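/- A \emph{switch graph} is a tuple $G=(V,E,s_0,s_1)$ with $V$ a finite set, $s_0,s_1:V\to V$ (the even and the odd successor; loops and $s_0(v)=s_1(v)$ are allowed) and $E=\{(v,s_0(v)):v\in V\}\cup\{(v,s_1(v)):v\in V\}$. For $o,d\in V$, the procedure $\mathrm{Run}(G,o,d)$ starts with $v:=o$ and the arrays $\mathtt{curr}=s_0$, $\mathtt{next}=s_1$; while $v\neq d$, it sets $w:=\mathtt{curr}[v]$, swaps $\mathtt{curr}[v]$ and $\mathtt{next}[v]$, and sets $v:=w$. The problem $\mathrm{ARRIVAL}$ is to decide, given $(G,o,d)$, whether $\mathrm{Run}(G,o,d)$ terminates. A \emph{dead end} of $(G,d)$ is a vertex from which there is no directed path (of length $\ge 0$) to $d$ in $(V,E)$. Let $\bar V=V\cup\{\bar d\}$ with a new vertex $\bar d$. Let $\bar G$ be a switch graph on $\bar V$ whose successor functions are given by $\bar s_0(w)=\bar s_1(w)=\bar d$ for every dead end $w$, by $\bar s_0(d)=\bar s_1(d)=d$, by $\bar s_i(v)=s_i(v)$ ($i=0,1$) for every other $v\in V$, and by arbitrary $\bar s_0(\bar d),\bar s_1(\bar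 d)\in\bar V$. \textbf{Theorem.} \begin{enumerate} \item $\mathrm{ARRIVAL}$ is in $\mathrm{coNP}$. That is, the complement in $\{0,1\}^*$ of the language of encodings of Yes-instances has a verifier that runs in polynomial time on a Turing machine and uses certificates of polynomial length. \item For every switch graph $G$, all $o,d\in V$ and every choice of $\bar s_0(\bar d),\bar s_1(\bar d)$: $\mathrm{Run}(G,o,d)$ terminates if and only if $\mathrm{Run}(\bar G,o,\bar d)$ does not terminate. \item There is a map, computable in polynomial time on a Turing machine, that sends every instance $(G,o,d)$ to an instance $(\bar G,o,\bar d)$ of this form, so that $(G,o,d)$ is a Yes-instance of $\mathrm{ARRIVAL}$ if and only if $(\bar G,o,\bar d)$ is a No-instance. \end{enumerate} Here an instance with vertices $0,\dots,n-1$ is encoded as a binary string that lists $n$, $o$, $d$ and then $s_0(v),s_1(v)$ for $v=0,\dots,n-1$, each number $k$ written as $1^k0$; in the encoding of $(\bar G,o,\bar d)$, the vertex $\bar d$ has the number $n$. -/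

import Mathlib

/-- A switch graph on the vertex set `V`: every vertex has an even successor `s₀` and an odd
successor `s₁` (possibly equal, and loops are allowed). -/
structure SwitchGraph (V : Type*) where
  s₀ : V → V
  s₁ : V → V

namespace SwitchGraph

variable {V W : Type*}

/-- The edge set `E = {(v, s₀ v)} ∪ {(v, s₁ v)}`. -/
def edges (G : SwitchGraph V) : Set (V × V) :=
  {e | ∃ v, e = (v, G.s₀ v)} ∪ {e | ∃ v, e = (v, G.s₁ v)}

/-- A state of the train run: the current vertex, and the two arrays `s_curr` and `s_next`. -/
structure State (V : Type*) where
  pos : V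
  curr : V → V
  next : V → V

/-- The state before the first iteration. -/
def start (G : SwitchGraph V) (o : V) : State V where
  pos := o
  curr := G.s₀
  next := G.s₁

/-- The body of the while loop: `w := s_curr[v]; swap (s_curr[v], s_next[v]); v := w`. -/
def State.advance [DecidableEq V] (σ : State V) : State V where
  pos := σ.curr σ.pos
  curr := Function.update σ.curr σ.pos (σ.next σ.pos)
  next := Function.update σ.next σ.pos (σ.curr σ.pos)

/-- The procedure `Run(G, o, d)` terminates: the loop, whose guard is `v ≠ d`, is left after
finitely many iterations of its body. -/
def RunTerminates [DecidableEq V] (G : SwitchGraph V) (o d : V) : Prop :=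
  ∃ k : ℕ, (State.advance^[k] (G.start o)).pos = d

/-- A dead end with respect to the destination `d`: a vertex from which there is no directed
path (of length `≥ 0`) to `d` in the graph `(V, E)`. -/
def IsDeadEnd (G : SwitchGraph V) (d w : V) : Prop :=
  ¬ Relation.ReflTransGen (fun u v => (u, v) ∈ G.edges) w d

open Classical in
/-- The graph `Ḡ` on `V ∪ {d̄}`, where `d̄ = none`: both successors of every dead end become `d̄`,
both successors of `d` become `d`, the successors of `d̄` are the given vertices `a` and `b`,
and nothing else changes. -/
noncomputable def bar (G : SwitchGraph V) (d : V) (a b : Option V) : SwitchGraph (Option V) where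
  s₀
    | none => a
    | some v => if G.IsDeadEnd d v then none else if v = d then some d else some (G.s₀ v)
  s₁
    | none => b
    | some v => if G.IsDeadEnd d v then none else if v = d then some d else some (G.s₁ v)

/-- Renaming the vertices along a bijection. -/
def rename (G : SwitchGraph V) (e : V ≃ W) : SwitchGraph W where
  s₀ w := e (G.s₀ (e.symm w))
  s₁ w := e (G.s₁ (e.symm w))

end SwitchGraph

/-- An instance `(G, o, d)` of ARRIVAL as an algorithm receives it, with vertices numbered
`0, …, n - 1`. -/
@[ext]
structure ArrivalInstance where
  n : ℕ
  G : SwitchGraph (Fin n)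
  o : Fin n
  d : Fin n

/-- The number `k` as `k` ones, followed by a zero. -/
def unaryCode (k : ℕ) : List Bool := List.replicate k true ++ [false]

theorem unaryCode_append_inj {k l : ℕ} {r s : List Bool}
    (h : unaryCode k ++ r = unaryCode l ++ s) : k = l ∧ r = s := by
  induction k generalizing l with
  | zero =>
    cases l with
    | zero => simpa [unaryCode] using h
    | succ l => simp [unaryCode, List.replicate_succ] at h
  | succ k ih =>
    cases l with
    | zero => simp [unaryCode, List.replicate_succ] at h
    | succ l =>
      have := @ih l (by simpa [unaryCode, List.replicate_succ] using h)
      exact ⟨by rw [this.1], this.2⟩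

namespace ArrivalInstance

/-- `Run(G, o, d)` terminates. -/
def Yes (I : ArrivalInstance) : Prop := I.G.RunTerminates I.o I.d

/-- The binary string encoding an instance: `n`, `o`, `d`, and then, for `v = 0, …, n - 1`, the
two successors of `v`. As all vertices are listed, the length of the string is at least `n`, so
writing the vertex numbers in unary changes it only polynomially compared with binary numbers. -/
def encode (I : ArrivalInstance) : List Bool :=
  unaryCode I.n ++ unaryCode I.o ++ unaryCode I.d ++
    (List.finRange I.n).flatMap fun v => unaryCode (I.G.s₀ v) ++ unaryCode (I.G.s₁ v)

theorem encode_injective : Function.Injective encode := by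
  rintro ⟨n, ⟨s₀, s₁⟩, o, d⟩ ⟨n', ⟨t₀, t₁⟩, o', d'⟩ h
  simp only [encode, List.append_assoc] at h
  obtain ⟨rfl, h⟩ := unaryCode_append_inj h
  obtain ⟨ho, h⟩ := unaryCode_append_inj h
  obtain ⟨hd, h⟩ := unaryCode_append_inj h
  have key : ∀ l : List (Fin n),
      (l.flatMap fun v => unaryCode (s₀ v) ++ unaryCode (s₁ v)) =
        (l.flatMap fun v => unaryCode (t₀ v) ++ unaryCode (t₁ v)) →
      ∀ v ∈ l, s₀ v = t₀ v ∧ s₁ v = t₁ v := by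
    intro l
    induction l with
    | nil => simp
    | cons u l ih =>
      intro h
      simp only [List.flatMap_cons, List.append_assoc] at h
      obtain ⟨h0, h⟩ := unaryCode_append_inj h
      obtain ⟨h1, h⟩ := unaryCode_append_inj h
      intro v hv
      rcases List.mem_cons.1 hv with rfl | hv
      · exact ⟨Fin.ext h0, Fin.ext h1⟩
      · exact ih h v hv
  have hs := key _ h
  obtain rfl : s₀ = t₀ := funext fun v => (hs v (List.mem_finRange v)).1
  obtain rfl : s₁ = t₁ := funext fun v => (hs v (List.mem_finRange v)).2
  obtain rfl := Fin.ext ho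
  obtain rfl := Fin.ext hd
  rfl

/-- The instance `(Ḡ, o, d̄)`; the old vertices keep their numbers, and `d̄` gets the number `n`. -/
noncomputable def bar (I : ArrivalInstance) (a b : Option (Fin I.n)) : ArrivalInstance where
  n := I.n + 1
  G := (I.G.bar I.d a b).rename finSuccEquivLast.symm
  o := finSuccEquivLast.symm (some I.o)
  d := finSuccEquivLast.symm none

end ArrivalInstance

/-- The language of (encodings of) Yes-instances of ARRIVAL. -/
def ARRIVAL : Language Bool := {x | ∃ I : ArrivalInstance, I.encode = x ∧ I.Yes}

/-- The pair of the binary strings `x` and `y` as the string `x#y`, with `none` as separator. -/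
def pairCode (z : List Bool × List Bool) : List (Option Bool) :=
  z.1.map some ++ none :: z.2.map some

/-- The class NP: `x ∈ L` iff there is a certificate of length polynomial in that of `x` that is
accepted, together with `x`, by a verifier running in polynomial time on a Turing machine. -/
def InNP (L : Language Bool) : Prop :=
  ∃ (p : Polynomial ℕ) (ver : List Bool × List Bool → Bool),
    Nonempty (Turing.TM2ComputableInPolyTime pairCode Computability.encodeBool ver) ∧
      ∀ x, x ∈ L ↔ ∃ y : List Bool, y.length ≤ p.eval x.length ∧ ver (x, y) = true

/-- The class coNP: the complements of the languages in NP. -/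
def InCoNP (L : Language Bool) : Prop := InNP Lᶜ

/-! Switching. Dead ends are closed under successors. If the train reaches `d`, it therefore meets
no dead end before, so the run in Ḡ is the same up to the first arrival at `d` and then loops there
forever. Otherwise some vertex is visited without bound, and so are both of its successors. If that
vertex had a path to `d`, then `d` would be visited, so it is a dead end. Up to the first dead end
the two runs agree, and Ḡ then moves on to d̄. This is `runTerminates_iff_not_bar`, and it rests on
`exists_pos_eq_or_isDeadEnd`.

Certificates. Let `c v` be the number of departures from `v` before the first dead end. A vertex
that is left `c` times uses its even edge ⌈c/2⌉ times and its odd edge ⌊c/2⌋ times, so flow is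
conserved at every live vertex (one that is no dead end), and `c d = 0`. Conversely, any `c` with `c
d = 0` that satisfies this balance at the live vertices dominates the true visit numbers, which
excludes an arrival at `d` (`not_runTerminates_of_inflow_le`). Before the first dead end no state of
position and switch parities repeats, so the numbers `c v` have at most 2n binary digits. The
certificate consists of the column totals of the binary additions in the balance equations: their
parities are the digits of `c`, each total is at most 4n + 1, and each equation relates neighbouring
columns only (`IsCertificate.not_runTerminates`, `exists_isCertificate`).

Polynomial time. Both algorithms are described by formulas of first-order logic with counting over
the positions of the input word. One set variable is available, whose definition is iterated as
often as the word is long; it computes the live vertices. Numbers are values of position variables,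
sums and block lengths are obtained by counting, and a column total is the multiplicity of a pair of
consecutive unary blocks. A formula is evaluated by sweeps over a tape with a fixed number of tracks
(`Fm.runsIn_code`), and sweeps are compiled to a stack machine (`Runs.stepsTo`). Every quantifier
costs a factor linear in the length of the word, so a fixed formula has polynomial cost.
`polyTime_of_printer` packages this; it is applied to the reduction in `polyTime_bar` and to the
verifier in `polyTime_verifier`. -/

/-! ### A while language for sweeps over a tape of fixed length -/

namespace Sweep

/-- Programs acting on flags in `Q`, a tape of cells in `C`, and a Boolean output string. -/
inductive Prog (Q C : Type)
  | load (f : Q → Q)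
  | sweep (δ : Q → C → Q × C)
  | emit (b : Bool)
  | seq (p q : Prog Q C)
  | ite (c : Q → Bool) (p q : Prog Q C)
  | loop (c : Q → Bool) (p : Prog Q C)

/-- The flags, the tape and the output of a program. -/
@[ext]
structure Conf (Q C : Type) where
  flags : Q
  tape : List C
  out : List Bool

variable {Q C : Type}

/-- The effect of a transducer that passes over the tape from its last cell to its first. -/
def transduce (δ : Q → C → Q × C) (q : Q) : List C → Q × List C
  | [] => (q, [])
  | a :: l =>
    let r := transduce δ q l
    let s := δ r.1 a
    (s.1, s.2 :: r.2)

/-- `Runs p s s' t`: the program `p` leads from `s` to `s'` at cost `t`. -/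
inductive Runs : Prog Q C → Conf Q C → Conf Q C → ℕ → Prop
  | load (f : Q → Q) (q T O) : Runs (.load f) ⟨q, T, O⟩ ⟨f q, T, O⟩ 1
  | sweep (δ : Q → C → Q × C) (q T O) :
      Runs (.sweep δ) ⟨q, T, O⟩ ⟨(transduce δ q T).1, (transduce δ q T).2, O⟩ (2 * T.length + 2)
  | emit (b : Bool) (q T O) : Runs (.emit b) ⟨q, T, O⟩ ⟨q, T, b :: O⟩ 1
  | seq {p₁ p₂ : Prog Q C} {s s' s'' t t'} : Runs p₁ s s' t → Runs p₂ s' s'' t' →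
      Runs (.seq p₁ p₂) s s'' (t + t')
  | ite_true {c : Q → Bool} {p₁ p₂ : Prog Q C} {s s' t} : c s.flags = true → Runs p₁ s s' t →
      Runs (.ite c p₁ p₂) s s' (t + 1)
  | ite_false {c : Q → Bool} {p₁ p₂ : Prog Q C} {s s' t} : c s.flags = false → Runs p₂ s s' t →
      Runs (.ite c p₁ p₂) s s' (t + 1)
  | loop_true {c : Q → Bool} {p : Prog Q C} {s s' s'' t t'} : c s.flags = true → Runs p s s' t →
      Runs (.loop c p) s' s'' t' → Runs (.loop c p) s s'' (t + t' + 1)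
  | loop_false {c : Q → Bool} {p : Prog Q C} {s} : c s.flags = false → Runs (.loop c p) s s 1

/-! ### Compilation to a stack machine -/

/-- The stacks: the input, the two halves of the tape, and the output. -/
inductive Stk
  | inp | left | right | out
  deriving DecidableEq

instance : Fintype Stk := ⟨{.inp, .left, .right, .out}, fun k => by cases k <;> simp⟩

/-- The stack alphabets. -/
def Alph (A C : Type) : Stk → Type
  | .inp => A
  | .left => C
  | .right => C
  | .out => Bool

/-- The contents of all stacks. -/
def stk4 {A C : Type} (i : List A) (l r : List C) (o : List Bool) : ∀ k, List (Alph A C k)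
  | .inp => i
  | .left => l
  | .right => r
  | .out => o

section stk4

variable {A : Type} (i i' : List A) (l r x : List C) (o o' : List Bool)

@[simp] theorem update_stk4_inp :
    Function.update (stk4 i l r o) .inp i' = stk4 i' l r o := by
  funext k; cases k <;> rfl

@[simp] theorem update_stk4_left :
    Function.update (stk4 i l r o) .left x = stk4 i x r o := by
  funext k; cases k <;> rfl

@[simp] theorem update_stk4_right :
    Function.update (stk4 i l r o) .right x = stk4 i l x o := by
  funext k; cases k <;> rfl

@[simp] theorem update_stk4_out :
    Function.update (stk4 i l r o) .out o' = stk4 i l r o' := by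
  funext k; cases k <;> rfl

end stk4

/-- The labels of the code of a program. -/
def Prog.Lab : Prog Q C → Type
  | .load _ => Unit
  | .sweep _ => Bool
  | .emit _ => Unit
  | .seq p q => p.Lab ⊕ q.Lab
  | .ite _ p q => Option (p.Lab ⊕ q.Lab)
  | .loop _ p => Option p.Lab

instance Prog.fintypeLab : (p : Prog Q C) → Fintype p.Lab
  | .load _ => inferInstanceAs (Fintype Unit)
  | .sweep _ => inferInstanceAs (Fintype Bool)
  | .emit _ => inferInstanceAs (Fintype Unit)
  | .seq p q =>
    letI := p.fintypeLab
    letI := q.fintypeLab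
    inferInstanceAs (Fintype (p.Lab ⊕ q.Lab))
  | .ite _ p q =>
    letI := p.fintypeLab
    letI := q.fintypeLab
    inferInstanceAs (Fintype (Option (p.Lab ⊕ q.Lab)))
  | .loop _ p =>
    letI := p.fintypeLab
    inferInstanceAs (Fintype (Option p.Lab))

/-- The label at which the code of a program is entered. -/
def Prog.entry : (p : Prog Q C) → p.Lab
  | .load _ => ()
  | .sweep _ => true
  | .emit _ => ()
  | .seq p _ => Sum.inl p.entry
  | .ite _ _ _ => none
  | .loop _ _ => none

open Turing

/-- Statements of the stack machine; the local variables are the flags and a buffer for a cell. -/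
abbrev SStmt (A Q C Λ : Type) := TM2.Stmt (Alph A C) Λ (Q × Option C)

/-- Pop a stack with cells into the buffer. -/
def popCell {A Λ : Type} (right : Bool) (s : SStmt A Q C Λ) : SStmt A Q C Λ :=
  match right with
  | true => TM2.Stmt.pop Stk.right (fun v a => (v.1, a)) s
  | false => TM2.Stmt.pop Stk.left (fun v a => (v.1, a)) s

/-- Push the buffer onto a stack with cells, and clear the buffer. -/
def pushCell {A Λ : Type} [Inhabited C] (right : Bool) (s : SStmt A Q C Λ) : SStmt A Q C Λ :=
  match right with
  | true => TM2.Stmt.push Stk.right (fun v => (v.2.getD default : C))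
      (TM2.Stmt.load (fun v => (v.1, none)) s)
  | false => TM2.Stmt.push Stk.left (fun v => (v.2.getD default : C))
      (TM2.Stmt.load (fun v => (v.1, none)) s)

/-- Push a bit onto the output stack. -/
def pushBit {A Λ : Type} (b : Bool) (s : SStmt A Q C Λ) : SStmt A Q C Λ :=
  TM2.Stmt.push Stk.out (fun _ => (b : Bool)) s

/-- Pop the input stack, and put the translated symbol into the buffer. -/
def popInput {A Λ : Type} (κ : A → C) (s : SStmt A Q C Λ) : SStmt A Q C Λ :=
  TM2.Stmt.pop Stk.inp (fun v (a : Option A) => (v.1, Option.map κ a)) s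

section stepAux

variable {A Λ : Type} (s : SStmt A Q C Λ) (v : Q × Option C) (i : List A) (l r : List C)
  (o : List Bool)

@[simp] theorem stepAux_popCell_right : TM2.stepAux (popCell true s) v (stk4 i l r o) =
    TM2.stepAux s (v.1, r.head?) (stk4 i l r.tail o) :=
  congrArg (TM2.stepAux s _) (update_stk4_right i l r r.tail o)

@[simp] theorem stepAux_popCell_left : TM2.stepAux (popCell false s) v (stk4 i l r o) =
    TM2.stepAux s (v.1, l.head?) (stk4 i l.tail r o) :=
  congrArg (TM2.stepAux s _) (update_stk4_left i l r l.tail o)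

@[simp] theorem stepAux_pushCell_right [Inhabited C] :
    TM2.stepAux (pushCell true s) v (stk4 i l r o) =
      TM2.stepAux s (v.1, none) (stk4 i l (v.2.getD default :: r) o) :=
  congrArg (TM2.stepAux s _) (update_stk4_right i l r (v.2.getD default :: r) o)

@[simp] theorem stepAux_pushCell_left [Inhabited C] :
    TM2.stepAux (pushCell false s) v (stk4 i l r o) =
      TM2.stepAux s (v.1, none) (stk4 i (v.2.getD default :: l) r o) :=
  congrArg (TM2.stepAux s _) (update_stk4_left i l r (v.2.getD default :: l) o)

@[simp] theorem stepAux_pushBit (b : Bool) : TM2.stepAux (pushBit b s) v (stk4 i l r o) =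
    TM2.stepAux s v (stk4 i l r (b :: o)) :=
  congrArg (TM2.stepAux s _) (update_stk4_out i l r o (b :: o))

@[simp] theorem stepAux_popInput (κ : A → C) : TM2.stepAux (popInput κ s) v (stk4 i l r o) =
    TM2.stepAux s (v.1, i.head?.map κ) (stk4 i.tail l r o) :=
  congrArg (TM2.stepAux s _) (update_stk4_inp i i.tail l r o)

end stepAux

/-- The label for the way to the end of the tape. -/
def entryR (δ : Q → C → Q × C) : (Prog.sweep δ).Lab := (true : Bool)

/-- The label for the way back. -/
def entryL (δ : Q → C → Q × C) : (Prog.sweep δ).Lab := (false : Bool)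

/-- The code of a program, whose labels are embedded by `emb`, and which is left to `exit`. -/
def Prog.code {A Λ : Type} [Inhabited C] :
    (p : Prog Q C) → (emb : p.Lab → Λ) → (exit : Λ) → p.Lab → SStmt A Q C Λ
  | .load f, _, exit, _ => TM2.Stmt.load (fun v => (f v.1, v.2)) (TM2.Stmt.goto fun _ => exit)
  | .sweep δ, emb, exit, l =>
    match (show Bool from l) with
    | true => popCell true <| TM2.Stmt.branch (fun v => v.2.isSome)
        (pushCell false <| TM2.Stmt.goto fun _ => emb (entryR δ))
        (TM2.Stmt.goto fun _ => emb (entryL δ))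
    | false => popCell false <| TM2.Stmt.branch (fun v => v.2.isSome)
        (TM2.Stmt.load (fun v => ((δ v.1 (v.2.getD default)).1,
            some (δ v.1 (v.2.getD default)).2)) <|
          pushCell true <| TM2.Stmt.goto fun _ => emb (entryL δ))
        (TM2.Stmt.goto fun _ => exit)
  | .emit b, _, exit, _ => pushBit b (TM2.Stmt.goto fun _ => exit)
  | .seq p q, emb, exit, l =>
    match (show p.Lab ⊕ q.Lab from l) with
    | .inl l => p.code (fun l => emb (Sum.inl l)) (emb (Sum.inr q.entry)) l
    | .inr l => q.code (fun l => emb (Sum.inr l)) exit l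
  | .ite c p q, emb, exit, l =>
    match (show Option (p.Lab ⊕ q.Lab) from l) with
    | none => TM2.Stmt.branch (fun v => c v.1)
        (TM2.Stmt.goto fun _ => emb (some (Sum.inl p.entry)))
        (TM2.Stmt.goto fun _ => emb (some (Sum.inr q.entry)))
    | some (.inl l) => p.code (fun l => emb (some (Sum.inl l))) exit l
    | some (.inr l) => q.code (fun l => emb (some (Sum.inr l))) exit l
  | .loop c p, emb, exit, l =>
    match (show Option p.Lab from l) with
    | none => TM2.Stmt.branch (fun v => c v.1)
        (TM2.Stmt.goto fun _ => emb (some p.entry)) (TM2.Stmt.goto fun _ => exit)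
    | some l => p.code (fun l => emb (some l)) (emb none) l

/-- Configurations of the stack machine. -/
abbrev SCfg (A Q C Λ : Type) := TM2.Cfg (Alph A C) Λ (Q × Option C)

/-- Reachability in a given number of steps. -/
def StepsTo {σ : Type*} (f : σ → Option σ) (t : ℕ) (a b : σ) : Prop :=
  (flip bind f)^[t] (some a) = some b

theorem StepsTo.refl {σ : Type*} (f : σ → Option σ) (a : σ) : StepsTo f 0 a a := rfl

theorem StepsTo.trans {σ : Type*} {f : σ → Option σ} {s t : ℕ} {a b c : σ}
    (h : StepsTo f s a b) (h' : StepsTo f t b c) : StepsTo f (s + t) a c := by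
  unfold StepsTo at *
  rw [Nat.add_comm, Function.iterate_add_apply, h, h']

theorem StepsTo.single {σ : Type*} {f : σ → Option σ} {a b : σ} (h : f a = some b) :
    StepsTo f 1 a b := h

theorem StepsTo.head {σ : Type*} {f : σ → Option σ} {t : ℕ} {a b c : σ}
    (h : f a = some b) (h' : StepsTo f t b c) : StepsTo f (t + 1) a c := by
  rw [Nat.add_comm]
  exact (StepsTo.single h).trans h'

/-- The configuration of the stack machine that corresponds to a configuration of a program, which
leaves the buffer and the left half of the tape empty. -/
def toCfg {A Λ : Type} (i : List A) (l : Λ) (s : Conf Q C) : SCfg A Q C Λ :=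
  ⟨some l, (s.flags, none), stk4 i [] s.tape s.out⟩

section

variable {A Λ : Type} [Inhabited C] (M : Λ → SStmt A Q C Λ)

theorem steps_right {lab lab' : Λ}
    (h : M lab = (popCell true <| TM2.Stmt.branch (fun v => v.2.isSome)
        (pushCell false <| TM2.Stmt.goto fun _ => lab) (TM2.Stmt.goto fun _ => lab')))
    (q : Q) (i : List A) (l r : List C) (o : List Bool) :
    StepsTo (TM2.step M) (r.length + 1) ⟨some lab, (q, none), stk4 i l r o⟩
      ⟨some lab', (q, none), stk4 i (r.reverse ++ l) [] o⟩ := by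
  induction r generalizing l with
  | nil => exact StepsTo.single (by simp [h])
  | cons a r ih =>
    refine StepsTo.head (b := ⟨some lab, (q, none), stk4 i (a :: l) r o⟩) ?_ ?_
    · simp [h]
    · simpa using ih (a :: l)

/-- The way to the end of the tape leaves the cells reversed on the left stack, so popping them
meets the last cell first. This is the order in which `transduce` works. -/
theorem steps_left {lab lab' : Λ} {δ : Q → C → Q × C}
    (h : M lab = (popCell false <| TM2.Stmt.branch (fun v => v.2.isSome)
        (TM2.Stmt.load (fun v => ((δ v.1 (v.2.getD default)).1,
            some (δ v.1 (v.2.getD default)).2)) <|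
          pushCell true <| TM2.Stmt.goto fun _ => lab)
        (TM2.Stmt.goto fun _ => lab')))
    (q : Q) (i : List A) (l : List C) (o : List Bool) :
    StepsTo (TM2.step M) (l.length + 1) ⟨some lab, (q, none), stk4 i l.reverse [] o⟩
      ⟨some lab', ((transduce δ q l).1, none), stk4 i [] (transduce δ q l).2 o⟩ := by
  -- The lower part `m` of the left stack and the finished part `r` are generalised: the first cell
  -- of the list lies below the others and is treated last.
  have key : ∀ m r, StepsTo (TM2.step M) l.length ⟨some lab, (q, none), stk4 i (l.reverse ++ m) r o⟩
      ⟨some lab, ((transduce δ q l).1, none), stk4 i m ((transduce δ q l).2 ++ r) o⟩ := by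
    induction l with
    | nil => intro m r; exact StepsTo.refl _ _
    | cons a l ih =>
      intro m r
      have := ih (a :: m) r
      rw [List.reverse_cons, List.append_assoc, List.singleton_append]
      refine this.trans (StepsTo.single ?_)
      simp [h, transduce]
  have h1 := key [] []
  rw [List.append_nil, List.append_nil] at h1
  exact h1.trans (StepsTo.single (by simp [h]))

/-- The costs in `Runs` are the exact step counts of the code. The embedding of labels and the exit
are quantified because the code of a subprogram sits in a larger label type; in a loop the second
hypothesis concerns the same loop and reuses both unchanged. -/
theorem Runs.stepsTo {p : Prog Q C} {s s' : Conf Q C} {t : ℕ} (hr : Runs p s s' t) (i : List A) :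
    ∀ (emb : p.Lab → Λ) (exit : Λ), (∀ l, M (emb l) = p.code emb exit l) →
      StepsTo (TM2.step M) t (toCfg i (emb p.entry) s) (toCfg i exit s') := by
  induction hr with
  | load f q T O =>
    intro emb exit h
    exact StepsTo.single (by simp [toCfg, h, Prog.code])
  | sweep δ q T O =>
    intro emb exit h
    have h1 := steps_right M (lab := emb (entryR δ))
      (lab' := emb (entryL δ)) (by rw [h]; rfl) q i [] T O
    have h2 := steps_left M (lab := emb (entryL δ)) (lab' := exit) (δ := δ)
      (by rw [h]; rfl) q i T O
    rw [List.append_nil] at h1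
    have := h1.trans h2
    rwa [show T.length + 1 + (T.length + 1) = 2 * T.length + 2 by ring] at this
  | emit b q T O =>
    intro emb exit h
    exact StepsTo.single (by simp [toCfg, h, Prog.code])
  | seq _ _ ih₁ ih₂ =>
    intro emb exit h
    exact (ih₁ _ _ fun l => h (Sum.inl l)).trans (ih₂ _ _ fun l => h (Sum.inr l))
  | ite_true hc _ ih =>
    intro emb exit h
    refine StepsTo.head ?_ (ih (fun l => emb (some (Sum.inl l))) _ fun l => h (some (Sum.inl l)))
    have := h none
    simp [toCfg, Prog.entry, this, Prog.code, hc]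
  | ite_false hc _ ih =>
    intro emb exit h
    refine StepsTo.head ?_ (ih (fun l => emb (some (Sum.inr l))) _ fun l => h (some (Sum.inr l)))
    have := h none
    simp [toCfg, Prog.entry, this, Prog.code, hc]
  | loop_true hc _ _ ih₁ ih₂ =>
    intro emb exit h
    refine StepsTo.head ?_ ((ih₁ (fun l => emb (some l)) _ fun l => h (some l)).trans
      (ih₂ emb exit h))
    have := h none
    simp [toCfg, Prog.entry, this, Prog.code, hc]
  | loop_false hc =>
    intro emb exit h
    refine StepsTo.single ?_
    have := h none
    simp [toCfg, Prog.entry, this, Prog.code, hc]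

end

/-! ### The machine with input and output -/

/-- The labels of the whole machine. -/
inductive MLab (Λ : Type)
  | read | rewind | prog (l : Λ) | clean

open Classical in
noncomputable instance {Λ : Type} [Fintype Λ] : Fintype (MLab Λ) :=
  Fintype.ofSurjective (fun l : Option (Option (Option Λ)) =>
    match l with
    | none => MLab.read
    | some none => MLab.rewind
    | some (some none) => MLab.clean
    | some (some (some l)) => MLab.prog l) fun l => by
    cases l with
    | read => exact ⟨none, rfl⟩
    | rewind => exact ⟨some none, rfl⟩
    | prog l => exact ⟨some (some (some l)), rfl⟩
    | clean => exact ⟨some (some none), rfl⟩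

/-- The code of the machine that writes its input, translated by `κ` and followed by the cells
`tl`, on the tape, runs the program `p`, and clears the tape. -/
def machineCode {A : Type} [Inhabited C] (q₀ : Q) (κ : A → C) (tl : Option C) (p : Prog Q C) :
    MLab p.Lab → SStmt A Q C (MLab p.Lab)
  | .read => popInput κ <| TM2.Stmt.branch (fun v => v.2.isSome)
      (pushCell false <| TM2.Stmt.goto fun _ => MLab.read)
      (TM2.Stmt.branch (fun _ => tl.isSome)
        (TM2.Stmt.load (fun v => (v.1, tl)) <|
          pushCell false <| TM2.Stmt.goto fun _ => MLab.rewind)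
        (TM2.Stmt.goto fun _ => MLab.rewind))
  | .rewind => popCell false <| TM2.Stmt.branch (fun v => v.2.isSome)
      (TM2.Stmt.load (fun v => (v.1, some (v.2.getD default))) <|
        pushCell true <| TM2.Stmt.goto fun _ => MLab.rewind)
      (TM2.Stmt.goto fun _ => MLab.prog p.entry)
  | .prog l => p.code MLab.prog MLab.clean l
  | .clean => popCell true <| TM2.Stmt.branch (fun v => v.2.isSome)
      (TM2.Stmt.load (fun v => (v.1, none)) <| TM2.Stmt.goto fun _ => MLab.clean)
      (TM2.Stmt.load (fun _ => (q₀, none)) <| TM2.Stmt.halt)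

/-- The machine with the code `machineCode`. -/
noncomputable def machine {A : Type} [Fintype A] [Fintype Q] [Fintype C] [Inhabited C]
    (q₀ : Q) (κ : A → C) (tl : Option C) (p : Prog Q C) : FinTM2 where
  K := Stk
  k₀ := Stk.inp
  k₁ := Stk.out
  Γ := Alph A C
  Λ := MLab p.Lab
  main := MLab.read
  ΛFin := inferInstance
  σ := Q × Option C
  σFin := inferInstance
  initialState := (q₀, none)
  Γk₀Fin := (inferInstance : Fintype A)
  m := machineCode q₀ κ tl p

/-- The rewinding phase of the machine is the way back of a sweep with this identity transducer, so
`steps_left` covers it. -/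
theorem transduce_id (q : Q) (l : List C) : transduce (fun q a => (q, a)) q l = (q, l) := by
  induction l with
  | nil => rfl
  | cons a l ih => simp [transduce, ih]

section

variable {A : Type} [Inhabited C] (q₀ : Q) (κ : A → C) (tl : Option C) (p : Prog Q C)

theorem machine_read (x : List A) (l : List C) :
    StepsTo (TM2.step (machineCode q₀ κ tl p)) (x.length + 1)
      (⟨some MLab.read, (q₀, none), stk4 x l [] []⟩ : SCfg A Q C (MLab p.Lab))
      ⟨some MLab.rewind, (q₀, none), stk4 [] ((x.map κ ++ tl.toList).reverse ++ l) [] []⟩ := by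
  induction x generalizing l with
  | nil =>
    refine StepsTo.single ?_
    cases tl <;> simp [machineCode]
  | cons a x ih =>
    refine StepsTo.head (b := (⟨some MLab.read, (q₀, none), stk4 x (κ a :: l) [] []⟩ :
      SCfg A Q C (MLab p.Lab))) ?_ ?_
    · simp [machineCode]
    · simpa using ih (κ a :: l)

/-- The halting configuration required by the computation model has the initial local state and no
stack content except the output, so flags and tape have to be reset. -/
theorem machine_clean (q : Q) (r : List C) (o : List Bool) :
    StepsTo (TM2.step (machineCode (A := A) q₀ κ tl p)) (r.length + 1)
      (⟨some MLab.clean, (q, none), stk4 [] [] r o⟩ : SCfg A Q C (MLab p.Lab))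
      ⟨none, (q₀, none), stk4 [] [] [] o⟩ := by
  induction r with
  | nil => exact StepsTo.single (by simp [machineCode])
  | cons a r ih =>
    refine StepsTo.head (b := (⟨some MLab.clean, (q, none), stk4 [] [] r o⟩ :
      SCfg A Q C (MLab p.Lab))) ?_ ih
    simp [machineCode]

theorem machine_run {x : List A} {T : List C} {s' : Conf Q C} {t : ℕ}
    (hT : x.map κ ++ tl.toList = T) (h : Runs p ⟨q₀, T, []⟩ s' t) :
    StepsTo (TM2.step (machineCode q₀ κ tl p))
      (x.length + 1 + (T.length + 1) + t + (s'.tape.length + 1))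
      (⟨some MLab.read, (q₀, none), stk4 x [] [] []⟩ : SCfg A Q C (MLab p.Lab))
      ⟨none, (q₀, none), stk4 [] [] [] s'.out⟩ := by
  have h1 := machine_read q₀ κ tl p x []
  rw [hT, List.append_nil] at h1
  have h2 := steps_left (machineCode q₀ κ tl p) (lab := MLab.rewind)
    (lab' := MLab.prog p.entry) (δ := fun q a => (q, a)) rfl q₀ ([] : List A) T []
  rw [transduce_id] at h2
  exact ((h1.trans h2).trans (h.stepsTo (machineCode q₀ κ tl p) ([] : List A) MLab.prog MLab.clean
    fun _ => rfl)).trans (machine_clean q₀ κ tl p s'.flags s'.tape s'.out)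

/-- A function is computed in polynomial time by a program, if the program produces the output at
polynomial cost. -/
theorem polyTime_of_runs [Fintype A] [Fintype Q] [Fintype C] {α β : Type}
    (ea : α → List A) (eb : β → List Bool) (f : α → β)
    (P : Polynomial ℕ)
    (h : ∀ a, ∃ s' t, Runs p ⟨q₀, (ea a).map κ ++ tl.toList, []⟩ s' t ∧ s'.out = eb (f a) ∧
      s'.tape.length = (ea a).length + tl.toList.length ∧ t ≤ P.eval (ea a).length) :
    Nonempty (TM2ComputableInPolyTime ea eb f) := by
  -- For an input of length n, reading costs n + 1, and rewinding and clearing cost n + |tl| + 1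
  -- each.
  refine ⟨⟨⟨machine q₀ κ tl p, Equiv.refl A, Equiv.refl Bool⟩,
    P + 3 * Polynomial.X + Polynomial.C (3 + 2 * tl.toList.length), fun a => ?_⟩⟩
  have ex : ∃ t, t ≤ (P + 3 * Polynomial.X + Polynomial.C (3 + 2 * tl.toList.length)).eval
      (ea a).length ∧ StepsTo (TM2.step (machineCode q₀ κ tl p)) t
        (⟨some MLab.read, (q₀, none), stk4 (ea a) [] [] []⟩ : SCfg A Q C (MLab p.Lab))
        ⟨none, (q₀, none), stk4 [] [] [] (eb (f a))⟩ := by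
    obtain ⟨s', t, hr, ho, hl, ht⟩ := h a
    refine ⟨_, ?_, ho ▸ machine_run q₀ κ tl p rfl hr⟩
    rw [hl]
    simp
    omega
  refine ⟨⟨ex.choose, ?_⟩, ex.choose_spec.1⟩
  have := ex.choose_spec.2
  have e1 : initList (machine q₀ κ tl p) (List.map (Equiv.refl A).invFun (ea a)) =
      (⟨some MLab.read, (q₀, none), stk4 (ea a) [] [] []⟩ : SCfg A Q C (MLab p.Lab)) := by
    unfold initList
    congr 1
    funext k
    cases k
    · exact List.map_id _
    all_goals rfl
  have e2 : haltList (machine (A := A) q₀ κ tl p) (List.map (Equiv.refl Bool).invFun (eb (f a))) =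
      (⟨none, (q₀, none), stk4 [] [] [] (eb (f a))⟩ : SCfg A Q C (MLab p.Lab)) := by
    unfold haltList
    congr 1
    funext k
    cases k
    case out => exact List.map_id _
    all_goals rfl
  exact (congrArg _ (congrArg some e1)).trans (Eq.trans this (congrArg some e2.symm))

end

end Sweep

/-! ### Elementary programs on tapes with tracks. -/

namespace Sweep

/-! ### Tapes with tracks -/

/-- A tape cell holds a symbol of the word `x#y` and `m` marks. -/
abbrev Cell (m : ℕ) := Option Bool × (Fin m → Bool)

/-- The mark of a cell on the track `k`. -/
def Cell.get {m : ℕ} (c : Cell m) (k : ℕ) : Bool := if h : k < m then c.2 ⟨k, h⟩ else false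

/-- Change the mark of a cell on the track `k`. -/
def Cell.put {m : ℕ} (c : Cell m) (k : ℕ) (b : Bool) : Cell m :=
  (c.1, fun i => if i.1 = k then b else c.2 i)

/-- The cell without marks. -/
def Cell.blank {m : ℕ} (s : Option Bool) : Cell m := (s, fun _ => false)

variable {m : ℕ}

theorem Cell.get_put (c : Cell m) {k : ℕ} (hk : k < m) (k' : ℕ) (b : Bool) :
    (c.put k b).get k' = if k' = k then b else c.get k' := by
  unfold Cell.get Cell.put
  by_cases h : k' < m
  · simp [h]
  · have : k' ≠ k := by omega
    simp [h, this]

@[simp] theorem Cell.put_fst (c : Cell m) (k : ℕ) (b : Bool) : (c.put k b).1 = c.1 := rfl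

@[simp] theorem Cell.get_blank (s : Option Bool) (k : ℕ) :
    (Cell.blank s : Cell m).get k = false := by
  simp [Cell.get, Cell.blank]

/-- The mark at the position `p` on the track `k`. -/
def mark (T : List (Cell m)) (k p : ℕ) : Bool := (T[p]?).elim false fun c => c.get k

@[simp] theorem mark_nil (k p : ℕ) : mark ([] : List (Cell m)) k p = false := rfl

@[simp] theorem mark_cons_zero (c : Cell m) (T : List (Cell m)) (k : ℕ) :
    mark (c :: T) k 0 = c.get k := rfl

@[simp] theorem mark_cons_succ (c : Cell m) (T : List (Cell m)) (k p : ℕ) :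
    mark (c :: T) k (p + 1) = mark T k p := by simp [mark]

theorem mark_eq_false {T : List (Cell m)} {k p : ℕ} (h : T.length ≤ p) : mark T k p = false := by
  simp [mark, List.getElem?_eq_none h]

theorem lt_of_mark {T : List (Cell m)} {k p : ℕ} (h : mark T k p = true) : p < T.length := by
  by_contra h'
  rw [mark_eq_false (not_lt.1 h')] at h
  cases h

theorem mark_map_blank (w : List (Option Bool)) (k p : ℕ) :
    mark (w.map (Cell.blank (m := m))) k p = false := by
  unfold mark
  rw [List.getElem?_map]
  cases w[p]? <;> simp

/-- Two tapes hold the same word, and the same marks on all tracks in `K`. -/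
def Same (K : ℕ → Prop) (T T' : List (Cell m)) : Prop :=
  T.map Prod.fst = T'.map Prod.fst ∧ ∀ k, K k → ∀ p, mark T k p = mark T' k p

theorem Same.refl (K : ℕ → Prop) (T : List (Cell m)) : Same K T T := ⟨rfl, fun _ _ _ => rfl⟩

theorem Same.trans {K : ℕ → Prop} {T T' T'' : List (Cell m)} (h : Same K T T')
    (h' : Same K T' T'') : Same K T T'' :=
  ⟨h.1.trans h'.1, fun k hk p => (h.2 k hk p).trans (h'.2 k hk p)⟩

theorem Same.mono {K K' : ℕ → Prop} {T T' : List (Cell m)} (h : Same K T T')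
    (hK : ∀ k, K' k → K k) : Same K' T T' :=
  ⟨h.1, fun k hk p => h.2 k (hK k hk) p⟩

theorem Same.length_eq {K : ℕ → Prop} {T T' : List (Cell m)} (h : Same K T T') :
    T'.length = T.length := by
  simpa using congrArg List.length h.1.symm

/-! ### Elementary programs -/

/-- The flags: the result of the last test, and an auxiliary flag. -/
abbrev Flags := Bool × Bool

/-- Programs on tapes with tracks. -/
abbrev TProg (m : ℕ) := Prog Flags (Cell m)

/-- `p` leads from `s` to `s'` at cost at most `B`. -/
def RunsIn (p : TProg m) (s s' : Conf Flags (Cell m)) (B : ℕ) : Prop := ∃ t ≤ B, Runs p s s' t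

theorem RunsIn.mono {p : TProg m} {s s' : Conf Flags (Cell m)} {B B' : ℕ} (h : RunsIn p s s' B)
    (hB : B ≤ B') : RunsIn p s s' B' :=
  let ⟨t, ht, hr⟩ := h
  ⟨t, ht.trans hB, hr⟩

theorem RunsIn.seq {p p' : TProg m} {s s' s'' : Conf Flags (Cell m)} {B B' : ℕ}
    (h : RunsIn p s s' B) (h' : RunsIn p' s' s'' B') : RunsIn (.seq p p') s s'' (B + B') :=
  let ⟨_, ht, hr⟩ := h
  let ⟨_, ht', hr'⟩ := h'
  ⟨_, Nat.add_le_add ht ht', hr.seq hr'⟩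

theorem RunsIn.ite_true {c : Flags → Bool} {p p' : TProg m} {s s' : Conf Flags (Cell m)} {B : ℕ}
    (hc : c s.flags = true) (h : RunsIn p s s' B) : RunsIn (.ite c p p') s s' (B + 1) :=
  let ⟨_, ht, hr⟩ := h
  ⟨_, Nat.add_le_add_right ht 1, Runs.ite_true hc hr⟩

theorem RunsIn.ite_false {c : Flags → Bool} {p p' : TProg m} {s s' : Conf Flags (Cell m)} {B : ℕ}
    (hc : c s.flags = false) (h : RunsIn p' s s' B) : RunsIn (.ite c p p') s s' (B + 1) :=
  let ⟨_, ht, hr⟩ := h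
  ⟨_, Nat.add_le_add_right ht 1, Runs.ite_false hc hr⟩

theorem RunsIn.loop_true {c : Flags → Bool} {p : TProg m} {s s' s'' : Conf Flags (Cell m)}
    {B B' : ℕ} (hc : c s.flags = true) (h : RunsIn p s s' B) (h' : RunsIn (.loop c p) s' s'' B') :
    RunsIn (.loop c p) s s'' (B + B' + 1) :=
  let ⟨_, ht, hr⟩ := h
  let ⟨_, ht', hr'⟩ := h'
  ⟨_, Nat.add_le_add_right (Nat.add_le_add ht ht') 1, Runs.loop_true hc hr hr'⟩

theorem RunsIn.load (f : Flags → Flags) (q : Flags) (T : List (Cell m)) (O : List Bool) :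
    RunsIn (.load f) ⟨q, T, O⟩ ⟨f q, T, O⟩ 1 :=
  ⟨1, le_rfl, Runs.load f q T O⟩

/-- Apply a function, which may depend on the result of the last test, to all cells. -/
def mapCells (g : Bool → Cell m → Cell m) : TProg m := .sweep fun q a => (q, g q.1 a)

theorem runsIn_mapCells (g : Bool → Cell m → Cell m) (q : Flags) (T : List (Cell m))
    (O : List Bool) : RunsIn (mapCells g) ⟨q, T, O⟩ ⟨q, T.map (g q.1), O⟩ (2 * T.length + 2) := by
  have : transduce (fun (q : Flags) a => (q, g q.1 a)) q T = (q, T.map (g q.1)) := by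
    induction T with
    | nil => rfl
    | cons a T ih => simp [transduce, ih]
  have h := Runs.sweep (fun (q : Flags) a => (q, g q.1 a)) q T O
  rw [this] at h
  exact ⟨_, le_rfl, h⟩

theorem mark_map (g : Cell m → Cell m) (T : List (Cell m)) (k p : ℕ) :
    mark (T.map g) k p = (T[p]?).elim false fun c => (g c).get k := by
  unfold mark
  rw [List.getElem?_map]
  cases T[p]? <;> rfl

/-- Write, on the track `k`, a mark that is computed from each cell. -/
def writeMark (k : ℕ) (g : Bool → Cell m → Bool) : TProg m := mapCells fun r c => c.put k (g r c)

theorem runsIn_writeMark {k : ℕ} (hk : k < m) (g : Bool → Cell m → Bool) (q : Flags)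
    (T : List (Cell m)) (O : List Bool) :
    ∃ T', RunsIn (writeMark k g) ⟨q, T, O⟩ ⟨q, T', O⟩ (2 * T.length + 2) ∧
      Same (· ≠ k) T T' ∧ ∀ p, mark T' k p = (T[p]?).elim false (g q.1) := by
  refine ⟨_, runsIn_mapCells _ q T O, ⟨by simp [Function.comp_def], fun k' hk' p => ?_⟩,
    fun p => ?_⟩
  · rw [mark_map]
    simp [Cell.get_put _ hk, hk', mark]
  · rw [mark_map]
    simp [Cell.get_put _ hk]

/-- Test whether a cell with a given property exists. -/
def testAny (P : Cell m → Bool) : TProg m :=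
  .seq (.load fun q => (false, q.2)) (.sweep fun q a => ((q.1 || P a, q.2), a))

theorem runsIn_testAny (P : Cell m → Bool) (q : Flags) (T : List (Cell m)) (O : List Bool) :
    RunsIn (testAny P) ⟨q, T, O⟩ ⟨(T.any P, q.2), T, O⟩ (2 * T.length + 3) := by
  have : transduce (fun (q : Flags) a => ((q.1 || P a, q.2), a)) (false, q.2) T =
      ((T.any P, q.2), T) := by
    induction T with
    | nil => rfl
    | cons a T ih => simp [transduce, ih, Bool.or_comm]
  have h := Runs.sweep (fun (q : Flags) a => ((q.1 || P a, q.2), a)) (false, q.2) T O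
  rw [this] at h
  exact ((RunsIn.load _ q T O).seq ⟨_, le_rfl, h⟩).mono (by omega)

theorem any_eq_true_iff_getElem? (P : Cell m → Bool) (T : List (Cell m)) :
    T.any P = true ↔ ∃ p : ℕ, (T[p]?).elim false P = true := by
  rw [List.any_eq_true]
  constructor
  · rintro ⟨c, hc, h⟩
    obtain ⟨p, hp⟩ := List.mem_iff_getElem?.1 hc
    exact ⟨p, by simp [hp, h]⟩
  · rintro ⟨p, hp⟩
    cases h : T[p]? with
    | none => simp [h] at hp
    | some c => exact ⟨c, List.mem_of_getElem? h, by simpa [h] using hp⟩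

/-- Move all marks on the track `k` towards the first cell, and write `b` into the last cell. -/
def shiftMarks (k : ℕ) (b : Bool) : TProg m :=
  .seq (.load fun q => (b, q.2)) (.sweep fun q a => ((a.get k, q.2), a.put k q.1))

/-- The sweep comes from the last cell, so the flag carries the old mark of the following position
into the present one; its initial value `b` ends up in the last cell. -/
theorem runsIn_shiftMarks {k : ℕ} (hk : k < m) (b : Bool) (q : Flags) (T : List (Cell m))
    (O : List Bool) :
    ∃ q' T', RunsIn (shiftMarks k b) ⟨q, T, O⟩ ⟨q', T', O⟩ (2 * T.length + 3) ∧
      Same (· ≠ k) T T' ∧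
      ∀ p, mark T' k p = if p + 1 = T.length then b else mark T k (p + 1) := by
  have key : ∀ T : List (Cell m),
      (transduce (fun (q : Flags) a => ((a.get k, q.2), a.put k q.1)) (b, q.2) T).1 =
        (if T.length = 0 then b else mark T k 0, q.2) ∧
      Same (· ≠ k) T
        (transduce (fun (q : Flags) a => ((a.get k, q.2), a.put k q.1)) (b, q.2) T).2 ∧
      ∀ p, mark (transduce (fun (q : Flags) a => ((a.get k, q.2), a.put k q.1)) (b, q.2) T).2 k p =
        if p + 1 = T.length then b else mark T k (p + 1) := by
    intro T
    induction T with
    | nil => exact ⟨rfl, Same.refl _ _, fun p => by simp [transduce]⟩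
    | cons a T ih =>
      obtain ⟨h1, h2, h3⟩ := ih
      refine ⟨by simp [transduce, h1], ⟨?_, ?_⟩, ?_⟩
      · simp [transduce, h2.1]
      · intro k' hk' p
        cases p with
        | zero => simp [transduce, Cell.get_put _ hk, hk']
        | succ p => simpa [transduce] using h2.2 k' hk' p
      · intro p
        cases p with
        | zero => simp [transduce, Cell.get_put _ hk, h1, eq_comm]
        | succ p => simpa [transduce] using h3 p
  have h := Runs.sweep (fun (q : Flags) a => ((a.get k, q.2), a.put k q.1)) (b, q.2) T O
  exact ⟨_, _, ((RunsIn.load _ q T O).seq ⟨_, le_rfl, h⟩).mono (by omega), (key T).2⟩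

/-- Test whether some mark on the track `x` lies before some mark on the track `y`. -/
def testBefore (x y : ℕ) : TProg m :=
  .seq (.load fun _ => (false, false))
    (.sweep fun q a => ((q.1 || (a.get x && q.2), q.2 || a.get y), a))

/-- The second flag remembers whether a mark on `y` has been passed. The first flag is updated with
its old value, which makes the comparison strict. -/
theorem runsIn_testBefore (x y : ℕ) (q : Flags) (T : List (Cell m)) (O : List Bool) :
    ∃ q', RunsIn (testBefore x y) ⟨q, T, O⟩ ⟨q', T, O⟩ (2 * T.length + 3) ∧
      (q'.1 = true ↔ ∃ p p', p < p' ∧ mark T x p = true ∧ mark T y p' = true) := by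
  have key : ∀ T : List (Cell m),
      (transduce (fun (q : Flags) a => ((q.1 || (a.get x && q.2), q.2 || a.get y), a))
        (false, false) T).2 = T ∧
      ((transduce (fun (q : Flags) a => ((q.1 || (a.get x && q.2), q.2 || a.get y), a))
        (false, false) T).1.1 = true ↔
          ∃ p p', p < p' ∧ mark T x p = true ∧ mark T y p' = true) ∧
      ((transduce (fun (q : Flags) a => ((q.1 || (a.get x && q.2), q.2 || a.get y), a))
        (false, false) T).1.2 = true ↔ ∃ p, mark T y p = true) := by
    intro T
    induction T with
    | nil => simp [transduce]
    | cons a T ih =>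
      obtain ⟨h1, h2, h3⟩ := ih
      refine ⟨by simp [transduce, h1], ?_, ?_⟩
      · simp only [transduce, Bool.or_eq_true, Bool.and_eq_true, h2, h3]
        constructor
        · rintro (⟨p, p', h, h'⟩ | ⟨h, p, hp⟩)
          · exact ⟨p + 1, p' + 1, by omega, by simpa using h'⟩
          · exact ⟨0, p + 1, by omega, by simpa using ⟨h, hp⟩⟩
        · rintro ⟨p, p', h, h', h''⟩
          obtain ⟨p', rfl⟩ : ∃ r, p' = r + 1 := ⟨p' - 1, by omega⟩
          rw [mark_cons_succ] at h''
          cases p with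
          | zero => exact Or.inr ⟨h', p', h''⟩
          | succ p => exact Or.inl ⟨p, p', by omega, by simpa using h', h''⟩
      · simp only [transduce, Bool.or_eq_true, h3]
        constructor
        · rintro (⟨p, hp⟩ | h)
          · exact ⟨p + 1, by simpa using hp⟩
          · exact ⟨0, h⟩
        · rintro ⟨p, hp⟩
          cases p with
          | zero => exact Or.inr hp
          | succ p => exact Or.inl ⟨p, by simpa using hp⟩
  have h := Runs.sweep (fun (q : Flags) a => ((q.1 || (a.get x && q.2), q.2 || a.get y), a))
    (false, false) T O
  rw [(key T).1] at h
  exact ⟨_, ((RunsIn.load _ q T O).seq ⟨_, le_rfl, h⟩).mono (by omega), (key T).2.1⟩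

/-- Test the mark of the first cell on the track `k`. -/
def testHead (k : ℕ) : TProg m :=
  .seq (.load fun q => (false, q.2)) (.sweep fun q a => ((a.get k, q.2), a))

theorem runsIn_testHead (k : ℕ) (q : Flags) (T : List (Cell m)) (O : List Bool) :
    RunsIn (testHead k) ⟨q, T, O⟩ ⟨(mark T k 0, q.2), T, O⟩ (2 * T.length + 3) := by
  have key : ∀ T : List (Cell m), transduce (fun (q : Flags) a => ((a.get k, q.2), a))
      (false, q.2) T = ((mark T k 0, q.2), T) := by
    intro T
    induction T with
    | nil => rfl
    | cons a T ih => simp [transduce, ih]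
  have h := Runs.sweep (fun (q : Flags) a => ((a.get k, q.2), a)) (false, q.2) T O
  rw [key] at h
  exact ((RunsIn.load _ q T O).seq ⟨_, le_rfl, h⟩).mono (by omega)

/-! ### Loops over all positions -/

/-- Run the program `B` once for every position, from the last one to the first one; the current
position is the one marked on the track `x`. -/
def forEach (x : ℕ) (B : TProg m) : TProg m :=
  .seq (writeMark x fun _ _ => false) <| .seq (shiftMarks x true) <|
    .seq (testAny fun c => c.get x) <| .loop (fun q => q.1) <|
      .seq B <| .seq (shiftMarks x false) <| testAny fun c => c.get x

/-- The loop invariant `P` depends on an abstract value `a`, which the body at position `v` turns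
into `f v a`. As positions are visited in descending order, the result is a right fold over the
range. -/
theorem runsIn_forEach {α : Type*} {x : ℕ} (hx : x < m) {B : TProg m} {N b : ℕ}
    (P : α → List (Cell m) → List Bool → Prop) (f : ℕ → α → α)
    (hP : ∀ a T T' O, Same (· ≠ x) T T' → P a T O → P a T' O)
    (hN : ∀ a T O, P a T O → T.length = N)
    (hB : ∀ v < N, ∀ a T O q, P a T O → (∀ p, mark T x p = (p == v)) →
      ∃ q' T' O', RunsIn B ⟨q, T, O⟩ ⟨q', T', O'⟩ b ∧ P (f v a) T' O' ∧
        ∀ p, mark T' x p = (p == v))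
    (a : α) (T : List (Cell m)) (O : List Bool) (q : Flags) (h : P a T O) :
    ∃ q' T' O', RunsIn (forEach x B) ⟨q, T, O⟩ ⟨q', T', O'⟩
      (N * (b + 4 * N + 7) + 6 * N + 9) ∧ P ((List.range N).foldr f a) T' O' := by
  have any_iff : ∀ T : List (Cell m), (T.any fun c => c.get x) = true ↔
      ∃ p, mark T x p = true := fun T => any_eq_true_iff_getElem? _ _
  -- Here `v` is the number of positions still to be treated, so the marked position `p` satisfies
  -- `p + 1 = v`. For `v = 0` the mark has left the tape, and the loop stops.
  have key : ∀ v ≤ N, ∀ a T O q, P a T O → (∀ p, mark T x p = (p + 1 == v)) →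
      ∃ q' T' O', RunsIn (.loop (fun q => q.1) <| .seq B <| .seq (shiftMarks x false) <|
          testAny fun c => c.get x)
        ⟨(T.any fun c => c.get x, q), T, O⟩ ⟨q', T', O'⟩ (v * (b + 4 * N + 7) + 1) ∧
        P ((List.range v).foldr f a) T' O' := by
    intro v
    induction v with
    | zero =>
      intro _ a T O q h hm
      have hf : (T.any fun c => c.get x) = false := by
        rw [Bool.eq_false_iff, ne_eq, any_iff]
        rintro ⟨p, hp⟩
        simp [hm] at hp
      exact ⟨_, T, O, ⟨1, by omega, Runs.loop_false hf⟩, h⟩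
    | succ v ih =>
      intro hv a T O q h hm
      have hf : (T.any fun c => c.get x) = true := by
        rw [any_iff]
        exact ⟨v, by simp [hm]⟩
      obtain ⟨q₁, T₁, O₁, hr₁, h₁, hm₁⟩ := hB v (by omega) a T O (_, q) h (by simpa using hm)
      obtain ⟨q₂, T₂, hr₂, hs₂, hm₂⟩ := runsIn_shiftMarks hx false q₁ T₁ O₁
      have hN₁ := hN _ _ _ h₁
      have hN₂ := hs₂.length_eq
      have h₂ := hP _ _ _ _ hs₂ h₁
      obtain ⟨q', T', O', hr, h'⟩ := ih (by omega) (f v a) T₂ O₁ q₂.2 h₂ (by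
        intro p
        rw [hm₂, hm₁]
        split_ifs with hp
        · symm
          rw [beq_eq_false_iff_ne]
          omega
        · rfl)
      refine ⟨q', T', O', (RunsIn.loop_true hf (hr₁.seq (hr₂.seq (runsIn_testAny _ _ _ _)))
        hr).mono ?_, ?_⟩
      · rw [hN₂, hN₁]
        ring_nf
        omega
      · rw [List.range_succ, List.foldr_append]
        exact h'
  obtain ⟨T₁, hr₁, hs₁, hm₁⟩ := runsIn_writeMark hx (fun _ _ => false) q T O
  obtain ⟨q₂, T₂, hr₂, hs₂, hm₂⟩ := runsIn_shiftMarks hx true q T₁ O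
  have h₂ := hP _ _ _ _ (hs₁.trans hs₂) h
  have hN₀ := hN _ _ _ h
  have hN₁ := hs₁.length_eq
  have hN₂ := hs₂.length_eq
  obtain ⟨q', T', O', hr, h'⟩ := key N le_rfl a T₂ O q₂.2 h₂ (by
    intro p
    have hz : mark T₁ x (p + 1) = false := by
      rw [hm₁]
      cases T[p + 1]? <;> rfl
    rw [hm₂, hN₁, hN₀, hz]
    by_cases hp : p + 1 = N <;> simp [hp])
  refine ⟨q', T', O', (hr₁.seq (hr₂.seq ((runsIn_testAny _ _ _ _).seq hr))).mono ?_, h'⟩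
  rw [hN₂, hN₁, hN₀]
  omega

end Sweep

namespace Sweep

/-! ### A logic with counting on words -/

/-- Formulas about positions in a word over `Option Bool`, with one set variable. A quantifier at
depth `d` binds the variable with the number `d`. -/
inductive Fm
  | letter (a : Option Bool) (x : ℕ)
  | lt (x y : ℕ)
  | mem (x : ℕ)
  | neg (φ : Fm)
  | and (φ ψ : Fm)
  | ex (φ : Fm)
  | cnt (φ : Fm) (y : ℕ)

/-- The truth value of a formula at depth `d` in the word `w`, where `X` is the value of the set
variable, and `ρ` gives the values of the variables. -/
def Fm.eval (w : List (Option Bool)) (X : ℕ → Bool) : ℕ → (ℕ → ℕ) → Fm → Bool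
  | _, ρ, .letter a x => w[ρ x]? == some a
  | _, ρ, .lt x y => decide (ρ x < ρ y)
  | _, ρ, .mem x => X (ρ x)
  | d, ρ, .neg φ => !φ.eval w X d ρ
  | d, ρ, .and φ ψ => φ.eval w X d ρ && ψ.eval w X d ρ
  | d, ρ, .ex φ => (List.range w.length).any fun v => φ.eval w X (d + 1) (Function.update ρ d v)
  | d, ρ, .cnt φ y =>
    (List.range w.length).countP (fun v => φ.eval w X (d + 1) (Function.update ρ d v)) == ρ y

/-- All variables of a formula at depth `d` are bound or less than `d`, and all depths are less
than `D`. -/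
def Fm.wf (D : ℕ) : ℕ → Fm → Bool
  | d, .letter _ x => decide (x < d)
  | d, .lt x y => decide (x < d) && decide (y < d)
  | d, .mem x => decide (x < d)
  | d, .neg φ => φ.wf D d
  | d, .and φ ψ => φ.wf D d && ψ.wf D d
  | d, .ex φ => decide (d < D) && φ.wf D (d + 1)
  | d, .cnt φ y => decide (d < D) && decide (y < d) && φ.wf D (d + 1)

/-- The track that marks the value of the variable `e`. -/
def numTrack (e : ℕ) : ℕ := 3 + 2 * e

/-- The track for the evaluation of the quantifier at depth `e`. -/
def auxTrack (e : ℕ) : ℕ := 4 + 2 * e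

variable {m : ℕ}

/-- The program that evaluates a formula at depth `d`. -/
def Fm.code : ℕ → Fm → TProg m
  | _, .letter a x => testAny fun c => c.get (numTrack x) && (c.1 == a)
  | _, .lt x y => testBefore (numTrack x) (numTrack y)
  | _, .mem x => testAny fun c => c.get (numTrack x) && c.get 0
  | d, .neg φ => .seq (φ.code d) (.load fun q => (!q.1, q.2))
  | d, .and φ ψ => .seq (φ.code d) (.ite (fun q => q.1) (ψ.code d) (.load id))
  | d, .ex φ => .seq (writeMark (auxTrack d) fun _ _ => false) <|
      .seq (forEach (numTrack d) (.seq (φ.code (d + 1))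
        (writeMark (auxTrack d) fun r c => r || c.get (auxTrack d)))) <|
      testAny fun c => c.get (auxTrack d)
  | d, .cnt φ y => .seq (writeMark (auxTrack d) fun _ c => c.get (numTrack y)) <|
      .seq (forEach (numTrack d) (.seq (φ.code (d + 1))
        (.ite (fun q => q.1) (shiftMarks (auxTrack d) false) (.load id)))) <|
      testHead (auxTrack d)

/-- A bound for the cost of a loop over all positions. -/
def forCost (b N : ℕ) : ℕ := N * (b + 4 * N + 7) + 6 * N + 9

/-- A bound for the cost of the evaluation of a formula. -/
def Fm.cost : Fm → ℕ → ℕ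
  | .letter _ _, N => 2 * N + 3
  | .lt _ _, N => 2 * N + 3
  | .mem _, N => 2 * N + 3
  | .neg φ, N => φ.cost N + 1
  | .and φ ψ, N => φ.cost N + ψ.cost N + 2
  | .ex φ, N => forCost (φ.cost N + 2 * N + 4) N + 4 * N + 5
  | .cnt φ _, N => forCost (φ.cost N + 2 * N + 4) N + 4 * N + 5

/-- The tape holds the word `w`, the set `X` and the values of the variables less than `d`. -/
structure Rep (w : List (Option Bool)) (X : ℕ → Bool) (d : ℕ) (ρ : ℕ → ℕ) (T : List (Cell m)) :
    Prop where
  word : T.map Prod.fst = w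
  set : ∀ p, mark T 0 p = X p
  num : ∀ e < d, ∀ p, mark T (numTrack e) p = (p == ρ e)

/-- The tracks that must not be changed by a program for the depth `d`. -/
def Below (d k : ℕ) : Prop := k < 3 + 2 * d

theorem Rep.congr {w : List (Option Bool)} {X : ℕ → Bool} {d : ℕ} {ρ : ℕ → ℕ}
    {T T' : List (Cell m)} (h : Rep w X d ρ T) (hs : Same (Below d) T T') : Rep w X d ρ T' where
  word := hs.1 ▸ h.word
  set p := (hs.2 0 (by unfold Below; omega) p) ▸ h.set p
  num e he p := (hs.2 (numTrack e) (by unfold Below numTrack; omega) p) ▸ h.num e he p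

theorem Rep.length_eq {w : List (Option Bool)} {X : ℕ → Bool} {d : ℕ} {ρ : ℕ → ℕ}
    {T : List (Cell m)} (h : Rep w X d ρ T) : T.length = w.length := by
  rw [← h.word, List.length_map]

theorem Rep.lt_length {w : List (Option Bool)} {X : ℕ → Bool} {d : ℕ} {ρ : ℕ → ℕ}
    {T : List (Cell m)} (h : Rep w X d ρ T) {e : ℕ} (he : e < d) : ρ e < w.length := by
  rw [← h.length_eq]
  exact lt_of_mark (k := numTrack e) (by simp [h.num e he])

theorem Rep.getElem?_map {w : List (Option Bool)} {X : ℕ → Bool} {d : ℕ} {ρ : ℕ → ℕ}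
    {T : List (Cell m)} (h : Rep w X d ρ T) (p : ℕ) : (T[p]?).map Prod.fst = w[p]? := by
  rw [← h.word, List.getElem?_map]

theorem Rep.update {w : List (Option Bool)} {X : ℕ → Bool} {d : ℕ} {ρ : ℕ → ℕ}
    {T : List (Cell m)} (h : Rep w X d ρ T) {v : ℕ}
    (hv : ∀ p, mark T (numTrack d) p = (p == v)) :
    Rep w X (d + 1) (Function.update ρ d v) T where
  word := h.word
  set := h.set
  num e he p := by
    rcases Nat.lt_succ_iff_lt_or_eq.1 he with he | rfl
    · rw [Function.update_of_ne he.ne, h.num e he]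
    · rw [Function.update_self, hv]

/-- A track that marks exactly one position turns an existential sweep into a lookup at this
position. Atomic formulas read the values of their variables in this way. -/
theorem exists_mark_and {T : List (Cell m)} {k v : ℕ} (hk : ∀ p, mark T k p = (p == v))
    (g : Cell m → Bool) :
    (T.any fun c => c.get k && g c) = true ↔ (T[v]?).elim false g = true := by
  rw [any_eq_true_iff_getElem?]
  have : ∀ p : ℕ, ((T[p]?).elim false fun c => c.get k && g c) =
      (mark T k p && (T[p]?).elim false g) := by
    intro p
    unfold mark
    cases T[p]? <;> rfl
  simp [this, hk]

theorem foldr_or (g : ℕ → Bool) (l : List ℕ) :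
    l.foldr (fun v a => g v || a) false = l.any g := by
  induction l with
  | nil => rfl
  | cons v l ih => simp [ih]

theorem foldr_count (g : ℕ → Bool) (l : List ℕ) :
    l.foldr (fun v a => a + if g v = true then 1 else 0) 0 = l.countP g := by
  induction l with
  | nil => rfl
  | cons v l ih => simp [ih, List.countP_cons]

/-- The induction carries along that a program for depth `d` leaves all tracks below 3 + 2d
unchanged. The two tracks of a quantifier at depth `d` lie just above this bound and below the bound
for depth `d + 1`, so the evaluation of its body preserves them. -/
theorem Fm.runsIn_code {w : List (Option Bool)} {X : ℕ → Bool} {D : ℕ} (hD : 3 + 2 * D ≤ m)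
    (φ : Fm) : ∀ (d : ℕ) (ρ : ℕ → ℕ) (T : List (Cell m)) (q : Flags) (O : List Bool),
      φ.wf D d = true → d ≤ D → Rep w X d ρ T →
      ∃ q' T', RunsIn (φ.code d) ⟨q, T, O⟩ ⟨q', T', O⟩ (φ.cost w.length) ∧
        q'.1 = φ.eval w X d ρ ∧ Same (Below d) T T' := by
  induction φ with
  | letter a x =>
    intro d ρ T q O hw _ h
    simp only [Fm.wf, decide_eq_true_eq] at hw
    refine ⟨_, T, (runsIn_testAny _ q T O).mono (by rw [h.length_eq, Fm.cost]), ?_, Same.refl _ _⟩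
    rw [Bool.eq_iff_iff]
    dsimp only
    rw [exists_mark_and (h.num x hw) (fun c => c.1 == a), Fm.eval, ← h.getElem?_map]
    cases T[ρ x]? <;> simp
  | lt x y =>
    intro d ρ T q O hw _ h
    simp only [Fm.wf, decide_eq_true_eq, Bool.and_eq_true] at hw
    obtain ⟨q', hr, hq⟩ := runsIn_testBefore (numTrack x) (numTrack y) q T O
    refine ⟨q', T, hr.mono (by rw [h.length_eq, Fm.cost]), ?_, Same.refl _ _⟩
    rw [Bool.eq_iff_iff, hq]
    simp [h.num x hw.1, h.num y hw.2, Fm.eval]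
  | mem x =>
    intro d ρ T q O hw _ h
    simp only [Fm.wf, decide_eq_true_eq] at hw
    refine ⟨_, T, (runsIn_testAny _ q T O).mono (by rw [h.length_eq, Fm.cost]), ?_, Same.refl _ _⟩
    rw [Bool.eq_iff_iff]
    dsimp only
    rw [exists_mark_and (h.num x hw) (fun c => c.get 0), Fm.eval, ← h.set]
    rfl
  | neg φ ih =>
    intro d ρ T q O hw hd h
    obtain ⟨q', T', hr, hq, hs⟩ := ih d ρ T q O hw hd h
    exact ⟨_, T', hr.seq (RunsIn.load _ _ _ _), by simp [Fm.eval, hq], hs⟩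
  | and φ ψ ihφ ihψ =>
    intro d ρ T q O hw hd h
    simp only [Fm.wf, Bool.and_eq_true] at hw
    obtain ⟨q', T', hr, hq, hs⟩ := ihφ d ρ T q O hw.1 hd h
    cases he : φ.eval w X d ρ with
    | false =>
      refine ⟨q', T', (hr.seq (RunsIn.ite_false (c := fun q => q.1) (hq.trans he)
        (RunsIn.load id q' T' O))).mono ?_, by simp [Fm.eval, hq, he], hs⟩
      simp only [Fm.cost]
      omega
    | true =>
      obtain ⟨q'', T'', hr', hq', hs'⟩ := ihψ d ρ T' q' O hw.2 hd (h.congr hs)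
      refine ⟨q'', T'', (hr.seq (RunsIn.ite_true (c := fun q => q.1) (hq.trans he) hr')).mono ?_,
        by simp [Fm.eval, hq', he], hs.trans hs'⟩
      simp only [Fm.cost]
      omega
  | ex φ ih =>
    intro d ρ T q O hw hd h
    simp only [Fm.wf, Bool.and_eq_true, decide_eq_true_eq] at hw
    have hx : numTrack d < m := by unfold numTrack; omega
    have ha : auxTrack d < m := by unfold auxTrack; omega
    have hax : auxTrack d ≠ numTrack d := by unfold auxTrack numTrack; omega
    obtain ⟨T₁, hr₁, hs₁, hm₁⟩ := runsIn_writeMark ha (fun _ _ => false) q T O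
    have hL := h.length_eq
    set g : ℕ → Bool := fun v => φ.eval w X (d + 1) (Function.update ρ d v) with hg
    -- The auxiliary track holds the disjunction of the truth values found so far, repeated in every
    -- cell.
    obtain ⟨q₂, T₂, O₂, hr₂, ⟨hs₂, rfl, hm₂⟩⟩ := runsIn_forEach (α := Bool) hx
      (N := w.length) (b := φ.cost w.length + 2 * w.length + 4)
      (B := .seq (φ.code (d + 1)) (writeMark (auxTrack d) fun r c => r || c.get (auxTrack d)))
      (fun a T' O' => Same (Below d) T T' ∧ O' = O ∧ ∀ p < w.length, mark T' (auxTrack d) p = a)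
      (fun v a => g v || a)
      (fun a T' T'' O' hs hP => ⟨hP.1.trans (hs.mono fun k hk => by
          unfold Below at hk; unfold numTrack; omega), hP.2.1,
          fun p hp => (hs.2 _ hax p) ▸ hP.2.2 p hp⟩)
      (fun a T' O' hP => hP.1.length_eq.trans hL)
      (fun v hv a T' O' q' hP hm => by
        obtain ⟨hs, rfl, hma⟩ := hP
        obtain ⟨q₃, T₃, hr₃, hq₃, hs₃⟩ := ih (d + 1) _ T' q' O' hw.2 hw.1 ((h.congr hs).update hm)
        obtain ⟨T₄, hr₄, hs₄, hm₄⟩ := runsIn_writeMark ha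
          (fun r c => r || c.get (auxTrack d)) q₃ T₃ O'
        have hL₃ : T₃.length = w.length := hs₃.length_eq.trans (hs.length_eq.trans hL)
        refine ⟨q₃, T₄, O', (hr₃.seq hr₄).mono (by rw [hL₃]; omega),
          ⟨hs.trans ((hs₃.mono fun k hk => by unfold Below at *; omega).trans
            (hs₄.mono fun k hk => by unfold Below at hk; unfold auxTrack; omega)), rfl, ?_⟩, ?_⟩
        · intro p hp
          have h₃ : mark T₃ (auxTrack d) p = a := by
            rw [← hs₃.2 _ (by unfold Below auxTrack; omega) p]
            exact hma p hp
          unfold mark at h₃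
          rw [hm₄]
          rw [List.getElem?_eq_getElem (by omega)] at h₃ ⊢
          simp only [Option.elim] at h₃ ⊢
          rw [h₃, hq₃]
        · intro p
          rw [← hs₄.2 _ hax.symm, ← hs₃.2 _ (by unfold Below numTrack; omega), hm])
      false T₁ O q ⟨hs₁.mono fun k hk => by unfold Below at hk; unfold auxTrack; omega, rfl,
        fun p hp => by rw [hm₁]; cases T[p]? <;> rfl⟩
    have hL₂ : T₂.length = w.length := hs₂.length_eq.trans hL
    refine ⟨_, T₂, (hr₁.seq (hr₂.seq (runsIn_testAny _ _ _ _))).mono ?_, ?_, hs₂⟩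
    · rw [hL₂, hL, Fm.cost, forCost]
      omega
    · rw [foldr_or] at hm₂
      dsimp only
      rw [Fm.eval, Bool.eq_iff_iff, any_eq_true_iff_getElem?]
      constructor
      · rintro ⟨p, hp⟩
        have hlt : p < w.length := hL₂ ▸ lt_of_mark (k := auxTrack d) hp
        exact (hm₂ p hlt).symm.trans hp
      · intro he
        obtain ⟨v, hv, -⟩ := List.any_eq_true.1 he
        exact ⟨v, (hm₂ v (List.mem_range.1 hv)).trans he⟩
  | cnt φ y ih =>
    intro d ρ T q O hw hd h
    simp only [Fm.wf, Bool.and_eq_true, decide_eq_true_eq] at hw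
    have hx : numTrack d < m := by unfold numTrack; omega
    have ha : auxTrack d < m := by unfold auxTrack; omega
    have hax : auxTrack d ≠ numTrack d := by unfold auxTrack numTrack; omega
    obtain ⟨T₁, hr₁, hs₁, hm₁⟩ := runsIn_writeMark ha (fun _ c => c.get (numTrack y)) q T O
    have hL := h.length_eq
    have hy := h.lt_length hw.1.2
    set g : ℕ → Bool := fun v => φ.eval w X (d + 1) (Function.update ρ d v) with hg
    -- The auxiliary track works as a counter: its mark starts at `ρ y` and moves one cell towards
    -- the front for each witness. It stands on the first cell at the end exactly if the number of
    -- witnesses is `ρ y`; a larger number pushes it off the tape.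
    obtain ⟨q₂, T₂, O₂, hr₂, ⟨hs₂, rfl, hm₂⟩⟩ := runsIn_forEach (α := ℕ) hx
      (N := w.length) (b := φ.cost w.length + 2 * w.length + 4)
      (B := .seq (φ.code (d + 1))
        (.ite (fun q => q.1) (shiftMarks (auxTrack d) false) (.load id)))
      (fun a T' O' => Same (Below d) T T' ∧ O' = O ∧
        ∀ p < w.length, mark T' (auxTrack d) p = (p + a == ρ y))
      (fun v a => a + if g v = true then 1 else 0)
      (fun a T' T'' O' hs hP => ⟨hP.1.trans (hs.mono fun k hk => by
          unfold Below at hk; unfold numTrack; omega), hP.2.1,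
          fun p hp => (hs.2 _ hax p) ▸ hP.2.2 p hp⟩)
      (fun a T' O' hP => hP.1.length_eq.trans hL)
      (fun v hv a T' O' q' hP hm => by
        obtain ⟨hs, rfl, hma⟩ := hP
        obtain ⟨q₃, T₃, hr₃, hq₃, hs₃⟩ := ih (d + 1) _ T' q' O' hw.2 hw.1.1
          ((h.congr hs).update hm)
        have hL₃ : T₃.length = w.length := hs₃.length_eq.trans (hs.length_eq.trans hL)
        have hs₃' : Same (Below d) T T₃ :=
          hs.trans (hs₃.mono fun k hk => by unfold Below at *; omega)
        have hma₃ : ∀ p < w.length, mark T₃ (auxTrack d) p = (p + a == ρ y) := fun p hp => by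
          rw [← hs₃.2 _ (by unfold Below auxTrack; omega), hma p hp]
        have hm₃ : ∀ p, mark T₃ (numTrack d) p = (p == v) := fun p => by
          rw [← hs₃.2 _ (by unfold Below numTrack; omega), hm]
        cases he : g v with
        | false =>
          refine ⟨q₃, T₃, O', (hr₃.seq (RunsIn.ite_false (c := fun q => q.1) (hq₃.trans he)
            (RunsIn.load id q₃ T₃ O'))).mono (by omega), ⟨hs₃', rfl, ?_⟩, hm₃⟩
          simpa using hma₃
        | true =>
          obtain ⟨q₄, T₄, hr₄, hs₄, hm₄⟩ := runsIn_shiftMarks ha false q₃ T₃ O'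
          refine ⟨q₄, T₄, O', (hr₃.seq (RunsIn.ite_true (c := fun q => q.1) (hq₃.trans he)
            hr₄)).mono (by omega), ⟨hs₃'.trans (hs₄.mono fun k hk => by
              unfold Below at hk; unfold auxTrack; omega), rfl, ?_⟩, fun p => ?_⟩
          · intro p hp
            rw [hm₄, hL₃, if_pos rfl]
            split_ifs with hp'
            -- The empty mark that enters at the last cell is correct because `ρ y` is less than the
            -- length of the word.
            · symm
              rw [beq_eq_false_iff_ne]
              omega
            · rw [hma₃ _ (by omega), show p + 1 + a = p + (a + 1) by omega]
          · rw [← hs₄.2 _ hax.symm, hm₃])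
      0 T₁ O q ⟨hs₁.mono fun k hk => by unfold Below at hk; unfold auxTrack; omega, rfl,
        fun p hp => by
          rw [hm₁]
          exact h.num y hw.1.2 p⟩
    have hL₂ : T₂.length = w.length := hs₂.length_eq.trans hL
    refine ⟨_, T₂, (hr₁.seq (hr₂.seq (runsIn_testHead _ _ _ _))).mono ?_, ?_, hs₂⟩
    · rw [hL₂, hL, Fm.cost, forCost]
      omega
    · rw [foldr_count] at hm₂
      dsimp only
      rw [Fm.eval, hm₂ 0 (by omega), zero_add]

/-! ### Printers -/

/-- Descriptions of output strings. A loop at depth `d` binds the variable with the number `d`. -/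
inductive Printer
  | nil
  | bit (b : Bool)
  | append (p q : Printer)
  | ite (φ : Fm) (p q : Printer)
  | each (p : Printer)

/-- The output string of a printer. -/
def Printer.eval (w : List (Option Bool)) (X : ℕ → Bool) : ℕ → (ℕ → ℕ) → Printer → List Bool
  | _, _, .nil => []
  | _, _, .bit b => [b]
  | d, ρ, .append p q => p.eval w X d ρ ++ q.eval w X d ρ
  | d, ρ, .ite φ p q => if φ.eval w X d ρ = true then p.eval w X d ρ else q.eval w X d ρ
  | d, ρ, .each p =>
    (List.range w.length).flatMap fun v => p.eval w X (d + 1) (Function.update ρ d v)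

/-- The formulas in a printer at depth `d` are well-formed. -/
def Printer.wf (D : ℕ) : ℕ → Printer → Bool
  | _, .nil => true
  | _, .bit _ => true
  | d, .append p q => p.wf D d && q.wf D d
  | d, .ite φ p q => φ.wf D d && p.wf D d && q.wf D d
  | d, .each p => decide (d < D) && p.wf D (d + 1)

/-- The program of a printer at depth `d`. It produces the output from the end to the beginning. -/
def Printer.code : ℕ → Printer → TProg m
  | _, .nil => .load id
  | _, .bit b => .emit b
  | d, .append p q => .seq (q.code d) (p.code d)
  | d, .ite φ p q => .seq (φ.code d) (.ite (fun q => q.1) (p.code d) (q.code d))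
  | d, .each p => forEach (numTrack d) (p.code (d + 1))

/-- A bound for the cost of a printer. -/
def Printer.cost : Printer → ℕ → ℕ
  | .nil, _ => 1
  | .bit _, _ => 1
  | .append p q, N => p.cost N + q.cost N
  | .ite φ p q, N => φ.cost N + p.cost N + q.cost N + 1
  | .each p, N => forCost (p.cost N) N

theorem foldr_append_eq_flatMap (g : ℕ → List Bool) (l : List ℕ) :
    l.foldr (fun v a => g v ++ a) [] = l.flatMap g := by
  induction l with
  | nil => rfl
  | cons v l ih => simp [ih]

/-- The output is a stack, so strings are produced from their end. The descending order of `forEach`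
then gives the concatenation in ascending order. -/
theorem Printer.runsIn_code {w : List (Option Bool)} {X : ℕ → Bool} {D : ℕ} (hD : 3 + 2 * D ≤ m)
    (π : Printer) : ∀ (d : ℕ) (ρ : ℕ → ℕ) (T : List (Cell m)) (q : Flags) (O : List Bool),
      π.wf D d = true → d ≤ D → Rep w X d ρ T →
      ∃ q' T', RunsIn (π.code d) ⟨q, T, O⟩ ⟨q', T', π.eval w X d ρ ++ O⟩ (π.cost w.length) ∧
        Same (Below d) T T' := by
  induction π with
  | nil =>
    intro d ρ T q O _ _ _
    exact ⟨q, T, RunsIn.load id q T O, Same.refl _ _⟩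
  | bit b =>
    intro d ρ T q O _ _ _
    exact ⟨q, T, ⟨1, le_rfl, Runs.emit b q T O⟩, Same.refl _ _⟩
  | append π₁ π₂ ih₁ ih₂ =>
    intro d ρ T q O hw hd h
    simp only [Printer.wf, Bool.and_eq_true] at hw
    obtain ⟨q₂, T₂, hr₂, hs₂⟩ := ih₂ d ρ T q O hw.2 hd h
    obtain ⟨q₁, T₁, hr₁, hs₁⟩ := ih₁ d ρ T₂ q₂ _ hw.1 hd (h.congr hs₂)
    refine ⟨q₁, T₁, ?_, hs₂.trans hs₁⟩
    rw [Printer.eval, List.append_assoc]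
    exact (hr₂.seq hr₁).mono (by rw [Printer.cost, Nat.add_comm])
  | ite φ π₁ π₂ ih₁ ih₂ =>
    intro d ρ T q O hw hd h
    simp only [Printer.wf, Bool.and_eq_true] at hw
    obtain ⟨q', T', hr, hq, hs⟩ := φ.runsIn_code hD d ρ T q O hw.1.1 hd h
    cases he : φ.eval w X d ρ with
    | false =>
      obtain ⟨q₂, T₂, hr₂, hs₂⟩ := ih₂ d ρ T' q' O hw.2 hd (h.congr hs)
      refine ⟨q₂, T₂, ?_, hs.trans hs₂⟩
      rw [Printer.eval, if_neg (by simp [he])]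
      exact (hr.seq (RunsIn.ite_false (c := fun q => q.1) (hq.trans he) hr₂)).mono
        (by rw [Printer.cost]; omega)
    | true =>
      obtain ⟨q₂, T₂, hr₂, hs₂⟩ := ih₁ d ρ T' q' O hw.1.2 hd (h.congr hs)
      refine ⟨q₂, T₂, ?_, hs.trans hs₂⟩
      rw [Printer.eval, if_pos he]
      exact (hr.seq (RunsIn.ite_true (c := fun q => q.1) (hq.trans he) hr₂)).mono
        (by rw [Printer.cost]; omega)
  | each π ih =>
    intro d ρ T q O hw hd h
    simp only [Printer.wf, Bool.and_eq_true, decide_eq_true_eq] at hw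
    have hx : numTrack d < m := by unfold numTrack; omega
    obtain ⟨q', T', O', hr, hs, rfl⟩ := runsIn_forEach (α := List Bool) hx
      (N := w.length) (b := π.cost w.length) (B := π.code (d + 1))
      (fun a T' O' => Same (Below d) T T' ∧ O' = a ++ O)
      (fun v a => π.eval w X (d + 1) (Function.update ρ d v) ++ a)
      (fun a T' T'' O' hs hP => ⟨hP.1.trans (hs.mono fun k hk => by
          unfold Below at hk; unfold numTrack; omega), hP.2⟩)
      (fun a T' O' hP => hP.1.length_eq.trans h.length_eq)
      (fun v hv a T' O' q' hP hm => by
        obtain ⟨hs, rfl⟩ := hP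
        obtain ⟨q₃, T₃, hr₃, hs₃⟩ := ih (d + 1) _ T' q' (a ++ O) hw.2 hw.1
          ((h.congr hs).update hm)
        refine ⟨q₃, T₃, _, hr₃, ⟨hs.trans (hs₃.mono fun k hk => by unfold Below at *; omega), ?_⟩,
          fun p => ?_⟩
        · rw [List.append_assoc]
        · rw [← hs₃.2 _ (by unfold Below numTrack; omega), hm])
      [] T O q ⟨Same.refl _ _, rfl⟩
    rw [foldr_append_eq_flatMap] at hr
    exact ⟨q', T', hr, hs⟩

end Sweep

namespace Sweep

variable {m : ℕ}

/-! ### Iterated definitions of sets -/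

/-- The set defined by a formula at depth `1` in terms of the set `X`. -/
def stepSet (w : List (Option Bool)) (φ : Fm) (X : ℕ → Bool) : ℕ → Bool :=
  fun p => decide (p < w.length) && φ.eval w X 1 (Function.update (fun _ => 0) 0 p)

/-- The program that iterates the definition of a set. -/
def iterCode (φ : Fm) : TProg m :=
  forEach 2 <| .seq (writeMark 1 fun _ _ => false) <| .seq
    (forEach (numTrack 0) <| .seq (φ.code 1) <|
      writeMark 1 fun r c => c.get 1 || (r && c.get (numTrack 0))) <|
    writeMark 0 fun _ c => c.get 1

/-- A bound for the cost of `iterCode`. -/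
def iterCost (φ : Fm) (N : ℕ) : ℕ := forCost (forCost (φ.cost N + 2 * N + 2) N + 4 * N + 4) N

theorem foldr_set (g : ℕ → Bool) (l : List ℕ) (p : ℕ) :
    l.foldr (fun v (a : ℕ → Bool) p => a p || (g v && p == v)) (fun _ => false) p =
      l.any fun v => g v && p == v := by
  induction l with
  | nil => rfl
  | cons v l ih => simp [ih, Bool.or_comm]

theorem foldr_iterate {α : Type*} (s : α → α) (a : α) (n : ℕ) :
    (List.range n).foldr (fun _ b => s b) a = s^[n] a := by
  induction n generalizing a with
  | zero => rfl
  | succ n ih => rw [List.range_succ, List.foldr_append, Function.iterate_succ_apply]; exact ih _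

/-- The new set is collected on track 1 while the formula still reads the old set on track 0, and it
is copied when the pass is complete. The outer loop over positions, on track 2, serves only to
repeat this as often as the word is long. -/
theorem runsIn_iterCode {w : List (Option Bool)} {D : ℕ} (hD : 3 + 2 * D ≤ m) (hD' : 1 ≤ D)
    {φ : Fm} (hφ : φ.wf D 1 = true) (X : ℕ → Bool) (ρ : ℕ → ℕ) (T : List (Cell m)) (q : Flags)
    (O : List Bool) (h : Rep w X 0 ρ T) :
    ∃ q' T', RunsIn (iterCode φ) ⟨q, T, O⟩ ⟨q', T', O⟩ (iterCost φ w.length) ∧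
      Rep w ((stepSet w φ)^[w.length] X) 0 ρ T' := by
  have inner : ∀ (X : ℕ → Bool) (T : List (Cell m)) (q : Flags), Rep w X 0 ρ T →
      (∀ p, mark T 1 p = false) → ∃ q' T',
      RunsIn (forEach (numTrack 0) <| .seq (φ.code 1) <|
        writeMark 1 fun r c => c.get 1 || (r && c.get (numTrack 0))) ⟨q, T, O⟩ ⟨q', T', O⟩
        (forCost (φ.cost w.length + 2 * w.length + 2) w.length) ∧
      (∀ p, mark T' 1 p = stepSet w φ X p) ∧
      Same (fun k => k = 0 ∨ k = 2) T T' := by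
    -- The inner loop has to preserve only the old set and the round counter; the other tracks are
    -- scratch space at this point.
    intro X T q h hz
    set g : ℕ → Bool := fun v => φ.eval w X 1 (Function.update (fun _ => 0) 0 v) with hg
    obtain ⟨q', T', O', hr, hs, rfl, hm'⟩ := runsIn_forEach (α := ℕ → Bool) (x := numTrack 0)
      (by unfold numTrack; omega) (N := w.length) (b := φ.cost w.length + 2 * w.length + 2)
      (B := .seq (φ.code 1) <| writeMark 1 fun r c => c.get 1 || (r && c.get (numTrack 0)))
      (fun a T' O' => Same (fun k => k = 0 ∨ k = 2) T T' ∧ O' = O ∧ ∀ p, mark T' 1 p = a p)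
      (fun v a p => a p || (g v && p == v))
      (fun a T' T'' O' hs hP => ⟨hP.1.trans (hs.mono fun k hk => by
          unfold numTrack; omega), hP.2.1,
          fun p => (hs.2 1 (by unfold numTrack; omega) p) ▸ hP.2.2 p⟩)
      (fun a T' O' hP => hP.1.length_eq.trans h.length_eq)
      (fun v hv a T' O' q' hP hm => by
        obtain ⟨hs, rfl, hma⟩ := hP
        have hR : Rep w X 0 (fun _ => 0) T' :=
          ⟨hs.1 ▸ h.word, fun p => (hs.2 0 (Or.inl rfl) p) ▸ h.set p, fun e he => by omega⟩
        obtain ⟨q₃, T₃, hr₃, hq₃, hs₃⟩ := φ.runsIn_code hD 1 _ T' q' O' hφ hD' (hR.update hm)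
        obtain ⟨T₄, hr₄, hs₄, hm₄⟩ := runsIn_writeMark (k := 1) (by omega)
          (fun r c => c.get 1 || (r && c.get (numTrack 0))) q₃ T₃ O'
        have hm₃ : ∀ p, mark T₃ (numTrack 0) p = (p == v) := fun p => by
          rw [← hs₃.2 _ (by unfold Below numTrack; omega), hm]
        refine ⟨q₃, T₄, O', (hr₃.seq hr₄).mono ?_, ⟨hs.trans ((hs₃.mono fun k hk => by
          unfold Below; omega).trans (hs₄.mono fun k hk => by omega)), rfl, ?_⟩, fun p => ?_⟩
        · rw [hs₃.length_eq, hs.length_eq, h.length_eq]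
          omega
        · intro p
          have : mark T₄ 1 p = (mark T₃ 1 p || (q₃.1 && mark T₃ (numTrack 0) p)) := by
            rw [hm₄]
            unfold mark
            cases T₃[p]? <;> simp
          rw [this, hm₃, hq₃, ← hs₃.2 1 (by unfold Below; omega), hma]
        · rw [← hs₄.2 _ (by unfold numTrack; omega), hm₃])
      (fun _ => false) T O q ⟨Same.refl _ _, rfl, hz⟩
    refine ⟨q', T', hr, fun p => ?_, hs⟩
    rw [hm' p, foldr_set, Bool.eq_iff_iff, List.any_eq_true]
    simp only [List.mem_range, Bool.and_eq_true, beq_iff_eq, stepSet, decide_eq_true_eq]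
    constructor
    · rintro ⟨v, hv, hgv, rfl⟩
      exact ⟨hv, hgv⟩
    · rintro ⟨hp, hgp⟩
      exact ⟨p, hp, hgp, rfl⟩
  obtain ⟨q', T', O', hr, hR, rfl⟩ := runsIn_forEach (α := ℕ → Bool) (x := 2)
    (by omega) (N := w.length)
    (b := forCost (φ.cost w.length + 2 * w.length + 2) w.length + 4 * w.length + 4)
    (B := .seq (writeMark 1 fun _ _ => false) <| .seq
      (forEach (numTrack 0) <| .seq (φ.code 1) <|
        writeMark 1 fun r c => c.get 1 || (r && c.get (numTrack 0))) <|
      writeMark 0 fun _ c => c.get 1)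
    (fun a T' O' => Rep w a 0 ρ T' ∧ O' = O)
    (fun _ a => stepSet w φ a)
    (fun a T' T'' O' hs hP => ⟨⟨hs.1 ▸ hP.1.word,
      fun p => (hs.2 0 (by omega) p) ▸ hP.1.set p, fun e he => by omega⟩, hP.2⟩)
    (fun a T' O' hP => hP.1.length_eq)
    (fun v hv a T' O' q' hP hm => by
      obtain ⟨hR, rfl⟩ := hP
      obtain ⟨T₁, hr₁, hs₁, hm₁⟩ := runsIn_writeMark (k := 1) (by omega)
        (fun _ _ => false) q' T' O'
      have hR₁ : Rep w a 0 ρ T₁ := ⟨hs₁.1 ▸ hR.word,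
        fun p => (hs₁.2 0 (by omega) p) ▸ hR.set p, fun e he => by omega⟩
      have hz : ∀ p, mark T₁ 1 p = false := fun p => by rw [hm₁]; cases T'[p]? <;> rfl
      obtain ⟨q₂, T₂, hr₂, hm₂, hs₂⟩ := inner a T₁ q' hR₁ hz
      obtain ⟨T₃, hr₃, hs₃, hm₃⟩ := runsIn_writeMark (k := 0) (by omega)
        (fun _ c => c.get 1) q₂ T₂ O'
      refine ⟨q₂, T₃, O', (hr₁.seq (hr₂.seq hr₃)).mono ?_, ⟨⟨?_, ?_, fun e he => by omega⟩, rfl⟩,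
        fun p => ?_⟩
      · rw [hs₂.length_eq, hR₁.length_eq, hR.length_eq]
        omega
      · rw [← hs₃.1, ← hs₂.1, hR₁.word]
      · intro p
        rw [hm₃, ← hm₂ p]
        rfl
      · rw [← hs₃.2 2 (by omega), ← hs₂.2 2 (Or.inr rfl), ← hs₁.2 2 (by omega), hm])
    X T O q ⟨h, rfl⟩
  rw [foldr_iterate] at hR
  exact ⟨q', T', hr, hR⟩

/-! ### Polynomial time -/

/-- `f` is given by a polynomial. -/
def IsPoly (f : ℕ → ℕ) : Prop := ∃ P : Polynomial ℕ, ∀ N, f N = P.eval N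

theorem IsPoly.const (c : ℕ) : IsPoly fun _ => c := ⟨Polynomial.C c, fun N => by simp⟩

theorem IsPoly.id : IsPoly fun N => N := ⟨Polynomial.X, fun N => by simp⟩

theorem IsPoly.add {f g : ℕ → ℕ} (hf : IsPoly f) (hg : IsPoly g) : IsPoly fun N => f N + g N :=
  let ⟨P, hP⟩ := hf
  let ⟨Q, hQ⟩ := hg
  ⟨P + Q, fun N => by simp [hP, hQ]⟩

theorem IsPoly.mul {f g : ℕ → ℕ} (hf : IsPoly f) (hg : IsPoly g) : IsPoly fun N => f N * g N :=
  let ⟨P, hP⟩ := hf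
  let ⟨Q, hQ⟩ := hg
  ⟨P * Q, fun N => by simp [hP, hQ]⟩

theorem IsPoly.lin {f : ℕ → ℕ} (hf : IsPoly f) (a b : ℕ) : IsPoly fun N => f N + a * N + b :=
  (hf.add ((IsPoly.const a).mul IsPoly.id)).add (IsPoly.const b)

theorem IsPoly.forCost {f : ℕ → ℕ} (hf : IsPoly f) : IsPoly fun N => forCost (f N) N :=
  (IsPoly.id.mul (hf.lin 4 7)).lin 6 9

theorem Fm.isPoly_cost (φ : Fm) : IsPoly φ.cost := by
  induction φ with
  | letter a x => exact ((IsPoly.const 2).mul IsPoly.id).add (IsPoly.const 3)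
  | lt x y => exact ((IsPoly.const 2).mul IsPoly.id).add (IsPoly.const 3)
  | mem x => exact ((IsPoly.const 2).mul IsPoly.id).add (IsPoly.const 3)
  | neg φ ih => exact ih.add (IsPoly.const 1)
  | and φ ψ ih ih' => exact (ih.add ih').add (IsPoly.const 2)
  | ex φ ih => exact ((ih.lin 2 4).forCost).lin 4 5
  | cnt φ y ih => exact ((ih.lin 2 4).forCost).lin 4 5

theorem Printer.isPoly_cost (π : Printer) : IsPoly π.cost := by
  induction π with
  | nil => exact IsPoly.const 1
  | bit b => exact IsPoly.const 1
  | append p q ih ih' => exact ih.add ih'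
  | ite φ p q ih ih' => exact ((φ.isPoly_cost.add ih).add ih').add (IsPoly.const 1)
  | each p ih => exact ih.forCost

/-- A function is computable in polynomial time, if its output is described by a printer that uses
an iteratively defined set. -/
theorem polyTime_of_printer {D : ℕ} (hD : 1 ≤ D) {φ : Fm} (hφ : φ.wf D 1 = true) {π : Printer}
    (hπ : π.wf D 0 = true) {A : Type} [Fintype A] (κ : A → Option Bool)
    (tl : Option (Option Bool)) {α β : Type} (ea : α → List A) (eb : β → List Bool) (f : α → β)
    (h : ∀ a w, w = (ea a).map κ ++ tl.toList →
      eb (f a) = π.eval w ((stepSet w φ)^[w.length] fun _ => false) 0 fun _ => 0) :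
    Nonempty (Turing.TM2ComputableInPolyTime ea eb f) := by
  obtain ⟨P, hP⟩ : IsPoly fun N => iterCost φ N + π.cost N :=
    (((φ.isPoly_cost.lin 2 2).forCost).lin 4 4).forCost.add π.isPoly_cost
  -- Three tracks for the iterated set and two for each quantifier depth. The cost is a polynomial
  -- in the length of the word, which exceeds that of the input by the appended cell, if there is
  -- one; hence the composition.
  refine polyTime_of_runs (C := Cell (3 + 2 * D)) (Q := Flags) (false, false)
    (fun a => Cell.blank (κ a)) (tl.map Cell.blank) (.seq (iterCode φ) (π.code 0)) ea eb f
    (P.comp (Polynomial.X + Polynomial.C tl.toList.length)) fun a => ?_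
  set w := (ea a).map κ ++ tl.toList with hw
  have hT : (ea a).map (fun a => (Cell.blank (κ a) : Cell (3 + 2 * D))) ++
      (tl.map Cell.blank).toList = w.map Cell.blank := by
    cases tl <;> simp [hw, Function.comp_def]
  rw [hT]
  have hR : Rep w (fun _ => false) 0 (fun _ => 0) (w.map (Cell.blank (m := 3 + 2 * D))) :=
    ⟨by simp [Function.comp_def, Cell.blank], fun p => mark_map_blank w 0 p, fun e he => by omega⟩
  obtain ⟨q₁, T₁, hr₁, hR₁⟩ := runsIn_iterCode le_rfl hD hφ _ _ _ (false, false) [] hR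
  obtain ⟨q₂, T₂, hr₂, hs₂⟩ := π.runsIn_code le_rfl 0 _ T₁ q₁ [] hπ (Nat.zero_le _) hR₁
  obtain ⟨t, ht, hr⟩ := hr₁.seq hr₂
  have hlen : w.length = (ea a).length + tl.toList.length := by simp [hw]
  refine ⟨_, t, hr, ?_, ?_, ?_⟩
  · rw [List.append_nil, h a w hw]
  · rw [hs₂.length_eq, hR₁.length_eq, hlen]
    cases tl <;> rfl
  · rw [Polynomial.eval_comp, Polynomial.eval_add, Polynomial.eval_X, Polynomial.eval_C, ← hlen,
      ← hP]
    exact ht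

end Sweep

/-! ### Combinatorics of the train run. -/

namespace SwitchGraph

/-! ### Dead ends -/

/-- Read contrapositively, dead ends are closed under successors: a train that has entered one meets
only dead ends from then on. -/
theorem reaches_of_edge {V : Type*} {G : SwitchGraph V} {d u v : V} (h : (u, v) ∈ G.edges)
    (hv : ¬ G.IsDeadEnd d v) : ¬ G.IsDeadEnd d u := by
  unfold IsDeadEnd at *
  rw [not_not] at *
  exact Relation.ReflTransGen.head h hv

theorem not_isDeadEnd_self {V : Type*} (G : SwitchGraph V) (d : V) : ¬ G.IsDeadEnd d d :=
  fun h => h .refl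

theorem edge_s₀ {V : Type*} (G : SwitchGraph V) (u : V) : (u, G.s₀ u) ∈ G.edges := Or.inl ⟨u, rfl⟩

theorem edge_s₁ {V : Type*} (G : SwitchGraph V) (u : V) : (u, G.s₁ u) ∈ G.edges := Or.inr ⟨u, rfl⟩

/-! ### Positions and visits of the run -/

section

variable {V W : Type*} [DecidableEq V] [DecidableEq W]

/-- The position of the train after `k` steps. -/
def pos (G : SwitchGraph V) (o : V) (k : ℕ) : V := (State.advance^[k] (G.start o)).pos

/-- The number of times that the train has left `v` in the first `k` steps. -/
def visits (G : SwitchGraph V) (o : V) (k : ℕ) (v : V) : ℕ := Nat.count (fun i => G.pos o i = v) k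

variable (G : SwitchGraph V) (o : V)

theorem runTerminates_iff (d : V) : G.RunTerminates o d ↔ ∃ k, G.pos o k = d := Iff.rfl

@[simp] theorem pos_zero : G.pos o 0 = o := rfl

@[simp] theorem visits_zero (v : V) : G.visits o 0 v = 0 := by simp [visits]

theorem visits_succ (k : ℕ) (v : V) :
    G.visits o (k + 1) v = G.visits o k v + if G.pos o k = v then 1 else 0 := by
  simp [visits, Nat.count_succ]

/-- The switch at `v` flips once per departure from `v`, so both arrays are determined by the parity
of the number of visits. -/
theorem state_eq (k : ℕ) : State.advance^[k] (G.start o) =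
    ⟨G.pos o k, fun v => if Even (G.visits o k v) then G.s₀ v else G.s₁ v,
      fun v => if Even (G.visits o k v) then G.s₁ v else G.s₀ v⟩ := by
  induction k with
  | zero => simp [start]
  | succ k ih =>
    have h : State.advance^[k + 1] (G.start o) = (State.advance^[k] (G.start o)).advance :=
      Function.iterate_succ_apply' _ _ _
    have hp : G.pos o (k + 1) = (State.advance^[k] (G.start o)).advance.pos := by
      rw [← h]; rfl
    rw [hp, h, ih]
    unfold State.advance
    congr 1
    · funext v
      by_cases hv : v = G.pos o k
      · subst hv
        by_cases he : Even (G.visits o k (G.pos o k)) <;>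
          simp [visits_succ, Nat.even_add_one, he]
      · simp [visits_succ, hv, Ne.symm hv]
    · funext v
      by_cases hv : v = G.pos o k
      · subst hv
        by_cases he : Even (G.visits o k (G.pos o k)) <;>
          simp [visits_succ, Nat.even_add_one, he]
      · simp [visits_succ, hv, Ne.symm hv]

theorem pos_succ (k : ℕ) : G.pos o (k + 1) =
    if Even (G.visits o k (G.pos o k)) then G.s₀ (G.pos o k) else G.s₁ (G.pos o k) := by
  have h : State.advance^[k + 1] (G.start o) = (State.advance^[k] (G.start o)).advance :=
    Function.iterate_succ_apply' _ _ _
  have hp : G.pos o (k + 1) = (State.advance^[k] (G.start o)).advance.pos := by rw [← h]; rfl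
  rw [hp, state_eq]
  rfl

theorem pos_edge (k : ℕ) : (G.pos o k, G.pos o (k + 1)) ∈ G.edges := by
  rw [pos_succ]
  split_ifs
  · exact Or.inl ⟨_, rfl⟩
  · exact Or.inr ⟨_, rfl⟩

/-- As long as the successors of the visited vertices correspond to each other, so do the runs. -/
theorem pos_map (H : SwitchGraph W) {φ : V → W} (hφ : Function.Injective φ) {k : ℕ}
    (h₀ : ∀ i < k, H.s₀ (φ (G.pos o i)) = φ (G.s₀ (G.pos o i)))
    (h₁ : ∀ i < k, H.s₁ (φ (G.pos o i)) = φ (G.s₁ (G.pos o i))) :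
    ∀ i ≤ k, H.pos (φ o) i = φ (G.pos o i) ∧ ∀ v, H.visits (φ o) i (φ v) = G.visits o i v := by
  intro i
  induction i with
  | zero => simp
  | succ i ih =>
    intro hi
    obtain ⟨ih₁, ih₂⟩ := ih (by omega)
    constructor
    · rw [pos_succ, pos_succ, ih₁, ih₂, h₀ i (by omega), h₁ i (by omega)]
      split_ifs <;> rfl
    · intro v
      rw [visits_succ, visits_succ, ih₁, ih₂]
      simp [hφ.eq_iff]

theorem runTerminates_rename (e : V ≃ W) (d : V) :
    (G.rename e).RunTerminates (e o) (e d) ↔ G.RunTerminates o d := by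
  have : ∀ k, (G.rename e).pos (e o) k = e (G.pos o k) := fun k =>
    (pos_map G o (G.rename e) e.injective (k := k) (fun i _ => by simp [rename])
      (fun i _ => by simp [rename]) k le_rfl).1
  simp [runTerminates_iff, this]

/-! ### Conservation of the flow -/

/-- The number of arrivals at `v`, if every vertex `u` has been left `c u` times. -/
def inflow [Fintype V] (c : V → ℕ) (v : V) : ℕ :=
  ∑ u, ((if G.s₀ u = v then (c u + 1) / 2 else 0) + if G.s₁ u = v then c u / 2 else 0)

/-- Every presence at `v`, whether as the origin or by an arrival, is followed by a departure,
unless the train is there now. In the induction a step changes only the summand of the current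
vertex, and by one on the edge that is used. -/
theorem inflow_visits [Fintype V] (k : ℕ) (v : V) :
    (if v = o then 1 else 0) + G.inflow (G.visits o k) v =
      G.visits o k v + if G.pos o k = v then 1 else 0 := by
  induction k with
  | zero => simp [inflow, eq_comm (a := o)]
  | succ k ih =>
    rw [visits_succ, ← ih, add_assoc]
    congr 1
    have : ∀ u, ((if G.s₀ u = v then (G.visits o (k + 1) u + 1) / 2 else 0) +
        if G.s₁ u = v then G.visits o (k + 1) u / 2 else 0) =
        ((if G.s₀ u = v then (G.visits o k u + 1) / 2 else 0) +
          if G.s₁ u = v then G.visits o k u / 2 else 0) +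
        if G.pos o k = u then (if G.pos o (k + 1) = v then 1 else 0) else 0 := by
      intro u
      rw [visits_succ]
      by_cases hu : G.pos o k = u
      · subst hu
        rw [pos_succ]
        by_cases he : Even (G.visits o k (G.pos o k))
        · obtain ⟨r, hr⟩ := id he
          simp only [he, if_true]
          rw [hr]
          split_ifs <;> omega
        · obtain ⟨r, hr⟩ := Nat.not_even_iff_odd.1 he
          simp only [he, if_true, if_false]
          rw [hr]
          split_ifs <;> omega
      · simp [hu]
    unfold inflow
    rw [Finset.sum_congr rfl fun u _ => this u, Finset.sum_add_distrib]
    simp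

theorem sum_visits [Fintype V] (k : ℕ) : ∑ v, G.visits o k v = k := by
  induction k with
  | zero => simp
  | succ k ih => simp [visits_succ, Finset.sum_add_distrib, ih]

theorem visits_le (k : ℕ) (v : V) : G.visits o k v ≤ k := Nat.count_le _

theorem exists_pos_of_visits {k : ℕ} {v : V} (h : 0 < G.visits o k v) :
    ∃ i < k, G.pos o i = v := by
  by_contra! hc
  have : G.visits o k v = 0 := by
    rw [visits, Nat.count_iff_forall_not]
    exact hc
  omega

theorem visits_eq_zero {k : ℕ} {v : V} (h : ∀ i < k, G.pos o i ≠ v) : G.visits o k v = 0 := by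
  by_contra hc
  obtain ⟨i, hi, hv⟩ := G.exists_pos_of_visits o (Nat.pos_of_ne_zero hc)
  exact h i hi hv

/-! ### Arrival at a dead end -/

theorem not_isDeadEnd_pos {d : V} {k : ℕ} (hk : ¬ G.IsDeadEnd d (G.pos o k)) :
    ∀ i ≤ k, ¬ G.IsDeadEnd d (G.pos o i) := by
  intro i hi
  induction k with
  | zero => obtain rfl : i = 0 := by omega
            exact hk
  | succ k ih =>
    rcases Nat.le_succ_iff.1 hi with hi | rfl
    · exact ih (reaches_of_edge (G.pos_edge o k) hk) hi
    · exact hk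

/-- The train arrives at the destination or at a dead end. -/
theorem exists_pos_eq_or_isDeadEnd [Fintype V] (d : V) :
    ∃ k, G.pos o k = d ∨ G.IsDeadEnd d (G.pos o k) := by
  -- The visit numbers after `k` steps sum to `k`, so they cannot all stay bounded.
  have unbounded : ∃ v, ∀ B, ∃ k, B ≤ G.visits o k v := by
    by_contra! hc
    choose B hB using hc
    have h := G.sum_visits o (∑ v, B v + 1)
    have : ∑ v, G.visits o (∑ v, B v + 1) v ≤ ∑ v, B v :=
      Finset.sum_le_sum fun v _ => (hB v _).le
    omega
  have step : ∀ u v, (u, v) ∈ G.edges → (∀ B, ∃ k, B ≤ G.visits o k u) →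
      ∀ B, ∃ k, B ≤ G.visits o k v := by
    intro u v h hu B
    -- Either edge out of `u` takes at least half of the departures, rounded down, which gives `B +
    -- 1` arrivals at `v`. At most one of them is not yet followed by a departure.
    obtain ⟨k, hk⟩ := hu (2 * (B + 1))
    refine ⟨k, ?_⟩
    have h1 := G.inflow_visits o k v
    have h2 : G.visits o k u / 2 ≤ G.inflow (G.visits o k) v := by
      refine le_trans ?_ (Finset.single_le_sum (f := fun u =>
        ((if G.s₀ u = v then (G.visits o k u + 1) / 2 else 0) +
          if G.s₁ u = v then G.visits o k u / 2 else 0)) (fun _ _ => Nat.zero_le _)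
        (Finset.mem_univ u))
      rcases h with ⟨w, hw⟩ | ⟨w, hw⟩ <;> simp only [Prod.mk.injEq] at hw <;>
        obtain ⟨rfl, rfl⟩ := hw <;> split_ifs <;> first | omega | simp_all
    have h3 : (if G.pos o k = v then 1 else 0) ≤ 1 := by split_ifs <;> omega
    omega
  obtain ⟨v, hv⟩ := unbounded
  have visited : ∀ v, (∀ B, ∃ k, B ≤ G.visits o k v) → ∃ k, G.pos o k = v := by
    intro v hv
    obtain ⟨k, hk⟩ := hv 1
    obtain ⟨i, -, hi⟩ := G.exists_pos_of_visits o hk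
    exact ⟨i, hi⟩
  by_cases hd : G.IsDeadEnd d v
  · obtain ⟨k, rfl⟩ := visited v hv
    exact ⟨k, Or.inr hd⟩
  · have : ∀ B, ∃ k, B ≤ G.visits o k d := by
      have hr := not_not.1 hd
      clear hd
      induction hr with
      | refl => exact hv
      | tail _ he ih => exact step _ _ he ih
    obtain ⟨k, hk⟩ := visited d this
    exact ⟨k, Or.inl hk⟩

/-- If the train does not arrive at the destination, it arrives at a dead end, where it has not
been before. -/
theorem exists_first_deadEnd [Fintype V] {d : V} (h : ¬ G.RunTerminates o d) :
    ∃ k, G.IsDeadEnd d (G.pos o k) ∧ ∀ i < k, ¬ G.IsDeadEnd d (G.pos o i) := by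
  classical
  have ex : ∃ k, G.IsDeadEnd d (G.pos o k) := by
    obtain ⟨k, hk | hk⟩ := G.exists_pos_eq_or_isDeadEnd o d
    · exact absurd ⟨k, hk⟩ h
    · exact ⟨k, hk⟩
  exact ⟨Nat.find ex, Nat.find_spec ex, fun i hi => Nat.find_min ex hi⟩

/-- The graphs differ on `V` only at `d` and at dead ends, so the runs agree until the first visit
to such a vertex. At `d` the modified run stays forever; from a dead end it goes to `none` in one
step. -/
theorem runTerminates_iff_not_bar [Fintype V] (d : V) (a b : Option V) :
    G.RunTerminates o d ↔ ¬ (G.bar d a b).RunTerminates (some o) none := by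
  classical
  have main : ∀ k, (∀ i < k, G.pos o i ≠ d ∧ ¬ G.IsDeadEnd d (G.pos o i)) →
      ∀ i ≤ k, (G.bar d a b).pos (some o) i = some (G.pos o i) := fun k hk i hi =>
    (pos_map G o (G.bar d a b) (Option.some_injective V) (k := k)
      (fun i hi => by simp [bar, hk i hi]) (fun i hi => by simp [bar, hk i hi]) i hi).1
  constructor
  · intro h
    have h' : ∃ k, G.pos o k = d := h
    set K := Nat.find h' with hK
    have hKd : G.pos o K = d := Nat.find_spec h'
    have hlive := G.not_isDeadEnd_pos o (k := K) (d := d) (hKd ▸ G.not_isDeadEnd_self d)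
    have hm := main K fun i hi => ⟨Nat.find_min h' hi, hlive i hi.le⟩
    have stay : ∀ j, (G.bar d a b).pos (some o) (K + j) = some d := by
      intro j
      induction j with
      | zero => rw [add_zero, hm K le_rfl, hKd]
      | succ j ih =>
        rw [← add_assoc, pos_succ, ih]
        simp [bar, G.not_isDeadEnd_self d]
    rintro ⟨k, hk⟩
    change (G.bar d a b).pos (some o) k = none at hk
    rcases le_total k K with hle | hle
    · rw [hm k hle] at hk
      cases hk
    · obtain ⟨j, rfl⟩ := Nat.exists_eq_add_of_le hle
      rw [stay] at hk
      cases hk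
  · intro h
    by_contra hn
    obtain ⟨K, hK, hmin⟩ := G.exists_first_deadEnd o hn
    have hm := main K (fun i hi => ⟨fun he => hn ⟨i, he⟩, hmin i hi⟩) K le_rfl
    refine h ⟨K + 1, ?_⟩
    change (G.bar d a b).pos (some o) (K + 1) = none
    rw [pos_succ, hm]
    simp [bar, hK]

/-- By `state_eq`, position and parities form the whole state, so two times at which they agree have
the same future. -/
theorem state_congr {i j : ℕ} (hp : G.pos o i = G.pos o j)
    (hv : ∀ v, Even (G.visits o i v) ↔ Even (G.visits o j v)) (t : ℕ) :
    G.pos o (t + i) = G.pos o (t + j) := by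
  unfold pos
  rw [Function.iterate_add_apply, Function.iterate_add_apply, state_eq, state_eq, hp]
  simp only [hv]

/-- The first dead end is met in less than exponentially many steps. -/
theorem first_deadEnd_le [Fintype V] {d : V} {k : ℕ} (hk : G.IsDeadEnd d (G.pos o k))
    (hmin : ∀ i < k, ¬ G.IsDeadEnd d (G.pos o i)) :
    k ≤ Fintype.card V * 2 ^ Fintype.card V := by
  by_contra! hlt
  set M := Fintype.card V * 2 ^ Fintype.card V with hM
  have hcard : Fintype.card (V × (V → Bool)) < Fintype.card (Fin (M + 1)) := by
    simp [hM]
  obtain ⟨i, j, hij, h⟩ := Fintype.exists_ne_map_eq_of_card_lt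
    (fun i : Fin (M + 1) => (G.pos o i, fun v => decide (Even (G.visits o i v)))) hcard
  -- A repetition at times `i < j` can be cut out: the dead end at time `k` would already occur at
  -- the earlier time `k - j + i`.
  have key : ∀ i j : Fin (M + 1), i.1 < j.1 →
      (G.pos o i, fun v => decide (Even (G.visits o i v))) =
        (G.pos o j, fun v => decide (Even (G.visits o j v))) → False := by
    intro i j hij h
    rw [Prod.mk.injEq] at h
    have := G.state_congr o h.1 (fun v => by simpa using congrFun h.2 v) (k - j)
    have hj := j.2
    rw [Nat.sub_add_cancel (by omega)] at this
    exact hmin _ (by omega) (this ▸ hk)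
  rcases lt_or_gt_of_ne hij with hlt | hlt
  · exact key i j hlt h
  · exact key j i hlt h.symm

/-! ### Certificates -/

/-- By induction on time, `c` bounds the visits of live vertices. When the train leaves `v`, the new
visit number is the origin term plus the inflow, the inflow is monotone in the visits, and all
predecessors of a live vertex are live. Values of `c` at dead ends do not matter, since no edge
leads from them to live vertices. -/
theorem not_runTerminates_of_inflow_le [Fintype V] {d : V} (c : V → ℕ) (hd : c d = 0)
    (hc : ∀ v, ¬ G.IsDeadEnd d v → (if v = o then 1 else 0) + G.inflow c v ≤ c v) :
    ¬ G.RunTerminates o d := by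
  rintro ⟨K, hK⟩
  change G.pos o K = d at hK
  have hlive := G.not_isDeadEnd_pos o (k := K) (d := d) (hK ▸ G.not_isDeadEnd_self d)
  have key : ∀ k ≤ K + 1, ∀ v, ¬ G.IsDeadEnd d v → G.visits o k v ≤ c v := by
    intro k
    induction k with
    | zero => simp
    | succ k ih =>
      intro hk v hv
      have ih := ih (by omega)
      rw [visits_succ]
      by_cases hp : G.pos o k = v
      · rw [← inflow_visits]
        refine le_trans (Nat.add_le_add_left (Finset.sum_le_sum fun u _ => ?_) _) (hc v hv)
        refine Nat.add_le_add ?_ ?_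
        · split_ifs with hu
          · have := ih u (reaches_of_edge (G.edge_s₀ u) (hu ▸ hv))
            omega
          · exact le_rfl
        · split_ifs with hu
          · have := ih u (reaches_of_edge (G.edge_s₁ u) (hu ▸ hv))
            omega
          · exact le_rfl
      · simpa [hp] using ih v hv
  -- The run is continued formally past its arrival at time `K`, so that this presence at `d` counts
  -- as a departure.
  have h1 := key (K + 1) le_rfl d (G.not_isDeadEnd_self d)
  rw [visits_succ, if_pos hK, hd] at h1
  omega

/-- The number of edges to `v` from vertices in `P`. -/
def edgesFrom [Fintype V] (P : V → Prop) [DecidablePred P] (v : V) : ℕ :=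
  (Finset.univ.filter fun u => G.s₀ u = v ∧ P u).card +
    (Finset.univ.filter fun u => G.s₁ u = v ∧ P u).card

/-- A certificate that the train does not arrive at `d`: for each vertex `v`, the column totals
`T v 0, T v 1, …` of the binary addition of the numbers of trains on the incoming edges. -/
structure IsCertificate [Fintype V] (d : V) (T : V → ℕ → ℕ) : Prop where
  dest : ∀ b, T d b = 0
  first : ∀ v, ¬ G.IsDeadEnd d v → T v 0 = (if v = o then 1 else 0) +
    (Finset.univ.filter fun u => G.s₀ u = v ∧ T u 0 % 2 = 1).card +
      G.edgesFrom (fun u => T u 1 % 2 = 1) v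
  carry : ∀ v, ¬ G.IsDeadEnd d v → ∀ b,
    T v (b + 1) = T v b / 2 + G.edgesFrom (fun u => T u (b + 2) % 2 = 1) v

/-- Of `r + 2 h` departures the even edge takes `h + r` and the odd edge `h`: the lowest digit
travels on the even edge only. This is why the first column has a term of its own. -/
theorem inflow_eq [Fintype V] (c r h : V → ℕ) (hr : ∀ u, r u < 2) (hc : ∀ u, c u = r u + 2 * h u)
    (v : V) : G.inflow c v = (Finset.univ.filter fun u => G.s₀ u = v ∧ r u = 1).card +
      ∑ u, ((if G.s₀ u = v then h u else 0) + if G.s₁ u = v then h u else 0) := by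
  rw [Finset.card_filter, ← Finset.sum_add_distrib]
  refine Finset.sum_congr rfl fun u _ => ?_
  have := hr u
  rw [hc u]
  by_cases h0 : G.s₀ u = v <;> by_cases h1 : G.s₁ u = v <;> simp only [h0, h1, true_and, false_and,
    if_true, if_false] <;> (try split_ifs) <;> omega

theorem edgesFrom_add [Fintype V] (c r h : V → ℕ) (hr : ∀ u, r u < 2)
    (hc : ∀ u, c u = r u + 2 * h u) (v : V) :
    ∑ u, ((if G.s₀ u = v then c u else 0) + if G.s₁ u = v then c u else 0) =
      G.edgesFrom (fun u => r u = 1) v +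
        2 * ∑ u, ((if G.s₀ u = v then h u else 0) + if G.s₁ u = v then h u else 0) := by
  unfold edgesFrom
  rw [Finset.card_filter, Finset.card_filter, ← Finset.sum_add_distrib, Finset.mul_sum,
    ← Finset.sum_add_distrib]
  refine Finset.sum_congr rfl fun u _ => ?_
  have := hr u
  rw [hc u]
  by_cases h0 : G.s₀ u = v <;> by_cases h1 : G.s₁ u = v <;> simp only [h0, h1, true_and, false_and,
    if_true, if_false] <;> (try split_ifs) <;> omega

/-- The number of trains on the edges to `v`, if there are `h u` trains on each edge from `u`. -/
def edgeSum [Fintype V] (h : V → ℕ) (v : V) : ℕ :=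
  ∑ u, ((if G.s₀ u = v then h u else 0) + if G.s₁ u = v then h u else 0)

/-- The digits from the position `j` on of a number with `B` binary digits. -/
def ofDigits (β : ℕ → ℕ) (B j : ℕ) : ℕ := ∑ b ∈ Finset.range B, 2 ^ b * β (j + b)

/-- Horner's step. Both sides sum the same number `B` of terms; the missing last term is harmless
because all digits from `B` on vanish. -/
theorem ofDigits_eq {β : ℕ → ℕ} {B : ℕ} (hβ : ∀ b, B ≤ b → β b = 0) (j : ℕ) :
    ofDigits β B j = β j + 2 * ofDigits β B (j + 1) := by
  have h1 : ofDigits β B j = ∑ b ∈ Finset.range (B + 1), 2 ^ b * β (j + b) := by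
    rw [Finset.sum_range_succ, hβ (j + B) (by omega), mul_zero, add_zero, ofDigits]
  rw [h1, Finset.sum_range_succ', ofDigits, Finset.mul_sum, add_comm]
  simp [pow_succ', mul_assoc, add_comm, add_left_comm]

theorem ofDigits_eq_zero {β : ℕ → ℕ} {B j : ℕ} (hβ : ∀ b, B ≤ b → β b = 0) (hj : B ≤ j) :
    ofDigits β B j = 0 :=
  Finset.sum_eq_zero fun b _ => by rw [hβ (j + b) (by omega), mul_zero]

/-- The parities of the totals at `v` are read as the binary digits of a number `D v 0`. The column
equations say that these numbers satisfy the balance equations at live vertices, so the preceding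
criterion applies. -/
theorem IsCertificate.not_runTerminates [Fintype V] {d : V} {T : V → ℕ → ℕ}
    (hT : G.IsCertificate o d T) {B : ℕ} (hB : ∀ u b, B ≤ b → T u b = 0) :
    ¬ G.RunTerminates o d := by
  set D : V → ℕ → ℕ := fun u j => ofDigits (fun b => T u b % 2) B j with hD
  have hB' : ∀ u b, B ≤ b → T u b % 2 = 0 := fun u b hb => by rw [hB u b hb]
  have hDs : ∀ u j, D u j = T u j % 2 + 2 * D u (j + 1) := fun u j => ofDigits_eq (hB' u) j
  have hr : ∀ j u, T u j % 2 < 2 := fun j u => Nat.mod_lt _ two_pos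
  refine G.not_runTerminates_of_inflow_le o (fun u => D u 0)
    (by simp [hD, ofDigits, hT.dest]) fun v hv => le_of_eq ?_
  have h1 := G.inflow_eq (fun u => D u 0) (fun u => T u 0 % 2) (fun u => D u 1) (hr 0)
    (fun u => hDs u 0) v
  have h2 : ∀ j, G.edgeSum (fun u => D u j) v =
      G.edgesFrom (fun u => T u j % 2 = 1) v + 2 * G.edgeSum (fun u => D u (j + 1)) v :=
    fun j => G.edgesFrom_add _ _ _ (hr j) (fun u => hDs u j) v
  -- Downward induction on the column `j`, starting at `B`, where everything vanishes: the total of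
  -- column `j` and the higher digits of the incoming flow add up to `D v j`.
  have key : ∀ i j, i + j = B → T v j + 2 * G.edgeSum (fun u => D u (j + 2)) v = D v j := by
    intro i
    induction i with
    | zero =>
      intro j hj
      have hz : ∀ u k, B ≤ k → D u k = 0 := fun u k hk => ofDigits_eq_zero (hB' u) hk
      rw [hB v j (by omega), hz v j (by omega), edgeSum]
      simp [hz _ (j + 2) (by omega)]
    | succ i ih =>
      intro j hj
      have h3 := ih (j + 1) (by omega)
      have h4 := hT.carry v hv j
      have h5 := h2 (j + 2)
      have h6 := hDs v j
      rw [show j + 1 + 2 = j + 2 + 1 by ring] at h3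
      omega
  have h3 := key B 0 rfl
  have h4 := hT.first v hv
  have h5 := h2 1
  rw [h1]
  change _ + (_ + G.edgeSum (fun u => D u 1) v) = _
  simp only [zero_add, Nat.reduceAdd] at h3 h5
  omega

/-- The column totals of the binary addition of the numbers `c u`. -/
def columnTotal [Fintype V] (c : V → ℕ) (v : V) : ℕ → ℕ
  | 0 => (if v = o then 1 else 0) +
    (Finset.univ.filter fun u => G.s₀ u = v ∧ c u / 2 ^ 0 % 2 = 1).card +
      G.edgesFrom (fun u => c u / 2 ^ 1 % 2 = 1) v
  | b + 1 => columnTotal c v b / 2 + G.edgesFrom (fun u => c u / 2 ^ (b + 2) % 2 = 1) v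

theorem edgesFrom_le [Fintype V] (P : V → Prop) [DecidablePred P] (v : V) :
    G.edgesFrom P v ≤ 2 * Fintype.card V := by
  have h0 := Finset.card_le_univ (Finset.univ.filter fun u => G.s₀ u = v ∧ P u)
  have h1 := Finset.card_le_univ (Finset.univ.filter fun u => G.s₁ u = v ∧ P u)
  unfold edgesFrom
  omega

/-- A later column receives at most 2n digits and half of the preceding total, and the bound 4n + 1
is stable under this recursion. -/
theorem columnTotal_le [Fintype V] (c : V → ℕ) (v : V) (b : ℕ) :
    G.columnTotal o c v b ≤ 4 * Fintype.card V + 1 := by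
  induction b with
  | zero =>
    have h0 := Finset.card_le_univ (Finset.univ.filter fun u => G.s₀ u = v ∧ c u / 2 ^ 0 % 2 = 1)
    have h1 := G.edgesFrom_le (fun u => c u / 2 ^ 1 % 2 = 1) v
    have h2 : (if v = o then 1 else 0) ≤ 1 := by split_ifs <;> omega
    rw [columnTotal]
    omega
  | succ b ih =>
    have h1 := G.edgesFrom_le (fun u => c u / 2 ^ (b + 2) % 2 = 1) v
    rw [columnTotal]
    omega

/-- This is what remains of the balance equation after the columns below `b` have been added and
divided away. Modulo 2 it shows that the total has the parity of the digit `b` of `c v`; it also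
bounds the total by `c v / 2 ^ b`. -/
theorem columnTotal_add [Fintype V] {c : V → ℕ} {v : V}
    (hc : (if v = o then 1 else 0) + G.inflow c v = c v) (b : ℕ) :
    G.columnTotal o c v b + 2 * G.edgeSum (fun u => c u / 2 ^ (b + 2)) v = c v / 2 ^ b := by
  have hr : ∀ j u, c u / 2 ^ j % 2 < 2 := fun j u => Nat.mod_lt _ two_pos
  have hs : ∀ j u, c u / 2 ^ j = c u / 2 ^ j % 2 + 2 * (c u / 2 ^ (j + 1)) := fun j u => by
    rw [pow_succ, ← Nat.div_div_eq_div_mul, Nat.mod_add_div]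
  have h2 : ∀ j, G.edgeSum (fun u => c u / 2 ^ j) v =
      G.edgesFrom (fun u => c u / 2 ^ j % 2 = 1) v +
        2 * G.edgeSum (fun u => c u / 2 ^ (j + 1)) v :=
    fun j => G.edgesFrom_add _ _ _ (hr j) (hs j) v
  induction b with
  | zero =>
    have h1 := G.inflow_eq c (fun u => c u / 2 ^ 0 % 2) (fun u => c u / 2 ^ 1) (hr 0)
      (fun u => by simpa using hs 0 u) v
    change _ = _ + G.edgeSum (fun u => c u / 2 ^ 1) v at h1
    have h3 := h2 1
    rw [columnTotal, pow_zero, Nat.div_one] at *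
    rw [show 1 + 1 = 0 + 2 by ring] at h3
    omega
  | succ b ih =>
    have h3 := h2 (b + 2)
    have h4 := hs b v
    rw [columnTotal, show b + 1 + 2 = b + 2 + 1 by ring]
    omega

/-- If the train does not arrive at `d`, there is a certificate of polynomial size. -/
theorem exists_isCertificate [Fintype V] {d : V} (h : ¬ G.RunTerminates o d) :
    ∃ T, G.IsCertificate o d T ∧ ∀ v b, T v b ≤ 4 * Fintype.card V + 1 ∧
      (2 * Fintype.card V ≤ b → T v b = 0) := by
  classical
  obtain ⟨K, hK, hmin⟩ := G.exists_first_deadEnd o h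
  have hKle := G.first_deadEnd_le o hK hmin
  set c := G.visits o K with hc
  have hdead : ∀ v, G.IsDeadEnd d v → c v = 0 := fun v hv =>
    G.visits_eq_zero o fun i hi he => hmin i hi (he ▸ hv)
  have hcons : ∀ v, ¬ G.IsDeadEnd d v → (if v = o then 1 else 0) + G.inflow c v = c v := by
    intro v hv
    rw [hc, inflow_visits, if_neg fun he : G.pos o K = v => hv (he ▸ hK), add_zero]
  have hd : c d = 0 := G.visits_eq_zero o fun i _ he => h ⟨i, he⟩
  have hlt : ∀ v, c v < 2 ^ (2 * Fintype.card V) := fun v =>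
    calc c v ≤ K := G.visits_le o K v
      _ ≤ Fintype.card V * 2 ^ Fintype.card V := hKle
      _ < 2 ^ Fintype.card V * 2 ^ Fintype.card V :=
        Nat.mul_lt_mul_of_pos_right Nat.lt_two_pow_self (by positivity)
      _ = 2 ^ (2 * Fintype.card V) := by rw [← pow_add, two_mul]
  -- No balance holds at dead ends. The value zero fits there because `c` vanishes on them, so the
  -- parities of `T` are the digits of `c` at all vertices.
  set T : V → ℕ → ℕ := fun v b => if G.IsDeadEnd d v then 0 else G.columnTotal o c v b with hT
  have hlive : ∀ v, ¬ G.IsDeadEnd d v → ∀ b, T v b = G.columnTotal o c v b :=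
    fun v hv b => by simp [hT, hv]
  have hle : ∀ v b, T v b ≤ c v / 2 ^ b := by
    intro v b
    by_cases hv : G.IsDeadEnd d v
    · simp [hT, hv]
    · have := G.columnTotal_add o (hcons v hv) b
      rw [hlive v hv]
      omega
  have hmod : ∀ b u, T u b % 2 = c u / 2 ^ b % 2 := by
    intro b v
    by_cases hv : G.IsDeadEnd d v
    · simp [hT, hv, hdead v hv]
    · have := G.columnTotal_add o (hcons v hv) b
      rw [hlive v hv]
      omega
  refine ⟨T, ⟨fun b => ?_, fun v hv => ?_, fun v hv b => ?_⟩, fun v b => ⟨?_, fun hb => ?_⟩⟩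
  · have := hle d b
    rw [hd] at this
    simpa using this
  · simp only [hmod, hlive v hv, columnTotal]
  · simp only [hmod, hlive v hv, columnTotal]
  · by_cases hv : G.IsDeadEnd d v
    · simp [hT, hv]
    · rw [hlive v hv]
      exact G.columnTotal_le o c v b
  · have h1 := hle v b
    rw [Nat.div_eq_of_lt ((hlt v).trans_le (Nat.pow_le_pow_right two_pos hb))] at h1
    omega

end

end SwitchGraph

/-! ### Arithmetic and unary blocks in the logic. -/

namespace Sweep

/-! ### Truth of formulas -/

/-- The formula `φ` at depth `d` is true. -/
abbrev Sat (w : List (Option Bool)) (X : ℕ → Bool) (d : ℕ) (ρ : ℕ → ℕ) (φ : Fm) : Prop :=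
  φ.eval w X d ρ = true

namespace Fm

/-- Disjunction. -/
def or (φ ψ : Fm) : Fm := neg (and (neg φ) (neg ψ))

/-- The variables `x` and `y` have the same value. -/
def eq (x y : ℕ) : Fm := and (neg (lt x y)) (neg (lt y x))

/-- The value of `x` is zero. -/
def isZero (d x : ℕ) : Fm := neg (ex (lt d x))

/-- The value of `y` is the successor of the value of `x`. -/
def succ (d x y : ℕ) : Fm := and (lt x y) (neg (ex (and (lt x d) (lt d y))))

/-- The value of `z` is the sum of the values of `x` and `y`. -/
def add (d x y z : ℕ) : Fm := and (neg (lt z x)) (cnt (and (neg (lt d x)) (lt d z)) y)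

/-- The value of `y` exceeds the value of `x` by the constant `c`. -/
def addConst : (c d x y : ℕ) → Fm
  | 0, _, x, y => eq x y
  | c + 1, d, x, y => ex (and (succ (d + 1) x d) (addConst c (d + 1) d y))

/-- The number of zeros before the position `q` is the value of `j`. -/
def zerosBefore (d q j : ℕ) : Fm := cnt (and (letter (some false) d) (lt d q)) j

/-- The block of ones with the number `j` has the length `k`. -/
def block (d j k : ℕ) : Fm := cnt (and (letter (some true) d) (zerosBefore (d + 1) d j)) k

/-- The block with the constant number `c` has the length `k`. -/
def blockConst (c d k : ℕ) : Fm :=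
  ex (ex (and (isZero (d + 2) d) (and (addConst c (d + 2) d (d + 1)) (block (d + 2) (d + 1) k))))

/-- The block with the number `2 v + c` has the length `k`. -/
def blockTwice (c d v k : ℕ) : Fm :=
  ex (ex (and (add (d + 2) v v d) (and (addConst c (d + 2) d (d + 1)) (block (d + 2) (d + 1) k))))

end Fm

section

variable {w : List (Option Bool)} {X : ℕ → Bool} {d : ℕ} {ρ : ℕ → ℕ}

theorem countP_range (p : ℕ → Bool) (n : ℕ) :
    (List.range n).countP p = Nat.count (fun v => p v = true) n := by
  induction n with
  | zero => simp
  | succ n ih => rw [List.range_succ, List.countP_append, Nat.count_succ, ih]; simp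

@[simp] theorem sat_letter (a : Option Bool) (x : ℕ) :
    Sat w X d ρ (.letter a x) ↔ w[ρ x]? = some a := by simp [Sat, Fm.eval]

@[simp] theorem sat_lt (x y : ℕ) : Sat w X d ρ (.lt x y) ↔ ρ x < ρ y := by simp [Sat, Fm.eval]

@[simp] theorem sat_mem (x : ℕ) : Sat w X d ρ (.mem x) ↔ X (ρ x) = true := Iff.rfl

@[simp] theorem sat_neg (φ : Fm) : Sat w X d ρ (.neg φ) ↔ ¬ Sat w X d ρ φ := by
  simp [Sat, Fm.eval]

@[simp] theorem sat_and (φ ψ : Fm) :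
    Sat w X d ρ (.and φ ψ) ↔ Sat w X d ρ φ ∧ Sat w X d ρ ψ := by simp [Sat, Fm.eval]

@[simp] theorem sat_ex (φ : Fm) : Sat w X d ρ (.ex φ) ↔
    ∃ v < w.length, Sat w X (d + 1) (Function.update ρ d v) φ := by simp [Sat, Fm.eval]

@[simp] theorem sat_cnt (φ : Fm) (y : ℕ) : Sat w X d ρ (.cnt φ y) ↔
    Nat.count (fun v => Sat w X (d + 1) (Function.update ρ d v) φ) w.length = ρ y := by
  simp [Sat, Fm.eval, countP_range]

@[simp] theorem sat_or (φ ψ : Fm) :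
    Sat w X d ρ (.or φ ψ) ↔ Sat w X d ρ φ ∨ Sat w X d ρ ψ := by
  unfold Fm.or
  rw [sat_neg, sat_and, sat_neg, sat_neg]
  tauto

@[simp] theorem sat_eq (x y : ℕ) : Sat w X d ρ (.eq x y) ↔ ρ x = ρ y := by
  unfold Fm.eq
  rw [sat_and, sat_neg, sat_neg, sat_lt, sat_lt]
  omega

theorem sat_isZero {x : ℕ} (hx : x < d) (hρ : ρ x < w.length) :
    Sat w X d ρ (.isZero d x) ↔ ρ x = 0 := by
  unfold Fm.isZero
  rw [sat_neg, sat_ex]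
  simp only [sat_lt, Function.update_self, Function.update_of_ne hx.ne]
  constructor
  · intro h
    by_contra hc
    exact h ⟨0, by omega, by omega⟩
  · rintro h ⟨v, -, hv⟩
    omega

theorem sat_succ {x y : ℕ} (hx : x < d) (hy : y < d) (hρ : ρ y < w.length) :
    Sat w X d ρ (.succ d x y) ↔ ρ x + 1 = ρ y := by
  unfold Fm.succ
  rw [sat_and, sat_neg, sat_ex]
  simp only [sat_and, sat_lt, Function.update_self, Function.update_of_ne hx.ne,
    Function.update_of_ne hy.ne]
  constructor
  · rintro ⟨h, h'⟩
    by_contra hc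
    exact h' ⟨ρ x + 1, by omega, by omega, by omega⟩
  · intro h
    refine ⟨by omega, ?_⟩
    rintro ⟨v, -, hv⟩
    omega

theorem count_interval (a c n : ℕ) (hc : c ≤ n) :
    Nat.count (fun p => ¬ p < a ∧ p < c) n = c - a := by
  rw [Nat.count_eq_card_filter_range]
  have : (Finset.range n).filter (fun p => ¬ p < a ∧ p < c) = Finset.Ico a c := by
    ext p
    simp
    omega
  rw [this, Nat.card_Ico]

/-- The difference of `ρ z` and `ρ x` is obtained by counting the positions of the half-open
interval between them. -/
theorem sat_add {x y z : ℕ} (hx : x < d) (hz : z < d) (hρ : ρ z < w.length) :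
    Sat w X d ρ (.add d x y z) ↔ ρ x + ρ y = ρ z := by
  unfold Fm.add
  rw [sat_and, sat_neg, sat_cnt]
  simp only [sat_and, sat_lt, sat_neg, Function.update_self, Function.update_of_ne hx.ne,
    Function.update_of_ne hz.ne]
  rw [count_interval _ _ _ hρ.le]
  omega

theorem sat_addConst (c : ℕ) : ∀ {d x y : ℕ} {ρ : ℕ → ℕ} (_ : x < d) (_ : y < d)
    (_ : ρ y < w.length), Sat w X d ρ (.addConst c d x y) ↔ ρ x + c = ρ y := by
  induction c with
  | zero => intro d x y ρ _ _ _; simp [Fm.addConst]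
  | succ c ih =>
    intro d x y ρ hx hy hρ
    rw [Fm.addConst, sat_ex]
    constructor
    · rintro ⟨v, hv, h⟩
      rw [sat_and, sat_succ (by omega) (by omega) (by simpa using hv),
        ih (by omega) (by omega) (by simpa [hy.ne] using hρ)] at h
      simp [hx.ne, hy.ne] at h
      omega
    · intro h
      refine ⟨ρ x + 1, by omega, ?_⟩
      rw [sat_and, sat_succ (by omega) (by omega) (by simp; omega),
        ih (by omega) (by omega) (by simpa [hy.ne] using hρ)]
      simp [hx.ne, hy.ne]
      omega

/-! ### Blocks of ones -/

/-- The number of zeros among the first `q` symbols. -/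
def zeros (w : List (Option Bool)) (q : ℕ) : ℕ := Nat.count (fun p => w[p]? = some (some false)) q

/-- The number of ones after exactly `j` zeros. -/
def blockLen (w : List (Option Bool)) (j : ℕ) : ℕ :=
  Nat.count (fun q => w[q]? = some (some true) ∧ zeros w q = j) w.length

theorem sat_zerosBefore {q j : ℕ} (hq : q < d) (hρ : ρ q ≤ w.length) :
    Sat w X d ρ (.zerosBefore d q j) ↔ zeros w (ρ q) = ρ j := by
  unfold Fm.zerosBefore
  rw [sat_cnt]
  simp only [sat_and, sat_lt, sat_letter, Function.update_self, Function.update_of_ne hq.ne]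
  have : Nat.count (fun v => w[v]? = some (some false) ∧ v < ρ q) w.length = zeros w (ρ q) := by
    rw [zeros, Nat.count_eq_card_filter_range, Nat.count_eq_card_filter_range]
    congr 1
    ext p
    simp only [Finset.mem_filter, Finset.mem_range]
    exact ⟨fun h => ⟨h.2.2, h.2.1⟩, fun h => ⟨by omega, h.2, h.1⟩⟩
  rw [this]

theorem sat_block {j k : ℕ} (hj : j < d) :
    Sat w X d ρ (.block d j k) ↔ blockLen w (ρ j) = ρ k := by
  unfold Fm.block
  rw [sat_cnt]
  have : Nat.count (fun v => Sat w X (d + 1) (Function.update ρ d v)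
      (.and (.letter (some true) d) (.zerosBefore (d + 1) d j))) w.length =
      blockLen w (ρ j) := by
    rw [blockLen, Nat.count_eq_card_filter_range, Nat.count_eq_card_filter_range]
    congr 1
    refine Finset.filter_congr fun v hv => ?_
    rw [Finset.mem_range] at hv
    rw [sat_and, sat_letter, sat_zerosBefore (by omega) (by simpa using hv.le)]
    simp [hj.ne]
  rw [this]

/-- The condition `c < w.length` appears because the number of the block is itself the value of a
quantified variable, hence a position. -/
theorem sat_blockConst {c k : ℕ} (hk : k < d) :
    Sat w X d ρ (.blockConst c d k) ↔ c < w.length ∧ blockLen w c = ρ k := by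
  unfold Fm.blockConst
  have h1 : k ≠ d + 1 := by omega
  rw [sat_ex]
  simp only [sat_ex]
  constructor
  · rintro ⟨z, hz, j, hj, h⟩
    rw [sat_and, sat_and, sat_isZero (by omega) (by simpa using hz),
      sat_addConst c (by omega) (by omega) (by simpa using hj), sat_block (by omega)] at h
    simp [hk.ne, h1] at h
    obtain ⟨rfl, h2, h3⟩ := h
    obtain rfl : c = j := by omega
    exact ⟨hj, h3⟩
  · rintro ⟨hc, h⟩
    refine ⟨0, by omega, c, hc, ?_⟩
    rw [sat_and, sat_and, sat_isZero (by omega) (by simp; omega),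
      sat_addConst c (by omega) (by omega) (by simpa using hc), sat_block (by omega)]
    simp [hk.ne, h1, h]

theorem sat_blockTwice {c v k : ℕ} (hv : v < d) (hk : k < d) :
    Sat w X d ρ (.blockTwice c d v k) ↔
      2 * ρ v + c < w.length ∧ blockLen w (2 * ρ v + c) = ρ k := by
  unfold Fm.blockTwice
  have h1 : k ≠ d + 1 := by omega
  have h2 : v ≠ d + 1 := by omega
  rw [sat_ex]
  simp only [sat_ex]
  constructor
  · rintro ⟨z, hz, j, hj, h⟩
    rw [sat_and, sat_and, sat_add (by omega) (by omega) (by simpa using hz),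
      sat_addConst c (by omega) (by omega) (by simpa using hj), sat_block (by omega)] at h
    simp [hk.ne, hv.ne, h1, h2] at h
    obtain ⟨rfl, h3, h4⟩ := h
    obtain rfl : 2 * ρ v + c = j := by omega
    exact ⟨hj, h4⟩
  · rintro ⟨hc, h⟩
    refine ⟨2 * ρ v, by omega, 2 * ρ v + c, hc, ?_⟩
    rw [sat_and, sat_and, sat_add (by omega) (by omega) (by simp; omega),
      sat_addConst c (by omega) (by omega) (by simpa using hc), sat_block (by omega)]
    simp [hk.ne, hv.ne, h1, h2, h]
    omega

theorem zeros_cons_succ (a : Option Bool) (w : List (Option Bool)) (q : ℕ) :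
    zeros (a :: w) (q + 1) = zeros w q + if a = some false then 1 else 0 := by
  rw [zeros, Nat.count_succ']
  simp [zeros]

@[simp] theorem zeros_zero (w : List (Option Bool)) : zeros w 0 = 0 := by simp [zeros]

@[simp] theorem blockLen_nil (j : ℕ) : blockLen [] j = 0 := by simp [blockLen]

theorem blockLen_cons_zero_zero (w : List (Option Bool)) : blockLen (some false :: w) 0 = 0 := by
  rw [blockLen, List.length_cons, Nat.count_succ']
  simp [zeros_cons_succ]

theorem blockLen_cons_zero_succ (w : List (Option Bool)) (j : ℕ) :
    blockLen (some false :: w) (j + 1) = blockLen w j := by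
  rw [blockLen, List.length_cons, Nat.count_succ']
  simp [zeros_cons_succ, blockLen]

theorem blockLen_cons_one (w : List (Option Bool)) (j : ℕ) :
    blockLen (some true :: w) j = blockLen w j + if j = 0 then 1 else 0 := by
  rw [blockLen, List.length_cons, Nat.count_succ']
  simp [zeros_cons_succ, blockLen, eq_comm]

/-- Separators do not affect the numbering, so the blocks of a certificate are numbered on from
those of the instance. -/
theorem blockLen_cons_none (w : List (Option Bool)) (j : ℕ) :
    blockLen (none :: w) j = blockLen w j := by
  rw [blockLen, List.length_cons, Nat.count_succ']
  simp [zeros_cons_succ, blockLen]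

/-- The blocks of a word that begins with blocks `bs`. -/
theorem blockLen_flatMap (bs : List ℕ) (r : List (Option Bool)) (j : ℕ) :
    blockLen ((bs.flatMap unaryCode).map some ++ r) j =
      if h : j < bs.length then bs[j] else blockLen r (j - bs.length) := by
  induction bs generalizing j with
  | nil => simp
  | cons k bs ih =>
    have h0 : ∀ k, blockLen ((unaryCode k).map some ++
        ((bs.flatMap unaryCode).map some ++ r)) 0 = k := by
      intro k
      induction k with
      | zero => simp [unaryCode, blockLen_cons_zero_zero]
      | succ k ihk =>
        simp only [unaryCode, List.replicate_succ, List.cons_append, List.map_cons] at ihk ⊢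
        rw [blockLen_cons_one, ihk]
        rfl
    have h1 : ∀ k j, blockLen ((unaryCode k).map some ++
        ((bs.flatMap unaryCode).map some ++ r)) (j + 1) =
          blockLen ((bs.flatMap unaryCode).map some ++ r) j := by
      intro k j
      induction k with
      | zero => simp [unaryCode, blockLen_cons_zero_succ]
      | succ k ihk =>
        simp only [unaryCode, List.replicate_succ, List.cons_append, List.map_cons] at ihk ⊢
        rw [blockLen_cons_one, ihk]
        rfl
    rw [List.flatMap_cons, List.map_append, List.append_assoc]
    cases j with
    | zero => simp [h0]
    | succ j => simp [h1, ih]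

theorem zeros_flatMap (bs : List ℕ) (r : List (Option Bool)) (q : ℕ) :
    zeros ((bs.flatMap unaryCode).map some ++ r) ((bs.flatMap unaryCode).length + q) =
      bs.length + zeros r q := by
  induction bs with
  | nil => simp
  | cons k bs ih =>
    have : ∀ k (s : List (Option Bool)) q, zeros ((unaryCode k).map some ++ s) (k + 1 + q) =
        zeros s q + 1 := by
      intro k s q
      induction k with
      | zero =>
        rw [show 0 + 1 + q = q + 1 by ring]
        simp [unaryCode, zeros_cons_succ]
      | succ k ihk =>
        rw [show k + 1 + 1 + q = (k + 1 + q) + 1 by ring]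
        simp only [unaryCode, List.replicate_succ, List.cons_append, List.map_cons] at ihk ⊢
        rw [zeros_cons_succ, ihk]
        simp
    have hl : (unaryCode k).length = k + 1 := by simp [unaryCode]
    rw [List.flatMap_cons, List.map_append, List.append_assoc, List.length_append, hl, add_assoc,
      this, ih, List.length_cons]
    ring

/-- A block uses only positions without a zero. So block lengths stay below the length of the word
by at least the number of zeros, which leaves room for them as values of variables. -/
theorem blockLen_add_zeros_le (w : List (Option Bool)) (j : ℕ) :
    blockLen w j + zeros w w.length ≤ w.length := by
  have h1 : blockLen w j ≤ Nat.count (fun q => ¬ w[q]? = some (some false)) w.length := by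
    rw [blockLen, Nat.count_eq_card_filter_range, Nat.count_eq_card_filter_range]
    refine Finset.card_le_card (Finset.monotone_filter_right _ fun q _ hq => ?_)
    simp [hq.1]
  have h2 : Nat.count (fun q => ¬ w[q]? = some (some false)) w.length + zeros w w.length =
      w.length := by
    rw [zeros, Nat.count_eq_card_filter_range, Nat.count_eq_card_filter_range, add_comm]
    rw [Finset.card_filter_add_card_filter_not, Finset.card_range]
  omega

end

end Sweep

/-! ### The encoding of an instance as a list of unary blocks. -/

open SwitchGraph

theorem unaryCode_length (k : ℕ) : (unaryCode k).length = k + 1 := by simp [unaryCode]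

theorem flatMap_unaryCode_length (bs : List ℕ) :
    (bs.flatMap unaryCode).length = bs.sum + bs.length := by
  induction bs with
  | nil => rfl
  | cons k bs ih =>
    rw [List.flatMap_cons, List.length_append, ih, unaryCode_length, List.sum_cons,
      List.length_cons]
    omega

theorem getElem?_flatMap_pair {n : ℕ} (f g : Fin n → ℕ) :
    ((List.finRange n).flatMap fun v => [f v, g v]).length = 2 * n ∧ ∀ v : Fin n,
      ((List.finRange n).flatMap fun v => [f v, g v])[2 * v.1]? = some (f v) ∧
      ((List.finRange n).flatMap fun v => [f v, g v])[2 * v.1 + 1]? = some (g v) := by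
  induction n with
  | zero => exact ⟨rfl, fun v => v.elim0⟩
  | succ n ih =>
    obtain ⟨h1, h2⟩ := ih (fun v => f v.succ) (fun v => g v.succ)
    rw [List.finRange_succ, List.flatMap_cons, List.flatMap_map]
    refine ⟨by rw [List.length_append, h1]; simp; ring, fun v => ?_⟩
    refine Fin.cases (by simp) (fun v => ?_) v
    obtain ⟨h3, h4⟩ := h2 v
    constructor
    · rw [Fin.val_succ, show 2 * (v.1 + 1) = 2 * v.1 + 1 + 1 by ring]
      simpa using h3
    · rw [Fin.val_succ, show 2 * (v.1 + 1) + 1 = 2 * v.1 + 1 + 1 + 1 by ring]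
      simpa using h4

namespace ArrivalInstance

/-- The numbers in the encoding of an instance. -/
def blocks (I : ArrivalInstance) : List ℕ :=
  I.n :: I.o.1 :: I.d.1 :: (List.finRange I.n).flatMap fun v => [(I.G.s₀ v).1, (I.G.s₁ v).1]

theorem encode_eq (I : ArrivalInstance) : I.encode = I.blocks.flatMap unaryCode := by
  simp [encode, blocks, List.flatMap_assoc]

theorem blocks_length (I : ArrivalInstance) : I.blocks.length = 2 * I.n + 3 := by
  simp [blocks, (getElem?_flatMap_pair _ _).1]

theorem le_encode_length (I : ArrivalInstance) : 3 * I.n + 3 ≤ I.encode.length := by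
  rw [encode_eq, flatMap_unaryCode_length, blocks_length]
  simp only [blocks, List.sum_cons]
  omega

end ArrivalInstance

namespace Sweep

/-- The first blocks of the word `w` are the numbers in the encoding of `I`. -/
structure Codes (w : List (Option Bool)) (I : ArrivalInstance) : Prop where
  length : 3 * I.n + 4 ≤ w.length
  le_zeros : 3 ≤ zeros w w.length
  size : blockLen w 0 = I.n
  origin : blockLen w 1 = I.o
  dest : blockLen w 2 = I.d
  even : ∀ v : Fin I.n, blockLen w (2 * v + 3) = I.G.s₀ v
  odd : ∀ v : Fin I.n, blockLen w (2 * v + 4) = I.G.s₁ v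

theorem blockLen_eq_of_getElem? {bs : List ℕ} {r : List (Option Bool)} {j k : ℕ}
    (h : bs[j]? = some k) : blockLen ((bs.flatMap unaryCode).map some ++ r) j = k := by
  obtain ⟨hj, rfl⟩ := List.getElem?_eq_some_iff.1 h
  rw [blockLen_flatMap, dif_pos hj]

/-- The number of a block depends only on the symbols before it, so the rest `r` is arbitrary: it is
empty for the reduction and the certificate for the verifier. The length bound includes the
separator. -/
theorem codes_encode (I : ArrivalInstance) (r : List (Option Bool)) :
    Codes (I.encode.map some ++ none :: r) I where
  length := by
    have := I.le_encode_length
    simp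
    omega
  le_zeros := by
    rw [I.encode_eq, List.length_append, List.length_map, zeros_flatMap, I.blocks_length]
    omega
  size := by rw [I.encode_eq]; exact blockLen_eq_of_getElem? rfl
  origin := by rw [I.encode_eq]; exact blockLen_eq_of_getElem? rfl
  dest := by rw [I.encode_eq]; exact blockLen_eq_of_getElem? rfl
  even v := by
    rw [I.encode_eq]
    refine blockLen_eq_of_getElem? ?_
    simpa [ArrivalInstance.blocks] using
      ((getElem?_flatMap_pair (fun v => (I.G.s₀ v).1) (fun v => (I.G.s₁ v).1)).2 v).1
  odd v := by
    rw [I.encode_eq]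
    refine blockLen_eq_of_getElem? ?_
    simpa [ArrivalInstance.blocks] using
      ((getElem?_flatMap_pair (fun v => (I.G.s₀ v).1) (fun v => (I.G.s₁ v).1)).2 v).2

/-! ### Dead ends -/

/-- The vertex `0` is the destination, or one of its successors is in the set. -/
def reachFm : Fm :=
  .or (.blockConst 2 1 0) (.ex (.and (.mem 1) (.or (.blockTwice 3 2 0 1) (.blockTwice 4 2 0 1))))

section

variable {w : List (Option Bool)} {I : ArrivalInstance}

theorem Codes.stepSet_iff (h : Codes w I) (X : ℕ → Bool) (v : Fin I.n) :
    stepSet w reachFm X v = true ↔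
      v = I.d ∨ X (I.G.s₀ v) = true ∨ X (I.G.s₁ v) = true := by
  have hl := h.length
  have hv := v.2
  rw [stepSet, Bool.and_eq_true, decide_eq_true_eq]
  change v.1 < w.length ∧ Sat w X 1 _ reachFm ↔ _
  rw [reachFm, sat_or, sat_ex, sat_blockConst (by omega), h.dest]
  simp only [sat_and, sat_or, sat_mem]
  have key : ∀ k c, Sat w X 2 (Function.update (Function.update (fun _ => 0) 0 v.1) 1 k)
      (.blockTwice c 2 0 1) ↔ 2 * v.1 + c < w.length ∧ blockLen w (2 * v.1 + c) = k :=
    fun k c => sat_blockTwice (by omega) (by omega)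
  have h2 := (I.G.s₀ v).2
  have h3 := (I.G.s₁ v).2
  simp only [Nat.reduceAdd] at key ⊢
  simp only [key, h.even, h.odd, Function.update_self, Fin.ext_iff, eq_comm (a := v.1)]
  constructor
  · rintro ⟨-, h1 | ⟨k, -, hX, ⟨-, rfl⟩ | ⟨-, rfl⟩⟩⟩
    · exact Or.inl h1.2
    · exact Or.inr (Or.inl hX)
    · exact Or.inr (Or.inr hX)
  · rintro (h1 | h1 | h1)
    · exact ⟨by omega, Or.inl ⟨by omega, h1⟩⟩
    · exact ⟨by omega, Or.inr ⟨_, by omega, h1, Or.inl ⟨by omega, rfl⟩⟩⟩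
    · exact ⟨by omega, Or.inr ⟨_, by omega, h1, Or.inr ⟨by omega, rfl⟩⟩⟩

/-- An increasing iteration of subsets of a finite set is constant from some point on. -/
theorem iterate_eq_of_card_le {α : Type*} [Fintype α] [DecidableEq α] {F : Finset α → Finset α}
    (S : ℕ → Finset α) (hS : ∀ i, S (i + 1) = F (S i)) (hmono : ∀ i, S i ⊆ S (i + 1)) {N : ℕ}
    (hN : Fintype.card α ≤ N) : S N = S (N + 1) := by
  have key : ∀ i, S i = S (i + 1) ∨ i < (S (i + 1)).card := by
    intro i
    induction i with
    | zero =>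
      rcases (hmono 0).eq_or_ssubset with h | h
      · exact Or.inl h
      · exact Or.inr (lt_of_le_of_lt (Nat.zero_le _) (Finset.card_lt_card h))
    | succ i ih =>
      rcases ih with h | h
      · exact Or.inl (by rw [hS (i + 1), ← h, ← hS i, h])
      · rcases (hmono (i + 1)).eq_or_ssubset with h' | h'
        · exact Or.inl h'
        · exact Or.inr (lt_of_le_of_lt h (Finset.card_lt_card h'))
  refine (key N).resolve_right fun h => ?_
  have := Finset.card_le_univ (S (N + 1))
  omega

/-- The set of all vertices from which the destination can be reached. -/
def reachSet (w : List (Option Bool)) : ℕ → Bool := (stepSet w reachFm)^[w.length] fun _ => false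

/-- By induction on the rounds, every vertex that enters the set has a path to the destination.
Conversely, the iterates restricted to vertices increase and are stable after n rounds, fewer than
are performed. The stable set contains the destination and all predecessors of its members. -/
theorem Codes.reachSet_iff (h : Codes w I) (v : Fin I.n) :
    reachSet w v = true ↔ ¬ I.G.IsDeadEnd I.d v := by
  set X : ℕ → ℕ → Bool := fun i => (stepSet w reachFm)^[i] fun _ => false with hX
  have hs : ∀ i (v : Fin I.n), X (i + 1) v = true ↔
      v = I.d ∨ X i (I.G.s₀ v) = true ∨ X i (I.G.s₁ v) = true := fun i v => by
    rw [hX]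
    dsimp only
    rw [Function.iterate_succ_apply']
    exact h.stepSet_iff _ v
  constructor
  · have : ∀ i (v : Fin I.n), X i v = true → ¬ I.G.IsDeadEnd I.d v := by
      intro i
      induction i with
      | zero => intro v hv; cases hv
      | succ i ih =>
        intro v hv
        rcases (hs i v).1 hv with rfl | hv | hv
        · exact I.G.not_isDeadEnd_self _
        · exact reaches_of_edge (I.G.edge_s₀ v) (ih _ hv)
        · exact reaches_of_edge (I.G.edge_s₁ v) (ih _ hv)
    exact this _ v
  · intro hv
    set S : ℕ → Finset (Fin I.n) := fun i => Finset.univ.filter fun v => X i v = true with hS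
    have hmem : ∀ i v, v ∈ S i ↔ X i v = true := fun i v => by simp [hS]
    have hstep : ∀ i, S (i + 1) = Finset.univ.filter fun v =>
        v = I.d ∨ I.G.s₀ v ∈ S i ∨ I.G.s₁ v ∈ S i := fun i => by
      ext v
      rw [hmem, hs]
      simp [hmem]
    have hmono : ∀ i, S i ⊆ S (i + 1) := by
      intro i
      induction i with
      | zero => intro v hv; rw [hmem] at hv; cases hv
      | succ i ih =>
        rw [hstep (i + 1)]
        intro v hv
        rw [hstep i] at hv
        simp only [Finset.mem_filter, Finset.mem_univ, true_and] at hv ⊢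
        exact hv.imp id (Or.imp (fun h => ih h) fun h => ih h)
    have hl := h.length
    have heq := iterate_eq_of_card_le (F := fun S => Finset.univ.filter fun v =>
      v = I.d ∨ I.G.s₀ v ∈ S ∨ I.G.s₁ v ∈ S) S hstep hmono (N := w.length)
      (by rw [Fintype.card_fin]; omega)
    change X w.length v = true
    rw [← hmem]
    have hclosed : ∀ v, v = I.d ∨ I.G.s₀ v ∈ S w.length ∨ I.G.s₁ v ∈ S w.length →
        v ∈ S w.length := by
      intro v hv
      rw [heq, hstep]
      simpa using hv
    refine Relation.ReflTransGen.head_induction_on (not_not.1 hv) (hclosed _ (Or.inl rfl)) ?_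
    rintro u v' huv - hv'
    rcases huv with ⟨x, hx⟩ | ⟨x, hx⟩ <;> simp only [Prod.mk.injEq] at hx <;>
      obtain ⟨rfl, rfl⟩ := hx
    · exact hclosed _ (Or.inr (Or.inl hv'))
    · exact hclosed _ (Or.inr (Or.inr hv'))

end

/-! ### The reduction -/

/-- Print the value of the variable `d + 1` for which the formula `ψ` at depth `d + 2` is true. -/
def Printer.unary (d : ℕ) (ψ : Fm) : Printer :=
  .append (.each (.ite (.ex (.and ψ (.lt d (d + 1)))) (.bit true) .nil)) (.bit false)

/-- The variable `k` is the new successor of the vertex `0`, where the old successors are given by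
the blocks with the numbers `2 v + c`. -/
def newSuccFm (c d k : ℕ) : Fm :=
  .or (.and (.neg (.mem 0)) (.blockConst 0 d k)) <|
    .or (.and (.mem 0) (.and (.blockConst 2 d 0) (.eq k 0)))
      (.and (.mem 0) (.and (.neg (.blockConst 2 d 0)) (.blockTwice c d 0 k)))

/-- The printer of the instance `(Ḡ, o, d̄)`, where both successors of `d̄` are `d̄`. -/
def barPrinter : Printer :=
  .append (.bit true) <| .append (.unary 0 (.blockConst 0 2 1)) <|
    .append (.unary 0 (.blockConst 1 2 1)) <| .append (.unary 0 (.blockConst 0 2 1)) <|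
      .append (.each (.ite (.ex (.and (.blockConst 0 2 1) (.lt 0 1)))
        (.append (.unary 1 (newSuccFm 3 3 2)) (.unary 1 (newSuccFm 4 3 2))) .nil)) <|
        .append (.unary 0 (.blockConst 0 2 1)) (.unary 0 (.blockConst 0 2 1))

theorem flatMap_range_ite_lt (f : ℕ → List Bool) {k N : ℕ} (hk : k ≤ N) :
    ((List.range N).flatMap fun q => if q < k then f q else []) = (List.range k).flatMap f := by
  induction N with
  | zero => obtain rfl : k = 0 := by omega
            rfl
  | succ N ih =>
    rcases Nat.lt_or_eq_of_le hk with hk | rfl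
    · rw [List.range_succ, List.flatMap_append, ih (by omega)]
      simp
      omega
    · refine List.flatMap_congr fun q hq => ?_
      rw [if_pos (List.mem_range.1 hq)]

/-- One bit is printed for each position `q < k`, so a printed number must be less than the length
of the word. -/
theorem Printer.eval_unary {w : List (Option Bool)} {X : ℕ → Bool} {d : ℕ} {ρ : ℕ → ℕ} {ψ : Fm}
    {k : ℕ} (hk : k < w.length)
    (h : ∀ q < w.length, ∀ i < w.length,
      (Sat w X (d + 2) (Function.update (Function.update ρ d q) (d + 1) i) ψ ↔ i = k)) :
    (Printer.unary d ψ).eval w X d ρ = unaryCode k := by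
  have : ∀ q ∈ List.range w.length, (Printer.ite (.ex (.and ψ (.lt d (d + 1)))) (.bit true)
      .nil).eval w X (d + 1) (Function.update ρ d q) = if q < k then [true] else [] := by
    intro q hq
    rw [List.mem_range] at hq
    rw [Printer.eval]
    refine if_congr ?_ rfl rfl
    change Sat w X (d + 1) _ (.ex _) ↔ _
    rw [sat_ex]
    constructor
    · rintro ⟨i, hi, hs⟩
      rw [sat_and, sat_lt] at hs
      obtain ⟨h1, h2⟩ := hs
      rw [(h q hq i hi).1 h1] at h2
      simpa using h2
    · intro hlt
      refine ⟨k, hk, ?_⟩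
      rw [sat_and, sat_lt]
      exact ⟨(h q hq k hk).2 rfl, by simpa using hlt⟩
  change ((List.range w.length).flatMap fun q => Printer.eval w X (d + 1) (Function.update ρ d q)
    (.ite (.ex (.and ψ (.lt d (d + 1)))) (.bit true) .nil)) ++ [false] = _
  rw [List.flatMap_congr this, flatMap_range_ite_lt (fun _ => [true]) hk.le, unaryCode]
  congr 1
  clear this h hk
  induction k with
  | zero => rfl
  | succ k ih =>
    rw [List.range_succ, List.flatMap_append, List.replicate_succ', ih]
    rfl

theorem flatMap_range_eq_finRange (f : ℕ → List Bool) (n : ℕ) :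
    (List.range n).flatMap f = (List.finRange n).flatMap fun v : Fin n => f v := by
  rw [← List.map_coe_finRange_eq_range, List.flatMap_map]

section

variable {w : List (Option Bool)} {I : ArrivalInstance}

theorem Codes.sat_lt_size (h : Codes w I) {X : ℕ → Bool} {d x : ℕ} {ρ : ℕ → ℕ} (hx : x < d) :
    Sat w X d ρ (.ex (.and (.blockConst 0 (d + 1) d) (.lt x d))) ↔ ρ x < I.n := by
  have hl := h.length
  rw [sat_ex]
  simp only [sat_and, sat_lt, sat_blockConst (Nat.lt_succ_self d), h.size, Function.update_self,
    Function.update_of_ne hx.ne]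
  constructor
  · rintro ⟨v, -, ⟨-, rfl⟩, hv⟩
    exact hv
  · intro hv
    exact ⟨I.n, by omega, ⟨by omega, rfl⟩, hv⟩

theorem eval_unary_blockConst {X : ℕ → Bool} {ρ : ℕ → ℕ} {c : ℕ}
    (hc : c < w.length) (hk : blockLen w c < w.length) :
    (Printer.unary 0 (.blockConst c 2 1)).eval w X 0 ρ = unaryCode (blockLen w c) := by
  refine Printer.eval_unary hk fun q _ i _ => ?_
  rw [sat_blockConst (by omega)]
  simp [hc, eq_comm]

theorem Codes.eval_unary_newSucc (h : Codes w I) {X : ℕ → Bool} {c : ℕ} {ρ : ℕ → ℕ}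
    (v s : Fin I.n) (hv : ρ 0 = v) (hc : c ≤ 4) (hs : blockLen w (2 * v + c) = s) :
    (Printer.unary 1 (newSuccFm c 3 2)).eval w X 1 ρ =
      unaryCode (if X v = true then if v = I.d then v.1 else s.1 else I.n) := by
  have hl := h.length
  have hv' := v.2
  have hs' := s.2
  refine Printer.eval_unary ?_ fun q _ i hi => ?_
  · split_ifs <;> omega
  · rw [newSuccFm, sat_or, sat_or]
    simp only [sat_and, sat_neg, sat_mem, sat_eq, Nat.reduceAdd]
    rw [sat_blockConst (by omega), sat_blockConst (by omega), sat_blockTwice (by omega) (by omega)]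
    have h0 : Function.update (Function.update ρ 1 q) 2 i 0 = v := by simp [hv]
    have h2 : Function.update (Function.update ρ 1 q) 2 i 2 = i := by simp
    rw [h0, h2, h.size, h.dest, hs]
    have hlt : 2 * v.1 + c < w.length := by omega
    have hlt0 : 0 < w.length := by omega
    have hlt2 : 2 < w.length := by omega
    simp only [hlt, hlt0, hlt2, true_and, Fin.ext_iff]
    have hcomm : I.d.1 = v.1 ↔ v.1 = I.d.1 := eq_comm
    rw [hcomm]
    split_ifs with h1 h3
    · rw [h3] at h1 ⊢
      simp [h1]
    · simp [h1, h3, eq_comm]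
    · simp [h1, eq_comm]

end

-- The new first number n + 1 is written as a one followed by the code of n, and d̄ itself has the
-- number n. The printer therefore needs no number beyond n. Sending both successors of d̄ to d̄
-- keeps the final part equally simple.
open Classical in
theorem ArrivalInstance.encode_bar (I : ArrivalInstance) :
    (I.bar none none).encode = true :: (unaryCode I.n ++ (unaryCode I.o ++ (unaryCode I.n ++
      (((List.finRange I.n).flatMap fun v =>
        unaryCode (if ¬ I.G.IsDeadEnd I.d v then if v = I.d then v.1 else (I.G.s₀ v).1 else I.n) ++
        unaryCode (if ¬ I.G.IsDeadEnd I.d v then if v = I.d then v.1 else (I.G.s₁ v).1 else I.n)) ++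
      (unaryCode I.n ++ unaryCode I.n))))) := by
  have h1 : unaryCode (I.n + 1) = true :: unaryCode I.n := rfl
  have h2 : ∀ (p : Prop) [Decidable p] (q : Prop) [Decidable q] (u s : Fin I.n),
      ((finSuccEquivLast.symm (if p then none else if q then some u else some s) :
        Fin (I.n + 1)) : ℕ) = if ¬ p then if q then u.1 else s.1 else I.n := by
    intro p _ q _ u s
    split_ifs <;> simp_all
  simp only [ArrivalInstance.encode, ArrivalInstance.bar, h1, SwitchGraph.rename, Equiv.symm_symm]
  rw [List.finRange_succ_last, List.flatMap_append, List.flatMap_map]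
  simp only [List.flatMap_cons, List.flatMap_nil, finSuccEquivLast_last,
    finSuccEquivLast_castSucc, SwitchGraph.bar, List.append_nil, List.append_assoc,
    finSuccEquivLast_symm_none, finSuccEquivLast_symm_some, Fin.val_last, Fin.val_castSucc,
    List.cons_append, h2]
  have : ∀ v s : Fin I.n, (if v = I.d then I.d.1 else s.1) = if v = I.d then v.1 else s.1 := by
    intro v s
    split_ifs with h <;> simp [h]
  refine congrArg (fun l => true :: (unaryCode I.n ++ (unaryCode I.o ++ (unaryCode I.n ++
    (l ++ (unaryCode I.n ++ unaryCode I.n)))))) (List.flatMap_congr fun v _ => ?_)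
  rw [← this, ← this]
  congr!

theorem eval_barPrinter (I : ArrivalInstance) {w : List (Option Bool)} (h : Codes w I) :
    barPrinter.eval w (reachSet w) 0 (fun _ => 0) = (I.bar none none).encode := by
  have hl := h.length
  have ho := I.o.2
  rw [ArrivalInstance.encode_bar, barPrinter]
  simp only [Printer.eval]
  rw [eval_unary_blockConst (by omega) (by rw [h.size]; omega),
    eval_unary_blockConst (by omega) (by rw [h.origin]; omega), h.size, h.origin]
  refine congrArg (fun l => true :: (unaryCode I.n ++ (unaryCode I.o ++ (unaryCode I.n ++
    (l ++ (unaryCode I.n ++ unaryCode I.n)))))) ?_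
  have key : ∀ v ∈ List.range w.length,
      (if Sat w (reachSet w) 1 (Function.update (fun _ => 0) 0 v) _ then _ else _) = if v < I.n then
    (Printer.append (.unary 1 (newSuccFm 3 3 2)) (.unary 1 (newSuccFm 4 3 2))).eval w (reachSet w) 1
      (Function.update (fun _ => 0) 0 v) else [] := fun v _ =>
    if_congr ((h.sat_lt_size (X := reachSet w) (ρ := Function.update (fun _ => 0) 0 v)
      Nat.zero_lt_one).trans (by rw [Function.update_self])) rfl rfl
  refine (List.flatMap_congr key).trans ?_
  rw [flatMap_range_ite_lt _ (by omega), flatMap_range_eq_finRange]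
  refine List.flatMap_congr fun v _ => ?_
  rw [Printer.eval, h.eval_unary_newSucc v _ (by simp) (by omega) (h.even v),
    h.eval_unary_newSucc v _ (by simp) (by omega) (h.odd v)]
  have hv := h.reachSet_iff v
  by_cases hX : reachSet w v = true
  · rw [if_pos hX, if_pos hX, if_pos (hv.1 hX), if_pos (hv.1 hX)]
  · rw [if_neg hX, if_neg hX, if_neg (mt hv.2 hX), if_neg (mt hv.2 hX)]

theorem polyTime_bar : Nonempty (Turing.TM2ComputableInPolyTime
    ArrivalInstance.encode ArrivalInstance.encode fun I => I.bar none none) := by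
  -- `D` is any bound on the nesting depth that passes the well-formedness check. The separator is
  -- appended to the input so that `codes_encode` applies with an empty rest.
  refine polyTime_of_printer (D := 12) (by decide) (φ := reachFm) (by decide) (π := barPrinter)
    (by decide) some (some none) _ _ _ fun I w hw => ?_
  subst hw
  exact (eval_barPrinter I (codes_encode I [])).symm

end Sweep

theorem ArrivalInstance.yes_iff_not_bar (I : ArrivalInstance) (a b : Option (Fin I.n)) :
    I.Yes ↔ ¬ (I.bar a b).Yes :=
  (runTerminates_iff_not_bar I.G I.o I.d a b).trans
    (not_congr (runTerminates_rename (I.G.bar I.d a b) (some I.o) finSuccEquivLast.symm none).symm)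

/-! ### The encodings of instances -/

/-- Any string that ends in zero is a concatenation of unary codes, so a final zero is all that has
to be checked about its block structure. The first block is split off because a new leading one
lengthens it. -/
theorem exists_flatMap_unaryCode (x : List Bool) :
    ∃ k bs, x ++ [false] = (k :: bs : List ℕ).flatMap unaryCode := by
  induction x with
  | nil => exact ⟨0, [], rfl⟩
  | cons a x ih =>
    obtain ⟨k, bs, h⟩ := ih
    cases a with
    | false => exact ⟨0, k :: bs, by rw [List.cons_append, h]; rfl⟩
    | true => exact ⟨k + 1, bs, by rw [List.cons_append, h]; rfl⟩

theorem ArrivalInstance.exists_blocks_eq {n : ℕ} {bs : List ℕ} (hl : bs.length = 2 * n + 3)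
    (h0 : bs[0]? = some n) (hlt : ∀ j k, j ≠ 0 → bs[j]? = some k → k < n) :
    ∃ I : ArrivalInstance, I.blocks = bs := by
  have hget : ∀ j (hj : j < 2 * n + 3), j ≠ 0 → bs[j]'(by omega) < n := fun j hj h =>
    hlt j _ h (List.getElem?_eq_getElem _)
  refine ⟨⟨n, ⟨fun v => ⟨_, hget (2 * v + 3) (by omega) (by omega)⟩,
    fun v => ⟨_, hget (2 * v + 4) (by omega) (by omega)⟩⟩, ⟨_, hget 1 (by omega) (by omega)⟩,
    ⟨_, hget 2 (by omega) (by omega)⟩⟩, List.ext_getElem? fun i => ?_⟩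
  match i with
  | 0 => exact h0.symm
  | 1 => exact (List.getElem?_eq_getElem _).symm
  | 2 => exact (List.getElem?_eq_getElem _).symm
  | i + 3 =>
    simp only [blocks, List.getElem?_cons_succ]
    obtain ⟨h1, h2⟩ := getElem?_flatMap_pair
      (fun v : Fin n => bs[2 * v.1 + 3]'(by omega)) (fun v : Fin n => bs[2 * v.1 + 4]'(by omega))
    by_cases hi : i < 2 * n
    · have hv : i / 2 < n := by omega
      obtain ⟨h3, h4⟩ := h2 ⟨i / 2, hv⟩
      rcases Nat.mod_two_eq_zero_or_one i with h | h
      · have e : 2 * (i / 2) = i := by omega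
        simp only [e] at h3
        rw [h3, List.getElem?_eq_getElem (by omega)]
      · have e : 2 * (i / 2) + 1 = i := by omega
        have e' : 2 * (i / 2) + 4 = i + 3 := by omega
        simp only [e, e'] at h4
        rw [h4, List.getElem?_eq_getElem (by omega)]
    · rw [List.getElem?_eq_none (by omega), List.getElem?_eq_none (by omega)]

namespace Sweep

theorem forall_update_lt {N d : ℕ} {ρ : ℕ → ℕ} (h : ∀ i < d, ρ i < N) {v : ℕ} (hv : v < N) :
    ∀ i < d + 1, Function.update ρ d v i < N := by
  intro i hi
  rcases eq_or_ne i d with rfl | h'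
  · rwa [Function.update_self]
  · rw [Function.update_of_ne h']
    exact h i (by omega)

/-- The part of the word before the separator is the encoding of an instance. -/
def isCodeFm : Fm :=
  .ex <| .and (.letter none 0) <| .ex <| .and (.zerosBefore 2 0 1) <| .ex <|
    .and (.blockConst 0 3 2) <| .and (.ex (.and (.add 4 2 2 3) (.addConst 3 4 3 1))) <|
      .and (.ex (.and (.succ 4 3 0) (.letter (some false) 3))) <|
        .neg <| .ex <| .and (.neg (.isZero 4 3)) <| .and (.lt 3 1) <|
          .ex <| .and (.block 5 3 4) (.neg (.lt 4 2))

theorem sat_isCodeFm {w : List (Option Bool)} {X : ℕ → Bool} {ρ : ℕ → ℕ} :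
    Sat w X 0 ρ isCodeFm ↔ ∃ h < w.length, w[h]? = some none ∧ ∃ Z < w.length, zeros w h = Z ∧
      ∃ n < w.length, (0 < w.length ∧ blockLen w 0 = n) ∧ (∃ t < w.length, n + n = t ∧ t + 3 = Z) ∧
        (∃ p < w.length, p + 1 = h ∧ w[p]? = some (some false)) ∧
          ¬ ∃ j < w.length, ¬ j = 0 ∧ j < Z ∧ ∃ k < w.length, blockLen w j = k ∧ ¬ k < n := by
  have h0 : ∀ i < 0, ρ i < w.length := fun i hi => by omega
  rw [isCodeFm, sat_ex]
  refine exists_congr fun h => and_congr_right fun hh => ?_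
  have h1 := forall_update_lt h0 hh
  rw [sat_and, sat_letter, sat_ex]
  refine and_congr (by simp) (exists_congr fun Z => and_congr_right fun hZ => ?_)
  have h2 := forall_update_lt h1 hZ
  rw [sat_and, sat_zerosBefore (by omega) (h2 _ (by omega)).le, sat_ex]
  refine and_congr (by simp) (exists_congr fun n => and_congr_right fun hn => ?_)
  have h3 := forall_update_lt h2 hn
  rw [sat_and, sat_blockConst (by omega), sat_and, sat_and, sat_ex, sat_ex, sat_neg, sat_ex]
  refine and_congr (by simp) (and_congr (exists_congr fun t => and_congr_right fun ht => ?_)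
    (and_congr (exists_congr fun p => and_congr_right fun hp => ?_)
      (not_congr (exists_congr fun j => and_congr_right fun hj => ?_))))
  · have h4 := forall_update_lt h3 ht
    rw [sat_and, sat_add (by omega) (by omega) (h4 _ (by omega)),
      sat_addConst 3 (by omega) (by omega) (h4 _ (by omega))]
    simp
  · have h4 := forall_update_lt h3 hp
    rw [sat_and, sat_succ (by omega) (by omega) (h4 _ (by omega)), sat_letter]
    simp
  · have h4 := forall_update_lt h3 hj
    rw [sat_and, sat_neg, sat_isZero (by omega) (h4 _ (by omega)), sat_and, sat_lt, sat_ex]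
    refine and_congr (by simp) (and_congr (by simp)
      (exists_congr fun k => and_congr_right fun hk => ?_))
    rw [sat_and, sat_block (by omega), sat_neg, sat_lt]
    simp

theorem getElem?_pairCode_eq_none {x y : List Bool} {h : ℕ} :
    (pairCode (x, y))[h]? = some none ↔ h = x.length := by
  rw [pairCode]
  rcases lt_trichotomy h x.length with hl | rfl | hl
  · rw [List.getElem?_append_left (by simpa using hl)]
    simp
    omega
  · simp
  · rw [List.getElem?_append_right (by simpa using hl.le)]
    obtain ⟨k, hk⟩ := Nat.exists_eq_add_of_lt hl
    simp [hk, show x.length + k + 1 - x.length = k + 1 by omega]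
    omega

/-- The formula locates the separator and requires a final zero before it, 2n + 3 blocks for the
length n of the first block, and later blocks shorter than n. By `exists_blocks_eq` these conditions
characterise the block lists of instances. -/
theorem sat_isCodeFm_pairCode {x y : List Bool} {X : ℕ → Bool} {ρ : ℕ → ℕ} :
    Sat (pairCode (x, y)) X 0 ρ isCodeFm ↔ ∃ I : ArrivalInstance, I.encode = x := by
  rw [sat_isCodeFm]
  have hN : (pairCode (x, y)).length = x.length + y.length + 1 := by
    simp [pairCode]
    omega
  constructor
  · rintro ⟨h, -, hh, Z, -, rfl, n, -, ⟨-, h0⟩, ⟨t, -, rfl, ht⟩, ⟨p, -, hp, hw⟩, hlt⟩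
    rw [getElem?_pairCode_eq_none] at hh
    subst hh
    obtain ⟨x, a, rfl⟩ : ∃ x' a, x = x' ++ [a] :=
      ⟨_, _, (List.dropLast_append_getLast (by rintro rfl; simp at hp)).symm⟩
    obtain rfl : a = false := by
      obtain rfl : p = x.length := by simpa using hp
      simpa [pairCode] using hw
    obtain ⟨k, bs, hx⟩ := exists_flatMap_unaryCode x
    generalize k :: bs = bs at hx
    rw [hx] at h0 ht hlt hN ⊢
    have hz := zeros_flatMap bs (none :: y.map some) 0
    rw [add_zero, zeros_zero, add_zero] at hz
    rw [pairCode] at hN h0 ht hlt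
    rw [hz] at ht hlt
    have hj : ∀ j k, bs[j]? = some k → blockLen ((bs.flatMap unaryCode).map some ++
      none :: y.map some) j = k := fun j k h => blockLen_eq_of_getElem? h
    have hsum := flatMap_unaryCode_length bs
    obtain ⟨I, hI⟩ := ArrivalInstance.exists_blocks_eq (n := n) (bs := bs) (by omega)
      (by
        have hb : bs[0]? = some (bs[0]'(by omega)) := List.getElem?_eq_getElem _
        rw [hb]
        exact congrArg some ((hj 0 _ hb).symm.trans h0)) (by
        intro j k hj0 hk
        by_contra hc
        obtain ⟨hjl, rfl⟩ := List.getElem?_eq_some_iff.1 hk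
        have := List.single_le_sum (by simp) _ (List.getElem_mem hjl)
        exact hlt ⟨j, by omega, hj0, hjl, _, by omega, hj j _ hk, hc⟩)
    exact ⟨I, by rw [I.encode_eq, hI]⟩
  · rintro ⟨I, rfl⟩
    have hc := codes_encode I (y.map some)
    have hl := I.le_encode_length
    have hbl := I.blocks_length
    refine ⟨_, by omega, getElem?_pairCode_eq_none.2 rfl, 2 * I.n + 3, by omega, ?_, I.n, by omega,
      ⟨by omega, hc.size⟩, ⟨_, by omega, rfl, by omega⟩,
      ⟨I.encode.length - 1, by omega, by omega, ?_⟩, ?_⟩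
    · have hz := zeros_flatMap I.blocks (none :: y.map some) 0
      rw [add_zero, zeros_zero, add_zero] at hz
      rw [pairCode, I.encode_eq, hz, hbl]
    · rw [pairCode, List.getElem?_append_left (by simp; omega), List.getElem?_map]
      have : I.encode.getLast? = some false := by
        obtain ⟨l, b, hb⟩ : ∃ l b, I.blocks = l ++ [b] :=
          ⟨_, _, (List.dropLast_append_getLast (by intro h; rw [h] at hbl; simp at hbl)).symm⟩
        rw [I.encode_eq, hb]
        simp [unaryCode]
      rw [List.getLast?_eq_getElem?] at this
      rw [this]
      rfl
    · rintro ⟨j, -, hj0, hj, k, -, hk, hkn⟩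
      refine hkn (hk ▸ ?_)
      rw [pairCode, I.encode_eq, blockLen_flatMap, dif_pos (by omega)]
      match j with
      | 1 => exact I.o.2
      | 2 => exact I.d.2
      | j + 3 =>
        have : ∀ k ∈ (List.finRange I.n).flatMap fun v => [(I.G.s₀ v).1, (I.G.s₁ v).1],
            k < I.n := by
          simp only [List.mem_flatMap]
          rintro k ⟨v, -, hk⟩
          simp only [List.mem_cons, List.not_mem_nil, or_false] at hk
          rcases hk with rfl | rfl
          · exact (I.G.s₀ v).2
          · exact (I.G.s₁ v).2
        exact this _ (List.getElem_mem _)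

end Sweep

namespace Sweep

/-! ### The column totals in a certificate -/

/-- The number of occurrences of the pair `(v, g)` as consecutive blocks. -/
def pairCount (w : List (Option Bool)) (v g : ℕ) : ℕ :=
  Nat.count (fun j => blockLen w j = v ∧ j + 1 < w.length ∧ blockLen w (j + 1) = g) w.length

theorem count_congr {p q : ℕ → Prop} [DecidablePred p] [DecidablePred q] {n : ℕ}
    (h : ∀ j < n, (p j ↔ q j)) : Nat.count p n = Nat.count q n := by
  rw [Nat.count_eq_card_filter_range, Nat.count_eq_card_filter_range]
  exact congrArg _ (Finset.filter_congr fun j hj => h j (Finset.mem_range.1 hj))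

/-- Three zeros in the word make every block at least three symbols shorter than the word. The
margin of three admits the consecutive columns `b`, `b + 1`, `b + 2` as values of variables. -/
theorem pairCount_eq_zero {w : List (Option Bool)} {v g : ℕ} (hz : 3 ≤ zeros w w.length)
    (hg : w.length < g + 3) : pairCount w v g = 0 := by
  rw [pairCount, Nat.count_eq_card_filter_range, Finset.card_eq_zero, Finset.filter_eq_empty_iff]
  rintro j - ⟨-, -, h⟩
  have := blockLen_add_zeros_le w (j + 1)
  omega

/-- The last position cannot start a pair, so the count is strictly less than the length and can be
the value of a variable. -/
theorem pairCount_lt {w : List (Option Bool)} (hw : 0 < w.length) (v g : ℕ) :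
    pairCount w v g < w.length := by
  obtain ⟨N, hN⟩ := Nat.exists_eq_add_of_lt hw
  rw [zero_add] at hN
  rw [pairCount, hN, Nat.count_succ]
  have : Nat.count (fun j => blockLen w j = v ∧ j + 1 < N + 1 ∧ blockLen w (j + 1) = g) N ≤ N :=
    Nat.count_le _
  rw [if_neg (by omega)]
  omega

/-- The value of `t` is the number of occurrences of the pair `(v, g)`. -/
def pairCountFm (d v g t : ℕ) : Fm :=
  .cnt (.ex (.and (.succ (d + 2) d (d + 1)) (.and (.block (d + 2) d v) (.block (d + 2) (d + 1) g))))
    t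

/-- The number of occurrences of the pair `(v, g)` is odd. -/
def oddFm (d v g : ℕ) : Fm :=
  .ex (.and (pairCountFm (d + 1) v g d)
    (.ex (.ex (.and (.add (d + 3) (d + 1) (d + 1) (d + 2)) (.succ (d + 3) (d + 2) d)))))

/-- The value of `a` is the number of vertices `u` with an odd number of pairs `(u, g)`, for which
the block with the number `2 u + c` has the length `v`. -/
def edgeCountFm (c d v g a : ℕ) : Fm :=
  .cnt (.and (.ex (.and (.blockConst 0 (d + 2) (d + 1)) (.lt d (d + 1))))
    (.and (.blockTwice c (d + 1) d v) (oddFm (d + 1) d g))) a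

/-- The value of `t` is the sum of the value of `e` and of the number of edges to `v` from vertices
`u` with an odd number of pairs `(u, g)`. -/
def addEdgesFm (d e v g t : ℕ) : Fm :=
  .ex <| .and (edgeCountFm 3 (d + 1) v g d) <| .ex <| .and (edgeCountFm 4 (d + 2) v g (d + 1)) <|
    .ex <| .and (.add (d + 3) e d (d + 2)) (.add (d + 3) (d + 2) (d + 1) t)

section

variable {w : List (Option Bool)} {X : ℕ → Bool} {d : ℕ} {ρ : ℕ → ℕ}

theorem sat_pairCountFm (hρ : ∀ i < d, ρ i < w.length) {v g t : ℕ} (hv : v < d) (hg : g < d) :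
    Sat w X d ρ (pairCountFm d v g t) ↔ pairCount w (ρ v) (ρ g) = ρ t := by
  rw [pairCountFm, sat_cnt, pairCount]
  refine Eq.congr_left (count_congr fun j hj => ?_)
  have h1 := forall_update_lt hρ hj
  have hv' : v ≠ d + 1 := by omega
  have hg' : g ≠ d + 1 := by omega
  rw [sat_ex]
  constructor
  · rintro ⟨i, hi, h⟩
    have h2 := forall_update_lt h1 hi
    rw [sat_and, sat_succ (by omega) (by omega) (h2 _ (by omega)), sat_and, sat_block (by omega),
      sat_block (by omega)] at h
    simp [hv.ne, hg.ne, hv', hg'] at h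
    obtain ⟨rfl, h⟩ := h
    exact ⟨h.1, hi, h.2⟩
  · rintro ⟨h3, hi, h4⟩
    have h2 := forall_update_lt h1 hi
    refine ⟨_, hi, ?_⟩
    rw [sat_and, sat_succ (by omega) (by omega) (h2 _ (by omega)), sat_and, sat_block (by omega),
      sat_block (by omega)]
    simp [hv.ne, hg.ne, hv', hg', h3, h4]

theorem sat_oddFm (hρ : ∀ i < d, ρ i < w.length) (hw : 0 < w.length) {v g : ℕ} (hv : v < d)
    (hg : g < d) : Sat w X d ρ (oddFm d v g) ↔ pairCount w (ρ v) (ρ g) % 2 = 1 := by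
  rw [oddFm, sat_ex]
  constructor
  · rintro ⟨t, ht, h⟩
    have h1 := forall_update_lt hρ ht
    rw [sat_and, sat_pairCountFm h1 (by omega) (by omega), sat_ex] at h
    obtain ⟨h, s, hs, h'⟩ := h
    have h2 := forall_update_lt h1 hs
    rw [sat_ex] at h'
    obtain ⟨r, hr, h'⟩ := h'
    have h3 := forall_update_lt h2 hr
    rw [sat_and, sat_add (by omega) (by omega) (h3 _ (by omega)),
      sat_succ (by omega) (by omega) (h3 _ (by omega))] at h'
    have hd : d ≠ d + 1 + 1 := by omega
    simp [hv.ne, hg.ne, hd] at h h'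
    omega
  · intro h
    have ht := pairCount_lt hw (ρ v) (ρ g)
    have h1 := forall_update_lt hρ ht
    refine ⟨_, ht, ?_⟩
    rw [sat_and, sat_pairCountFm h1 (by omega) (by omega), sat_ex]
    refine ⟨by simp [hv.ne, hg.ne], pairCount w (ρ v) (ρ g) / 2, by omega, ?_⟩
    have h2 := forall_update_lt h1 (v := pairCount w (ρ v) (ρ g) / 2) (by omega)
    rw [sat_ex]
    refine ⟨2 * (pairCount w (ρ v) (ρ g) / 2), by omega, ?_⟩
    have h3 := forall_update_lt h2 (v := 2 * (pairCount w (ρ v) (ρ g) / 2)) (by omega)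
    rw [sat_and, sat_add (by omega) (by omega) (h3 _ (by omega)),
      sat_succ (by omega) (by omega) (h3 _ (by omega))]
    have hd : d ≠ d + 1 + 1 := by omega
    simp [hd]
    omega

theorem count_eq_card_filter_fin {n N : ℕ} (hn : n ≤ N) (p : ℕ → Prop) [DecidablePred p] :
    Nat.count (fun u => u < n ∧ p u) N = (Finset.univ.filter fun u : Fin n => p u).card := by
  rw [Nat.count_eq_card_filter_range, ← Finset.card_map Fin.valEmbedding]
  congr 1
  ext u
  simp only [Finset.mem_filter, Finset.mem_range, Finset.mem_map, Finset.mem_univ, true_and,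
    Fin.valEmbedding_apply]
  constructor
  · rintro ⟨-, h, hp⟩
    exact ⟨⟨u, h⟩, hp, rfl⟩
  · rintro ⟨v, hp, rfl⟩
    exact ⟨by omega, v.2, hp⟩

variable {I : ArrivalInstance}

theorem Codes.sat_edgeCountFm (h : Codes w I) {c : ℕ} (hc : c ≤ 4) {s : Fin I.n → Fin I.n}
    (hs : ∀ u : Fin I.n, blockLen w (2 * u + c) = s u) (hρ : ∀ i < d, ρ i < w.length) {v g a : ℕ}
    (hv : v < d) (hg : g < d) (x : Fin I.n) (hx : ρ v = x) :
    Sat w X d ρ (edgeCountFm c d v g a) ↔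
      (Finset.univ.filter fun u : Fin I.n => s u = x ∧ pairCount w u (ρ g) % 2 = 1).card = ρ a := by
  have hl := h.length
  rw [edgeCountFm, sat_cnt]
  have : ∀ u < w.length, (Sat w X (d + 1) (Function.update ρ d u)
      (.and (.ex (.and (.blockConst 0 (d + 2) (d + 1)) (.lt d (d + 1))))
        (.and (.blockTwice c (d + 1) d v) (oddFm (d + 1) d g))) ↔
      u < I.n ∧ (blockLen w (2 * u + c) = x ∧ pairCount w u (ρ g) % 2 = 1)) := by
    intro u hu
    have h1 := forall_update_lt hρ hu
    rw [sat_and, h.sat_lt_size (by omega), sat_and, sat_blockTwice (by omega) (by omega),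
      sat_oddFm h1 (by omega) (by omega) (by omega)]
    simp only [Function.update_self, Function.update_of_ne hv.ne, Function.update_of_ne hg.ne, hx]
    refine and_congr_right fun hun => ?_
    have : 2 * u + c < w.length := by omega
    simp [this]
  rw [count_congr this, count_eq_card_filter_fin (by omega)]
  simp only [hs, Fin.ext_iff]

theorem Codes.sat_addEdgesFm (h : Codes w I) (hρ : ∀ i < d, ρ i < w.length) {e v g t : ℕ}
    (he : e < d) (hv : v < d) (hg : g < d) (ht : t < d) (x : Fin I.n) (hx : ρ v = x) :
    Sat w X d ρ (addEdgesFm d e v g t) ↔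
      ρ t = ρ e + I.G.edgesFrom (fun u => pairCount w u (ρ g) % 2 = 1) x := by
  have hl := h.length
  have hd1 : ∀ i < d, i ≠ d + 1 := fun i hi => by omega
  have hd2 : ∀ i < d, i ≠ d + 2 := fun i hi => by omega
  have hle : ∀ p : Fin I.n → Prop, ∀ [DecidablePred p], (Finset.univ.filter p).card ≤ I.n :=
    fun p _ => (Finset.card_le_univ _).trans_eq (Fintype.card_fin _)
  rw [addEdgesFm, sat_ex, edgesFrom]
  set A := (Finset.univ.filter fun u => I.G.s₀ u = x ∧ pairCount w u (ρ g) % 2 = 1).card with hA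
  set B := (Finset.univ.filter fun u => I.G.s₁ u = x ∧ pairCount w u (ρ g) % 2 = 1).card with hB
  have hA' : A ≤ I.n := hle _
  have hB' : B ≤ I.n := hle _
  have key : ∀ a < w.length, ∀ b < w.length, ∀ c < w.length,
      (Sat w X (d + 3) (Function.update (Function.update (Function.update ρ d a) (d + 1) b)
        (d + 2) c) (.and (.add (d + 3) e d (d + 2)) (.add (d + 3) (d + 2) (d + 1) t)) ↔
      ρ e + a = c ∧ c + b = ρ t) := by
    intro a ha b hb c hc
    have h3 := forall_update_lt (forall_update_lt (forall_update_lt hρ ha) hb) hc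
    rw [sat_and, sat_add (by omega) (by omega) (h3 _ (by omega)),
      sat_add (by omega) (by omega) (h3 _ (by omega))]
    have hd : d ≠ d + 1 + 1 := by omega
    simp [he.ne, ht.ne, hd1 _ he, hd1 _ ht, hd2 _ he, hd2 _ ht, hd]
  have key0 : ∀ a < w.length, (Sat w X (d + 1) (Function.update ρ d a)
      (edgeCountFm 3 (d + 1) v g d) ↔ A = a) := by
    intro a ha
    rw [h.sat_edgeCountFm (by omega) h.even (forall_update_lt hρ ha) (by omega) (by omega) x
      (by rwa [Function.update_of_ne hv.ne])]
    simp only [Function.update_self, Function.update_of_ne hg.ne, hA]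
  have key1 : ∀ a < w.length, ∀ b < w.length,
      (Sat w X (d + 2) (Function.update (Function.update ρ d a) (d + 1) b)
        (edgeCountFm 4 (d + 2) v g (d + 1)) ↔ B = b) := by
    intro a ha b hb
    rw [h.sat_edgeCountFm (by omega) h.odd (forall_update_lt (forall_update_lt hρ ha) hb)
      (by omega) (by omega) x
      (by rwa [Function.update_of_ne (hd1 _ hv), Function.update_of_ne hv.ne])]
    simp only [Function.update_self, Function.update_of_ne hg.ne, hB,
      Function.update_of_ne (hd1 _ hg)]
  constructor
  · rintro ⟨a, ha, hs⟩
    rw [sat_and, key0 a ha, sat_ex] at hs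
    obtain ⟨rfl, b, hb, hs⟩ := hs
    rw [sat_and, key1 _ ha b hb, sat_ex] at hs
    obtain ⟨rfl, c, hc, hs⟩ := hs
    rw [key _ ha _ hb _ hc] at hs
    omega
  · intro hs
    -- The summands are at most n, and the partial sum is at most `ρ t`, so all witnesses are
    -- positions.
    have := hρ t ht
    have ha : A < w.length := by omega
    have hb : B < w.length := by omega
    have hc : ρ e + A < w.length := by omega
    refine ⟨A, ha, ?_⟩
    rw [sat_and, key0 _ ha, sat_ex]
    refine ⟨rfl, B, hb, ?_⟩
    rw [sat_and, key1 _ ha _ hb, sat_ex]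
    refine ⟨rfl, _, hc, ?_⟩
    rw [key _ ha _ hb _ hc]
    omega

end

end Sweep

namespace Sweep

/-! ### The conditions for a certificate -/

/-- There are no pairs `(v, g)` for the destination `v` and a number `g` that is at least the number
of vertices. -/
def destFm : Fm :=
  .neg <| .ex <| .and (.blockConst 2 1 0) <| .ex <| .ex <| .and (.blockConst 0 3 2) <|
    .and (.neg (.lt 1 2)) <| .ex <| .and (pairCountFm 4 0 1 3) (.neg (.isZero 4 3))

/-- The equation for the first column of the vertex `0`, where `1` is the number of vertices, and
`2` is its successor. -/
def firstEqFm : Fm :=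
  .ex <| .and (pairCountFm 4 0 1 3) <| .ex <| .and (edgeCountFm 3 5 0 1 4) <| .ex <|
    .and (.or (.and (.blockConst 1 6 0) (.ex (.and (.isZero 7 6) (.succ 7 6 5))))
      (.and (.neg (.blockConst 1 6 0)) (.isZero 6 5))) <|
      .ex <| .and (.add 7 5 4 6) (addEdgesFm 7 6 0 2 3)

/-- The equation for the column `3` of the vertex `0`, where `2` is the preceding column, and
`4` is the succeeding column. -/
def carryEqFm : Fm :=
  .ex <| .and (pairCountFm 6 0 3 5) <| .ex <| .and (pairCountFm 7 0 2 6) <| .ex <| .ex <|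
    .and (.add 9 7 7 8) <| .and (.or (.eq 8 6) (.succ 9 8 6)) (addEdgesFm 9 7 0 4 5)

/-- All vertices that are no dead ends satisfy the equation for the first column. -/
def firstFm : Fm :=
  .neg <| .ex <| .and (.mem 0) <| .ex <| .and (.blockConst 0 2 1) <| .and (.lt 0 1) <|
    .ex <| .and (.succ 3 1 2) (.neg firstEqFm)

/-- All vertices that are no dead ends satisfy the equations for the other columns. -/
def carryFm : Fm :=
  .neg <| .ex <| .and (.mem 0) <| .ex <| .and (.blockConst 0 2 1) <| .and (.lt 0 1) <|
    .ex <| .and (.neg (.lt 2 1)) <| .ex <| .and (.succ 4 2 3) <| .ex <| .and (.succ 5 3 4) <|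
      .neg carryEqFm

section

variable {w : List (Option Bool)} {X : ℕ → Bool} {ρ : ℕ → ℕ} {I : ArrivalInstance}

theorem Codes.sat_destFm (h : Codes w I) :
    Sat w X 0 ρ destFm ↔ ∀ b, pairCount w I.d (I.n + b) = 0 := by
  have hl := h.length
  have hd := I.d.2
  have h0 : ∀ i < 0, ρ i < w.length := fun i hi => by omega
  rw [destFm, sat_neg, sat_ex, not_exists]
  constructor
  · intro hs b
    by_contra hc
    have hg : I.n + b < w.length := by
      by_contra hg
      exact hc (pairCount_eq_zero h.le_zeros (by omega))
    have hdl : I.d.1 < w.length := by omega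
    have hn : I.n < w.length := by omega
    have ht := pairCount_lt (by omega : 0 < w.length) I.d.1 (I.n + b)
    have h4 := forall_update_lt (forall_update_lt (forall_update_lt (forall_update_lt h0 hdl) hg)
      hn) ht
    refine hs I.d ⟨hdl, ?_⟩
    rw [sat_and, sat_blockConst (by omega), sat_ex]
    refine ⟨⟨by omega, by simp [h.dest]⟩, _, hg, ?_⟩
    rw [sat_ex]
    refine ⟨I.n, hn, ?_⟩
    rw [sat_and, sat_blockConst (by omega), sat_and, sat_neg, sat_lt, sat_ex]
    refine ⟨⟨by omega, by simp [h.size]⟩, by simp, _, ht, ?_⟩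
    rw [sat_and, sat_pairCountFm h4 (by omega) (by omega), sat_neg,
      sat_isZero (by omega) (h4 _ (by omega))]
    simpa using hc
  · rintro hb v ⟨hv, hs⟩
    rw [sat_and, sat_blockConst (by omega), sat_ex] at hs
    obtain ⟨⟨-, h1⟩, g, hg, hs⟩ := hs
    rw [sat_ex] at hs
    obtain ⟨n, hn, hs⟩ := hs
    rw [sat_and, sat_blockConst (by omega), sat_and, sat_neg, sat_lt, sat_ex] at hs
    obtain ⟨⟨-, h2⟩, h3, t, ht, hs⟩ := hs
    have h4 := forall_update_lt (forall_update_lt (forall_update_lt (forall_update_lt h0 hv) hg)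
      hn) ht
    rw [sat_and, sat_pairCountFm h4 (by omega) (by omega), sat_neg,
      sat_isZero (by omega) (h4 _ (by omega))] at hs
    simp [h.dest, h.size] at h1 h2 h3 hs
    subst h1 h2
    obtain ⟨b, rfl⟩ := Nat.exists_eq_add_of_le h3
    exact hs.2 (hs.1.symm.trans (hb b))

theorem Codes.sat_firstEqFm (h : Codes w I) (hρ : ∀ i < 3, ρ i < w.length) (v : Fin I.n)
    (h0 : ρ 0 = v) (h1 : ρ 1 = I.n) (h2 : ρ 2 = I.n + 1) :
    Sat w X 3 ρ firstEqFm ↔ pairCount w v I.n = (if v = I.o then 1 else 0) +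
      (Finset.univ.filter fun u => I.G.s₀ u = v ∧ pairCount w u I.n % 2 = 1).card +
        I.G.edgesFrom (fun u => pairCount w u (I.n + 1) % 2 = 1) v := by
  have hl := h.length
  set A := (Finset.univ.filter fun u => I.G.s₀ u = v ∧ pairCount w u I.n % 2 = 1).card with hA
  have hA' : A ≤ I.n := (Finset.card_le_univ _).trans_eq (Fintype.card_fin _)
  have hpos : 0 < w.length := by omega
  have ho : I.o.1 = v.1 ↔ v = I.o := by rw [Fin.ext_iff, eq_comm]
  have keyt : ∀ t < w.length, (Sat w X 4 (Function.update ρ 3 t) (pairCountFm 4 0 1 3) ↔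
      pairCount w v I.n = t) := by
    intro t ht
    rw [sat_pairCountFm (forall_update_lt hρ ht) (by omega) (by omega)]
    simp [h0, h1]
  have keya : ∀ t < w.length, ∀ a < w.length, (Sat w X 5 (Function.update (Function.update ρ 3 t)
      4 a) (edgeCountFm 3 5 0 1 4) ↔ A = a) := by
    intro t ht a ha
    rw [h.sat_edgeCountFm (by omega) h.even (forall_update_lt (forall_update_lt hρ ht) ha)
      (by omega) (by omega) v (by simp [h0])]
    simp [h1, hA]
  have keye : ∀ t < w.length, ∀ a < w.length, ∀ e < w.length,
      (Sat w X 6 (Function.update (Function.update (Function.update ρ 3 t) 4 a) 5 e)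
        (.or (.and (.blockConst 1 6 0) (.ex (.and (.isZero 7 6) (.succ 7 6 5))))
          (.and (.neg (.blockConst 1 6 0)) (.isZero 6 5))) ↔ (if v = I.o then 1 else 0) = e) := by
    intro t ht a ha e he
    have h6 := forall_update_lt (forall_update_lt (forall_update_lt hρ ht) ha) he
    have key1 : Sat w X 6 (Function.update (Function.update (Function.update ρ 3 t) 4 a) 5 e)
        (.ex (.and (.isZero 7 6) (.succ 7 6 5))) ↔ 1 = e := by
      rw [sat_ex]
      constructor
      · rintro ⟨z, hz, hs⟩
        have h7 := forall_update_lt h6 hz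
        rw [sat_and, sat_isZero (by omega) (h7 _ (by omega)),
          sat_succ (by omega) (by omega) (h7 _ (by omega))] at hs
        simp at hs
        omega
      · rintro rfl
        refine ⟨0, hpos, ?_⟩
        have h7 := forall_update_lt h6 hpos
        rw [sat_and, sat_isZero (by omega) (h7 _ (by omega)),
          sat_succ (by omega) (by omega) (h7 _ (by omega))]
        simp
    rw [sat_or, sat_and, sat_and, sat_neg, sat_blockConst (by omega), key1,
      sat_isZero (by omega) (h6 _ (by omega)), h.origin]
    have h1w : 1 < w.length := by omega
    simp only [h1w, true_and, ne_eq, OfNat.zero_ne_ofNat, not_false_eq_true, Function.update_of_ne,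
      h0, ho, Function.update_self]
    split_ifs with hv <;> simp [hv, eq_comm]
  have keys : ∀ t < w.length, ∀ a < w.length, ∀ e < w.length, ∀ s < w.length,
      (Sat w X 7 (Function.update (Function.update (Function.update (Function.update ρ 3 t) 4 a)
        5 e) 6 s) (.and (.add 7 5 4 6) (addEdgesFm 7 6 0 2 3)) ↔ e + a = s ∧
          t = s + I.G.edgesFrom (fun u => pairCount w u (I.n + 1) % 2 = 1) v) := by
    intro t ht a ha e he s hs
    have h7 := forall_update_lt (forall_update_lt (forall_update_lt (forall_update_lt hρ ht) ha)
      he) hs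
    rw [sat_and, sat_add (by omega) (by omega) (h7 _ (by omega)),
      h.sat_addEdgesFm h7 (by omega) (by omega) (by omega) (by omega) v (by simp [h0])]
    simp [h2]
  rw [firstEqFm, sat_ex]
  constructor
  · rintro ⟨t, ht, hs⟩
    rw [sat_and, keyt t ht, sat_ex] at hs
    obtain ⟨rfl, a, ha, hs⟩ := hs
    rw [sat_and, keya _ ht a ha, sat_ex] at hs
    obtain ⟨rfl, e, he, hs⟩ := hs
    rw [sat_and, keye _ ht _ ha e he, sat_ex] at hs
    obtain ⟨rfl, s, hs', hs⟩ := hs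
    rw [keys _ ht _ ha _ he _ hs'] at hs
    rw [hs.1]
    exact hs.2
  · intro heq
    have ht := pairCount_lt hpos v.1 I.n
    have ha : A < w.length := by omega
    have he : (if v = I.o then 1 else 0) < w.length := by omega
    have hs : (if v = I.o then 1 else 0) + A < w.length := by omega
    refine ⟨_, ht, ?_⟩
    rw [sat_and, keyt _ ht, sat_ex]
    refine ⟨rfl, _, ha, ?_⟩
    rw [sat_and, keya _ ht _ ha, sat_ex]
    refine ⟨rfl, _, he, ?_⟩
    rw [sat_and, keye _ ht _ ha _ he, sat_ex]
    exact ⟨rfl, _, hs, (keys _ ht _ ha _ he _ hs).2 ⟨rfl, heq⟩⟩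

/-- The half `e` of the preceding total `a` is characterised by `2 e = a` or `2 e + 1 = a`. -/
theorem Codes.sat_carryEqFm (h : Codes w I) (hρ : ∀ i < 5, ρ i < w.length) (v : Fin I.n)
    (h0 : ρ 0 = v) :
    Sat w X 5 ρ carryEqFm ↔ pairCount w v (ρ 3) = pairCount w v (ρ 2) / 2 +
      I.G.edgesFrom (fun u => pairCount w u (ρ 4) % 2 = 1) v := by
  have hl := h.length
  have hpos : 0 < w.length := by omega
  have keyt : ∀ t < w.length, (Sat w X 6 (Function.update ρ 5 t) (pairCountFm 6 0 3 5) ↔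
      pairCount w v (ρ 3) = t) := by
    intro t ht
    rw [sat_pairCountFm (forall_update_lt hρ ht) (by omega) (by omega)]
    simp [h0]
  have keya : ∀ t < w.length, ∀ a < w.length, (Sat w X 7 (Function.update (Function.update ρ 5 t)
      6 a) (pairCountFm 7 0 2 6) ↔ pairCount w v (ρ 2) = a) := by
    intro t ht a ha
    rw [sat_pairCountFm (forall_update_lt (forall_update_lt hρ ht) ha) (by omega) (by omega)]
    simp [h0]
  have keys : ∀ t < w.length, ∀ a < w.length, ∀ e < w.length, ∀ s < w.length,
      (Sat w X 9 (Function.update (Function.update (Function.update (Function.update ρ 5 t) 6 a)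
        7 e) 8 s) (.and (.add 9 7 7 8) <| .and (.or (.eq 8 6) (.succ 9 8 6))
          (addEdgesFm 9 7 0 4 5)) ↔ e + e = s ∧ (s = a ∨ s + 1 = a) ∧
            t = e + I.G.edgesFrom (fun u => pairCount w u (ρ 4) % 2 = 1) v) := by
    intro t ht a ha e he s hs
    have h9 := forall_update_lt (forall_update_lt (forall_update_lt (forall_update_lt hρ ht) ha)
      he) hs
    rw [sat_and, sat_add (by omega) (by omega) (h9 _ (by omega)), sat_and, sat_or, sat_eq,
      sat_succ (by omega) (by omega) (h9 _ (by omega)),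
      h.sat_addEdgesFm h9 (by omega) (by omega) (by omega) (by omega) v (by simp [h0])]
    simp
  rw [carryEqFm, sat_ex]
  constructor
  · rintro ⟨t, ht, hs⟩
    rw [sat_and, keyt t ht, sat_ex] at hs
    obtain ⟨rfl, a, ha, hs⟩ := hs
    rw [sat_and, keya _ ht a ha, sat_ex] at hs
    obtain ⟨rfl, e, he, hs⟩ := hs
    rw [sat_ex] at hs
    obtain ⟨s, hs', hs⟩ := hs
    rw [keys _ ht _ ha _ he _ hs'] at hs
    omega
  · intro heq
    have ht := pairCount_lt hpos v.1 (ρ 3)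
    have ha := pairCount_lt hpos v.1 (ρ 2)
    have he : pairCount w v (ρ 2) / 2 < w.length := by omega
    have hs : pairCount w v (ρ 2) / 2 + pairCount w v (ρ 2) / 2 < w.length := by omega
    refine ⟨_, ht, ?_⟩
    rw [sat_and, keyt _ ht, sat_ex]
    refine ⟨rfl, _, ha, ?_⟩
    rw [sat_and, keya _ ht _ ha, sat_ex]
    refine ⟨rfl, _, he, ?_⟩
    rw [sat_ex]
    exact ⟨_, hs, (keys _ ht _ ha _ he _ hs).2 ⟨rfl, by omega, heq⟩⟩

theorem Codes.sat_firstFm (h : Codes w I) : Sat w (reachSet w) 0 ρ firstFm ↔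
    ∀ v, ¬ I.G.IsDeadEnd I.d v → pairCount w v I.n = (if v = I.o then 1 else 0) +
      (Finset.univ.filter fun u => I.G.s₀ u = v ∧ pairCount w u I.n % 2 = 1).card +
        I.G.edgesFrom (fun u => pairCount w u (I.n + 1) % 2 = 1) v := by
  have hl := h.length
  have h0 : ∀ i < 0, ρ i < w.length := fun i hi => by omega
  rw [firstFm, sat_neg, sat_ex, not_exists]
  constructor
  · intro hs v hv
    have hv' := v.2
    have hvl : v.1 < w.length := by omega
    have hn : I.n < w.length := by omega
    have hn' : I.n + 1 < w.length := by omega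
    have h3 := forall_update_lt (forall_update_lt (forall_update_lt h0 hvl) hn) hn'
    by_contra hc
    refine hs v ⟨hvl, ?_⟩
    rw [sat_and, sat_mem, sat_ex]
    refine ⟨by simpa using (h.reachSet_iff v).2 hv, _, hn, ?_⟩
    rw [sat_and, sat_blockConst (by omega), sat_and, sat_lt, sat_ex]
    refine ⟨⟨by omega, by simp [h.size]⟩, by simp, _, hn', ?_⟩
    rw [sat_and, sat_succ (by omega) (by omega) (h3 _ (by omega)), sat_neg,
      h.sat_firstEqFm h3 v (by simp) (by simp) (by simp)]
    exact ⟨by simp, hc⟩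
  · rintro hf v ⟨hv, hs⟩
    rw [sat_and, sat_mem, sat_ex] at hs
    obtain ⟨hX, n, hn, hs⟩ := hs
    rw [sat_and, sat_blockConst (by omega), sat_and, sat_lt, sat_ex] at hs
    obtain ⟨⟨-, h1⟩, h2, m, hm, hs⟩ := hs
    have h3 := forall_update_lt (forall_update_lt (forall_update_lt h0 hv) hn) hm
    rw [sat_and, sat_succ (by omega) (by omega) (h3 _ (by omega)), sat_neg] at hs
    simp [h.size] at h1 h2 hX
    subst h1
    obtain ⟨h4, hs⟩ := hs
    simp at h4
    subst h4
    refine hs ((h.sat_firstEqFm h3 ⟨v, h2⟩ (by simp) (by simp) (by simp)).2 (hf _ ?_))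
    exact (h.reachSet_iff ⟨v, h2⟩).1 hX

theorem Codes.sat_carryFm (h : Codes w I) : Sat w (reachSet w) 0 ρ carryFm ↔
    ∀ v, ¬ I.G.IsDeadEnd I.d v → ∀ b, pairCount w v (I.n + (b + 1)) =
      pairCount w v (I.n + b) / 2 +
        I.G.edgesFrom (fun u => pairCount w u (I.n + (b + 2)) % 2 = 1) v := by
  have hl := h.length
  have h0 : ∀ i < 0, ρ i < w.length := fun i hi => by omega
  rw [carryFm, sat_neg, sat_ex, not_exists]
  constructor
  · intro hs v hv b
    have hv' := v.2
    by_contra hc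
    -- The formula sees only column numbers that are positions. If the last of the three is out of
    -- range, all totals involved vanish, and the equation reads `0 = 0`.
    have hb2 : I.n + (b + 2) < w.length := by
      by_contra hb
      have hz : ∀ u a, b ≤ a → pairCount w u (I.n + a) = 0 := fun u a ha =>
        pairCount_eq_zero h.le_zeros (by omega)
      refine hc ?_
      simp [hz v.1 (b + 1) (by omega), hz v.1 b (by omega), edgesFrom, hz _ (b + 2) (by omega)]
    have hvl : v.1 < w.length := by omega
    have hn : I.n < w.length := by omega
    have hb : I.n + b < w.length := by omega
    have hb1 : I.n + (b + 1) < w.length := by omega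
    have h4 := forall_update_lt (forall_update_lt (forall_update_lt (forall_update_lt h0 hvl) hn)
      hb) hb1
    have h5 := forall_update_lt h4 hb2
    refine hs v ⟨hvl, ?_⟩
    rw [sat_and, sat_mem, sat_ex]
    refine ⟨by simpa using (h.reachSet_iff v).2 hv, _, hn, ?_⟩
    rw [sat_and, sat_blockConst (by omega), sat_and, sat_lt, sat_ex]
    refine ⟨⟨by omega, by simp [h.size]⟩, by simp, _, hb, ?_⟩
    rw [sat_and, sat_neg, sat_lt, sat_ex]
    refine ⟨by simp, _, hb1, ?_⟩
    rw [sat_and, sat_succ (by omega) (by omega) (h4 _ (by omega)), sat_ex]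
    refine ⟨by simp [add_assoc], _, hb2, ?_⟩
    rw [sat_and, sat_succ (by omega) (by omega) (h5 _ (by omega)), sat_neg,
      h.sat_carryEqFm h5 v (by simp)]
    exact ⟨by simp [add_assoc], by simpa using hc⟩
  · rintro hf v ⟨hv, hs⟩
    rw [sat_and, sat_mem, sat_ex] at hs
    obtain ⟨hX, n, hn, hs⟩ := hs
    rw [sat_and, sat_blockConst (by omega), sat_and, sat_lt, sat_ex] at hs
    obtain ⟨⟨-, h1⟩, h2, g, hg, hs⟩ := hs
    rw [sat_and, sat_neg, sat_lt, sat_ex] at hs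
    obtain ⟨h3, g1, hg1, hs⟩ := hs
    have h4 := forall_update_lt (forall_update_lt (forall_update_lt (forall_update_lt h0 hv) hn)
      hg) hg1
    rw [sat_and, sat_succ (by omega) (by omega) (h4 _ (by omega)), sat_ex] at hs
    obtain ⟨hs1, g2, hg2, hs⟩ := hs
    have h5 := forall_update_lt h4 hg2
    rw [sat_and, sat_succ (by omega) (by omega) (h5 _ (by omega)), sat_neg] at hs
    obtain ⟨hs2, hs⟩ := hs
    simp [h.size] at h1 h2 h3 hX hs1 hs2
    subst h1 hs1 hs2
    obtain ⟨b, rfl⟩ := Nat.exists_eq_add_of_le h3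
    refine hs ((h.sat_carryEqFm h5 ⟨v, h2⟩ (by simp)).2 ?_)
    simpa [add_assoc] using hf ⟨v, h2⟩ ((h.reachSet_iff ⟨v, h2⟩).1 hX) b

end

/-- The word is not the encoding of an instance followed by a separator, or it codes a
certificate. -/
def acceptFm : Fm := .or (.neg isCodeFm) (.and destFm (.and firstFm carryFm))

theorem Codes.sat_certificate {w : List (Option Bool)} {ρ : ℕ → ℕ} {I : ArrivalInstance}
    (h : Codes w I) : Sat w (reachSet w) 0 ρ (.and destFm (.and firstFm carryFm)) ↔
      I.G.IsCertificate I.o I.d fun v b => pairCount w v (I.n + b) := by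
  rw [sat_and, sat_and, h.sat_destFm, h.sat_firstFm, h.sat_carryFm]
  exact ⟨fun hs => ⟨hs.1, hs.2.1, hs.2.2⟩, fun hs => ⟨hs.dest, hs.first, hs.carry⟩⟩

/-- The verifier for the complement of ARRIVAL. -/
def verifier (z : List Bool × List Bool) : Bool :=
  acceptFm.eval (pairCode z) (reachSet (pairCode z)) 0 fun _ => 0

theorem polyTime_verifier : Nonempty (Turing.TM2ComputableInPolyTime pairCode
    Computability.encodeBool verifier) := by
  refine polyTime_of_printer (D := 25) (by decide) (φ := reachFm) (by decide)
    (π := .ite acceptFm (.bit true) (.bit false)) (by decide) id none _ _ _ fun z w hw => ?_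
  rw [List.map_id, Option.toList_none, List.append_nil] at hw
  subst hw
  change [verifier z] = if verifier z = true then [true] else [false]
  cases verifier z <;> rfl

theorem verifier_of_not_code {x y : List Bool} (h : ¬ ∃ I : ArrivalInstance, I.encode = x) :
    verifier (x, y) = true := by
  change Sat _ _ _ _ _
  rw [acceptFm, sat_or, sat_neg, sat_isCodeFm_pairCode]
  exact Or.inl h

theorem verifier_encode (I : ArrivalInstance) (y : List Bool) :
    verifier (I.encode, y) = true ↔
      I.G.IsCertificate I.o I.d fun v b => pairCount (pairCode (I.encode, y)) v (I.n + b) := by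
  change Sat _ _ _ _ _ ↔ _
  have h : Codes (pairCode (I.encode, y)) I := codes_encode I _
  rw [acceptFm, sat_or, sat_neg, sat_isCodeFm_pairCode, h.sat_certificate]
  simp

/-- Pair counts are defined for every word, so soundness needs no assumption on the form of `y`.
Columns from the length of the word on are empty, which gives the bound `B`. -/
theorem not_yes_of_verifier {I : ArrivalInstance} {y : List Bool}
    (h : verifier (I.encode, y) = true) : ¬ I.Yes :=
  ((verifier_encode I y).1 h).not_runTerminates I.G I.o (B := (pairCode (I.encode, y)).length)
    fun _ _ hb => pairCount_eq_zero (codes_encode I _).le_zeros (by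
      have := (codes_encode I (y.map some)).length
      change _ ≤ (pairCode (I.encode, y)).length at this
      omega)

end Sweep

/-! ### Certificates as strings -/

theorem exists_list_count_eq {α : Type*} [DecidableEq α] [BEq α] [LawfulBEq α] (f : α → ℕ)
    (s : Finset α) :
    ∃ L : List α, (∀ a, L.count a = if a ∈ s then f a else 0) ∧ L.length = ∑ a ∈ s, f a := by
  induction s using Finset.induction_on with
  | empty => exact ⟨[], by simp⟩
  | insert b s hb ih =>
    obtain ⟨L, hL, hl⟩ := ih
    refine ⟨List.replicate (f b) b ++ L, fun a => ?_, by
      rw [List.length_append, List.length_replicate, hl, Finset.sum_insert hb]⟩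
    rw [List.count_append, hL, List.count_replicate]
    by_cases h : a = b
    · subst h
      simp [hb]
    · simp [h, Ne.symm h]

/-- The number of occurrences of `v` and `g` as consecutive elements. -/
def consecutive (v g : ℕ) (bs : List ℕ) (N : ℕ) : ℕ :=
  Nat.count (fun j => bs[j]? = some v ∧ bs[j + 1]? = some g) N

theorem consecutive_cons (v g k : ℕ) (bs : List ℕ) (N : ℕ) :
    consecutive v g (k :: bs) (N + 1) =
      consecutive v g bs N + if k = v ∧ bs[0]? = some g then 1 else 0 := by
  rw [consecutive, Nat.count_succ']
  simp [consecutive]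

/-- The second component `g` occurs neither in `bs` nor at the head of `cs`, so no pair lies in the
first part or across the border. -/
theorem consecutive_append {v g : ℕ} {bs cs : List ℕ} (hbs : ∀ k ∈ bs, k ≠ g)
    (hcs : ∀ k, cs[0]? = some k → k ≠ g) {N : ℕ} :
    consecutive v g (bs ++ cs) (bs.length + N) = consecutive v g cs N := by
  induction bs with
  | nil => simp
  | cons k bs ih =>
    rw [List.cons_append, List.length_cons, show bs.length + 1 + N = bs.length + N + 1 by ring,
      consecutive_cons, ih fun k hk => hbs k (List.mem_cons_of_mem _ hk), if_neg, add_zero]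
    rintro ⟨-, h⟩
    cases bs with
    | nil => exact hcs g h rfl
    | cons l bs => exact hbs l (by simp) (by simpa using h)

/-- The numbers in the string for a list of pairs, where the second components are shifted
by `n`. -/
def pairBlocks {n : ℕ} (L : List (Fin n × ℕ)) : List ℕ := L.flatMap fun p => [p.1.1, n + p.2]

theorem pairBlocks_cons {n : ℕ} (p : Fin n × ℕ) (L : List (Fin n × ℕ)) :
    pairBlocks (p :: L) = p.1.1 :: (n + p.2) :: pairBlocks L := rfl

theorem pairBlocks_length {n : ℕ} (L : List (Fin n × ℕ)) :
    (pairBlocks L).length = 2 * L.length := by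
  induction L with
  | nil => rfl
  | cons p L ih =>
    rw [pairBlocks_cons, List.length_cons, List.length_cons, ih, List.length_cons]
    ring

theorem pairBlocks_sum_le {n B : ℕ} {L : List (Fin n × ℕ)} (hL : ∀ p ∈ L, p.2 < B) :
    (pairBlocks L).sum ≤ (2 * n + B) * L.length := by
  induction L with
  | nil => simp [pairBlocks]
  | cons p L ih =>
    have h1 := ih fun p hp => hL p (List.mem_cons_of_mem _ hp)
    have h2 := hL p (by simp)
    have h3 := p.1.2
    rw [pairBlocks_cons, List.sum_cons, List.sum_cons, List.length_cons, mul_add, mul_one]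
    omega

theorem pairBlocks_head {n : ℕ} {L : List (Fin n × ℕ)} {k : ℕ} (h : (pairBlocks L)[0]? = some k) :
    k < n := by
  cases L with
  | nil => cases h
  | cons p L =>
    cases h
    exact p.1.2

/-- First components are less than n and shifted second components are at least n, so a pair of the
required form cannot start at a second component. -/
theorem consecutive_pairBlocks {n : ℕ} (L : List (Fin n × ℕ)) (v : Fin n) (b : ℕ) {N : ℕ}
    (hN : 2 * L.length ≤ N) : consecutive v (n + b) (pairBlocks L) N = L.count (v, b) := by
  induction L generalizing N with
  | nil => simp [pairBlocks, consecutive]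
  | cons p L ih =>
    rw [List.length_cons] at hN
    obtain ⟨M, rfl⟩ := Nat.exists_eq_add_of_le' (show 2 ≤ N by omega)
    have hv := v.2
    rw [pairBlocks_cons, show M + 2 = M + 1 + 1 by ring, consecutive_cons, consecutive_cons,
      ih (by omega), if_neg (by omega), List.count_cons]
    have : (p.1.1 = v.1 ∧ ((n + p.2) :: pairBlocks L)[0]? = some (n + b)) ↔ p = (v, b) := by
      simp [Prod.ext_iff, Fin.ext_iff]
    rw [if_congr this rfl rfl]
    simp [beq_iff_eq]

namespace Sweep

theorem blockLen_pairCode (bs cs : List ℕ) (j : ℕ) :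
    blockLen (pairCode (bs.flatMap unaryCode, cs.flatMap unaryCode)) j = (bs ++ cs)[j]?.getD 0 := by
  rw [pairCode, blockLen_flatMap]
  split_ifs with h
  · rw [List.getElem?_append_left h, List.getElem?_eq_getElem h]
    rfl
  · rw [blockLen_cons_none, List.getElem?_append_right (by omega)]
    have := blockLen_flatMap cs [] (j - bs.length)
    rw [List.append_nil] at this
    dsimp only
    rw [this]
    split_ifs with h'
    · rw [List.getElem?_eq_getElem h']
      rfl
    · rw [List.getElem?_eq_none (by omega)]
      simp

/-- Block numbers beyond the last block have length zero; `0 < g` excludes pairs that end in such a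
phantom block. -/
theorem pairCount_pairCode (bs cs : List ℕ) {v g : ℕ} (hg : 0 < g) :
    pairCount (pairCode (bs.flatMap unaryCode, cs.flatMap unaryCode)) v g =
      consecutive v g (bs ++ cs)
        (pairCode (bs.flatMap unaryCode, cs.flatMap unaryCode)).length := by
  refine count_congr fun j _ => ?_
  have hN : (bs ++ cs).length <
      (pairCode (bs.flatMap unaryCode, cs.flatMap unaryCode)).length := by
    have h1 := flatMap_unaryCode_length bs
    have h2 := flatMap_unaryCode_length cs
    rw [pairCode, List.length_append, List.length_append, List.length_cons, List.length_map,
      List.length_map]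
    dsimp only
    omega
  rw [blockLen_pairCode, blockLen_pairCode]
  constructor
  · rintro ⟨h1, -, h2⟩
    have hj : j + 1 < (bs ++ cs).length := by
      by_contra hj
      rw [List.getElem?_eq_none (by omega)] at h2
      exact hg.ne h2
    rw [List.getElem?_eq_getElem (by omega)] at h1 h2 ⊢
    rw [List.getElem?_eq_getElem hj]
    exact ⟨congrArg some h1, congrArg some h2⟩
  · rintro ⟨h1, h2⟩
    have hj := (List.getElem?_eq_some_iff.1 h2).1
    rw [h1, h2]
    exact ⟨rfl, by omega, rfl⟩

/-- The only number of the instance that is not less than n is the first one. It has no predecessor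
and is no vertex, so the instance contributes no pair and only those of the certificate are counted.
-/
theorem pairCount_encode (I : ArrivalInstance) (L : List (Fin I.n × ℕ)) (v : Fin I.n) (b : ℕ) :
    pairCount (pairCode (I.encode, (pairBlocks L).flatMap unaryCode)) v (I.n + b) =
      L.count (v, b) := by
  have hv := v.2
  have ho := I.o.2
  have hd := I.d.2
  have hL := flatMap_unaryCode_length (pairBlocks L)
  have hI := I.le_encode_length
  have hbl := I.blocks_length
  rw [pairBlocks_length] at hL
  rw [I.encode_eq, pairCount_pairCode _ _ (by omega)]
  have hlen : (pairCode (I.blocks.flatMap unaryCode, (pairBlocks L).flatMap unaryCode)).length =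
      I.encode.length + 1 + ((pairBlocks L).flatMap unaryCode).length := by
    rw [pairCode, List.length_append, List.length_cons, List.length_map, List.length_map,
      I.encode_eq]
    ring
  obtain ⟨M, hM⟩ := Nat.exists_eq_add_of_le (show I.blocks.length + 2 * L.length ≤
    (pairCode (I.blocks.flatMap unaryCode, (pairBlocks L).flatMap unaryCode)).length by omega)
  rw [hM, add_assoc, ← consecutive_pairBlocks L v b (N := 2 * L.length + M) (by omega)]
  have htail : ∀ k ∈ I.blocks.tail, k < I.n := by
    intro k hk
    simp only [ArrivalInstance.blocks, List.tail_cons, List.mem_cons, List.mem_flatMap,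
      List.not_mem_nil, or_false] at hk
    rcases hk with rfl | rfl | ⟨v, -, rfl | rfl⟩
    · exact ho
    · exact hd
    · exact (I.G.s₀ v).2
    · exact (I.G.s₁ v).2
  have hb : I.blocks = I.n :: I.blocks.tail := rfl
  rw [hb, List.cons_append, List.length_cons,
    show I.blocks.tail.length + 1 + (2 * L.length + M) =
      I.blocks.tail.length + (2 * L.length + M) + 1 by ring,
    consecutive_cons, if_neg (by omega), add_zero]
  refine consecutive_append (fun k hk => ?_) fun k hk => ?_
  · have := htail k hk
    omega
  · have := pairBlocks_head hk
    omega

theorem exists_verifier {I : ArrivalInstance} (h : ¬ I.Yes) :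
    ∃ y : List Bool, y.length ≤ (4 * I.n + 2) * (2 * I.n * I.n * (4 * I.n + 1)) ∧
      verifier (I.encode, y) = true := by
  obtain ⟨T, hT, hbd⟩ := I.G.exists_isCertificate I.o h
  rw [Fintype.card_fin] at hbd
  -- Each pair of a vertex and a column is listed as often as its total says; the 2n columns suffice
  -- because later totals vanish. A pair costs at most 4n ones and two zeros, which gives the factor
  -- 4n + 2.
  obtain ⟨L, hL, hl⟩ := exists_list_count_eq (fun p : Fin I.n × ℕ => T p.1 p.2)
    (Finset.univ ×ˢ Finset.range (2 * I.n))
  have hlt : ∀ p ∈ L, p.2 < 2 * I.n := by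
    intro p hp
    by_contra hc
    have := hL p
    rw [if_neg (by simpa using hc), List.count_eq_zero] at this
    exact this hp
  refine ⟨(pairBlocks L).flatMap unaryCode, ?_, ?_⟩
  · have h1 : L.length ≤ 2 * I.n * I.n * (4 * I.n + 1) := by
      rw [hl]
      refine (Finset.sum_le_card_nsmul _ _ _ fun p _ => (hbd p.1 p.2).1).trans_eq ?_
      rw [Finset.card_product, Finset.card_univ, Fintype.card_fin, Finset.card_range, smul_eq_mul]
      ring
    have h2 := pairBlocks_sum_le hlt
    have h3 := I.o.2
    rw [flatMap_unaryCode_length, pairBlocks_length]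
    calc (pairBlocks L).sum + 2 * L.length ≤ (2 * I.n + 2 * I.n) * L.length + 2 * L.length := by
          omega
      _ = (4 * I.n + 2) * L.length := by ring
      _ ≤ (4 * I.n + 2) * (2 * I.n * I.n * (4 * I.n + 1)) := Nat.mul_le_mul_left _ h1
  · rw [verifier_encode]
    convert hT using 3 with v b
    rw [pairCount_encode, hL]
    split_ifs with hb
    · rfl
    · exact ((hbd v b).2 (by simpa using hb)).symm

end Sweep

/-! ### Membership in coNP and the conclusion. -/

theorem inCoNP_ARRIVAL : InCoNP ARRIVAL := by
  refine ⟨(4 * Polynomial.X + 2) * (2 * Polynomial.X * Polynomial.X * (4 * Polynomial.X + 1)),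
    Sweep.verifier, Sweep.polyTime_verifier, fun x => ?_⟩
  by_cases hx : ∃ I : ArrivalInstance, I.encode = x
  · obtain ⟨I, rfl⟩ := hx
    have hI : I.encode ∈ ARRIVALᶜ ↔ ¬ I.Yes := by
      refine not_congr ⟨?_, fun h => ⟨I, rfl, h⟩⟩
      rintro ⟨J, hJ, h⟩
      rwa [← ArrivalInstance.encode_injective hJ]
    rw [hI]
    constructor
    · intro h
      obtain ⟨y, hy, hv⟩ := Sweep.exists_verifier h
      refine ⟨y, hy.trans ?_, hv⟩
      have hn : I.n ≤ I.encode.length := by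
        have := I.le_encode_length
        omega
      simp only [Polynomial.eval_mul, Polynomial.eval_one, Polynomial.eval_add, Polynomial.eval_X,
        Polynomial.eval_ofNat]
      gcongr
    · rintro ⟨y, -, hv⟩
      exact Sweep.not_yes_of_verifier hv
  -- Strings that encode no instance belong to the complement, and the verifier accepts them with
  -- the empty certificate.
  · refine ⟨fun _ => ⟨[], Nat.zero_le _, Sweep.verifier_of_not_code hx⟩, fun _ => ?_⟩
    rintro ⟨I, hI, -⟩
    exact hx ⟨I, hI⟩

theorem mainTheorem2 :
    InCoNP ARRIVAL ∧
    (∀ (V : Type*) [Fintype V] [DecidableEq V] (G : SwitchGraph V) (o d : V) (a b : Option V),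
      G.RunTerminates o d ↔ ¬ (G.bar d a b).RunTerminates (some o) none) ∧
    ∃ f : ArrivalInstance → ArrivalInstance,
      Nonempty (Turing.TM2ComputableInPolyTime
        ArrivalInstance.encode ArrivalInstance.encode f) ∧
      ∀ I : ArrivalInstance,
        (∃ a b : Option (Fin I.n), f I = I.bar a b) ∧ (I.Yes ↔ ¬ (f I).Yes) :=
  ⟨inCoNP_ARRIVAL, fun _ _ _ G o d a b => runTerminates_iff_not_bar G o d a b,
    fun I => I.bar none none, Sweep.polyTime_bar,
    fun I => ⟨⟨none, none, rfl⟩, I.yes_iff_not_bar none none⟩⟩
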